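/- **Setting.** Consider a finite average-reward Markov decision process $(\mathcal S,\mathcal A,\mathsf P,c)$ with $|c(s,a)|\le\bar c$ (unregularized). For a stationary randomized policy $\pi$ let $P_\pi$ and $P^\pi$ be the transition matrices on states and on state-action pairs. Assume ergodicity: for every policy $\pi$ the chain $P_\pi$ is irreducible and aperiodic, with stationary distribution $\nu^\pi$. Put $\rho(\pi)=\sum_{s,a}\nu^\pi(s)\pi(a|s)c(s,a)$, $\rho^*=\inf_\pi\rho(\pi)$, $\bar Q^\pi=\sum_{t\ge0}(P^\pi)^t(c-\rho(\pi)\mathbf 1)$, and let $t_{\rm mix}$ be the maximum over $\pi$ of the least $t\ge1$ with $\|(P_\pi^t)^\top q-\nu^\pi\|_1\le\frac12$ for all initial distributions $q$. **Features.** Let $\Psi\in\mathbb R^{(\mathcal S\times\mathcal A)\times d}$, $d\ge1$, have rows $\psi(s,a)$ with $\|\psi(s,a)\|_2\le1$, and let $\mathbb S=\operatorname{im}\Psi$. With $D^\pi=\operatorname{diag}(\nu^\pi(s)\pi(a|s))$ let $1-\beta_\pi$ be the infimum of $x^\top D^\pi(I-P^\pi)x$ over $x\in\mathbb S$ with $\|x\|_{D^\pi}=1$.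 Assume that the feature space is chosen so that $1-\beta_\pi>0$ and $\frac1{1-\beta_\pi}\le\chi\,t_{\rm mix}$ for all $\pi$, with a constant $\chi>0$. **Exploration.** For each $\pi$ fix $0<\underline\pi<1$ and put $\mathcal A_s=\{a:\pi(a|s)>\underline\pi/2\}$. Assume $$\underline\pi\,\bigl(|\mathcal A|-\min_s|\mathcal A_s|\bigr)\bigl(8+(1-\beta_\pi)\min_s\nu^\pi(s)\bigr)\le(1-\beta_\pi)\min_s\nu^\pi(s).$$ The perturbed policy is $\widetilde\pi(a|s)=\underline\pi$ for $a\notin\mathcal A_s$ and $\widetilde\pi(a|s)=\pi(a|s)\frac{1-(|\mathcal A|-|\mathcal A_s|)\underline\pi}{\sum_{a'\in\mathcal A_s}\pi(a'|s)}$ for $a\in\mathcal A_s$. Put $\widetilde D^\pi=\operatorname{diag}(\nu^\pi(s)\widetilde\pi(a|s))$ and let $\theta^*_\pi$ be the solution of $\Psi^\top\widetilde D^\pi\Psi\theta=\Psi^\top\widetilde D^\pi P^\pi\Psi\theta+\Psi^\top\widetilde D^\pi(c-\rho(\pi)\mathbf 1)$. Let $\epsilon_{\rm approx}=\sup_\pi\min_{b\in\mathbb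 R}\|\Psi\theta^*_\pi+b\mathbf 1-\bar Q^\pi\|_\infty$. Let $\bar\mu,\ell>0$ be lower bounds, for all $\pi$, of $\lambda_{\min}(\Psi^\top\widetilde D^\pi\Psi)$ and of $\lambda_{\min}(\widetilde D^\pi)$. For $\epsilon>0$ put $X=\dfrac{t_{\rm mix}\,(2+\bar c/\epsilon)}{\bar\mu\,\ell}$. **Critic (exploratory variance-reduced temporal difference method, EVRTD).** With $\widetilde g(\theta,\rho,\xi)=(\langle\psi(s,a)-\psi(s',a'),\theta\rangle-c(s,a)+\rho)\psi(s,a)$ for $\xi=\{(s,a),(s',a')\}$ and $\widehat\theta=0$ initially, each epoch works on one trajectory of the policy $\pi$ as follows. - It lets $\widetilde\theta$ be the previous output, and $\widetilde\rho$ the average of the costs of $N'$ state-action samples, each the last of $\tau'+1$ successive ones. - It lets $\widehat g$ be the average of $\widetilde g(\widetilde\theta,\widetilde\rho,\cdot)$ over $N$ observations, each obtained by $\tau'$ steps under $\pi$ to a state $s$ and then $a\sim\widetilde\pi(\cdot|s)$, $s'\sim\mathsf P(\cdot|s,a)$, $a'\sim\pi(\cdot|s')$. - Starting from $\theta_1=\widetilde\theta$,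 it performs $T$ updates $\theta_{t+1}=\theta_t-\eta(\widetilde g(\theta_t,\widetilde\rho,\xi_t)-\widetilde g(\widetilde\theta,\widetilde\rho,\xi_t)+\widehat g)$ with observations $\xi_t$ obtained in the same way with $\tau$ in place of $\tau'$, and outputs $\frac1T\sum_{t=1}^T\theta_t$. After the last epoch the estimate of $\bar Q^\pi$ is $\widehat Q=\Psi\widehat\theta$. A parameter selection $(\eta,T,N,N',\tau,\tau')$ is *admissible* if, for some $C_P>0$, $\varrho\in(0,1)$ with $\max_s\|(P_\pi)^t_{(s,\cdot)}-\nu^\pi\|_1\le C_P\varrho^t$ for all $\pi$ and $t$, there is for each $\pi$ a number $b>0$ with $x^\top\widetilde D^\pi(I-P^\pi)x\ge b\|x\|^2_{\widetilde D^\pi}$ on $\mathbb S$ such that $0<\eta\le\frac b{845}$, $T\ge\frac{64}{\bar\mu b\eta}$, $N\ge\frac{1160}{\bar\mu b^2}$, $N'\ge\frac1{\bar\mu b^2}$, $C_M\varrho^\tau\le\sqrt{\bar\mu}\,\eta$ and $\varrho^{\tau'}\le\min\{\lambda_{\min}(\widetilde D^\pi)/C_P,\,1/(4\max\{C_P,C_M,C_R\}+1)\}$,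 where $C_M=C_P\lambda_{\min}(\widetilde D^\pi)^{-1/2}\|\Psi\|_2\|I-P^\pi\|_2$ and $C_R=C_P\|\Psi\|_2$. **Actor (stochastic policy mirror descent, SPMD).** Start from the uniform policy $\pi_0$ and any initial state. In iteration $k$ let $\widehat Q_k$ be the estimate of the critic for $\pi_k$ on the continued trajectory, and let $\pi_{k+1}(\cdot|s)$ be the minimizer of $\lambda\langle\widehat Q_k(s,\cdot),p\rangle+\mathrm{KL}(p\,\|\,\pi_k(\cdot|s))$ over the distributions $p$ on $\mathcal A$, with $\lambda=\frac{\sqrt{2\log|\mathcal A|}}{\kappa\sqrt K}$. After $K$ iterations output $\widehat\pi=\pi_r$ with $r$ uniform on $\{0,\dots,K-1\}$. **Claim.** There are universal constants $C>0$ and $p\in\mathbb N$, and for every $\chi>0$ constants $C',C''>0$ depending only on $\chi$, such that for every such process, all such features and exploration levels, and every $\epsilon>0$, there is an admissible parameter selection with which the critic, run for $\lceil C'\log X\rceil$ epochs, has the following properties. 1. For every $\kappa>0$ there is a number $1\le K\le1+C\,\frac{\kappa^2\log|\mathcal A|}{\epsilon^2}$ of SPMD iterations such that, for every initial state, the total number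 of sampled state-action transitions is always at most $$C''\,\frac{t_{\rm mix}^3}{\bar\mu}\Bigl(1+\frac{\kappa^2}{\epsilon^2}\Bigr)(\log X)^p,$$ and if, for all $k<K$, the conditional expectation of $\min_{b}\|\widehat Q_k+b\mathbf 1\|_\infty^2$ given $\pi_k$ and the current state is at most $\kappa^2$, then $$\mathbb E[\rho(\widehat\pi)]-\rho^*\le C\,\epsilon_{\rm approx}+\epsilon .$$ 2. For every policy $\pi$ and every current state of the trajectory, $$\mathbb E\bigl[\min_b\|\widehat Q+b\mathbf 1\|_\infty^2\bigr]\le2\sup_{\pi'}\|\Psi\theta^*_{\pi'}\|_\infty^2+C\,\sup_{\pi'}\frac{\bar c^2+\|\theta^*_{\pi'}\|_2^2}{\lambda_{\min}(\widetilde D^{\pi'})},$$ so that $\kappa^2$ can be taken to be the right-hand side. -/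

import Mathlib

noncomputable section

namespace AMDP

/-! ### Average-reward Markov decision processes -/

/-- A finite average-reward MDP: `trans s a` is the distribution of the next state when the action
`a` is taken in the state `s`, and `cost s a` is the cost that is paid then. -/
structure Model (S A : Type) [Fintype S] where
  trans : S → A → stdSimplex ℝ S
  cost : S → A → ℝ

/-- A randomized stationary policy: `π s` is the distribution of the action in the state `s`. -/
abbrev Policy (S A : Type) [Fintype A] := S → stdSimplex ℝ A

variable {S A : Type} [Fintype S] [DecidableEq S] [Fintype A] [DecidableEq A] {d : ℕ}

/-- The state transition matrix of a policy. -/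
def stateMatrix (M : Model S A) (π : Policy S A) : Matrix S S ℝ :=
  Matrix.of fun s s' => ∑ a, π s a * M.trans s a s'

/-- The state-action transition matrix of a policy. -/
def pairMatrix (M : Model S A) (π : Policy S A) : Matrix (S × A) (S × A) ℝ :=
  Matrix.of fun x y => M.trans x.1 x.2 y.1 * π y.1 y.2

/-- The cost function as a vector indexed by the state-action pairs. -/
def costVec (M : Model S A) : S × A → ℝ := fun x => M.cost x.1 x.2

/-- `ν` is a stationary distribution of the chain of states that `π` induces. -/
def IsStationary (M : Model S A) (π : Policy S A) (ν : stdSimplex ℝ S) : Prop :=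
  ∀ s', ∑ s, ν s * stateMatrix M π s s' = ν s'

open Classical in
/-- The stationary distribution of a policy (it exists, and it is unique for ergodic models). -/
def stationary (M : Model S A) (π : Policy S A) : S → ℝ :=
  if h : ∃ ν, IsStationary M π ν then ⇑h.choose else 0

/-- The chain with transition matrix `P` is aperiodic: the return times of each state have greatest
common divisor one. -/
def IsAperiodic (P : Matrix S S ℝ) : Prop :=
  ∀ s, ∀ m : ℕ, (∀ n : ℕ, 0 < n → 0 < (P ^ n) s s → m ∣ n) → m = 1

/-- Ergodicity: every policy induces an irreducible and aperiodic chain. -/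
def IsErgodic (M : Model S A) : Prop :=
  ∀ π : Policy S A, (stateMatrix M π).IsIrreducible ∧ IsAperiodic (stateMatrix M π)

/-- The least `t ≥ 1` such that the law of the chain at time `t` is, for each initial distribution
`q`, within `1 / 2` of the stationary one in the `ℓ₁`-norm. -/
def policyMixingTime (M : Model S A) (π : Policy S A) : ℕ :=
  sInf {t : ℕ | 1 ≤ t ∧ ∀ q : stdSimplex ℝ S,
    ∑ s', |(∑ s, q s * (stateMatrix M π ^ t) s s') - stationary M π s'| ≤ 1 / 2}

/-- The mixing time of the model: the largest mixing time of a policy. -/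
def mixingTime (M : Model S A) : ℕ := ⨆ π : Policy S A, policyMixingTime M π

/-- The long-run average cost of a policy. -/
def avgCost (M : Model S A) (π : Policy S A) : ℝ :=
  ∑ s, stationary M π s * ∑ a, π s a * M.cost s a

/-- The basic differential Q-function: the sum over all times `t` of the expected value of
`cost - avgCost` at time `t`, when the chain starts from a given state-action pair. -/
def diffQ (M : Model S A) (π : Policy S A) : S × A → ℝ := fun x =>
  ∑' t : ℕ, ((pairMatrix M π ^ t).mulVec fun y => costVec M y - avgCost M π) x

/-! ### Perturbed policies and linear function approximation -/

open Classical in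
/-- The number of actions `a` with `p a ≤ u / 2`. -/
def numRare (u : ℝ) (p : stdSimplex ℝ A) : ℕ :=
  (Finset.univ.filter fun a => ¬ u / 2 < p a).card

open Classical in
/-- The perturbation of a distribution on the actions: each action of probability at most `u / 2`
gets the probability `u`, and the other probabilities are scaled down. -/
def perturbWeights (u : ℝ) (p : stdSimplex ℝ A) : A → ℝ := fun a =>
  if u / 2 < p a then
    p a * ((1 - numRare u p * u) / ∑ a' ∈ Finset.univ.filter (fun a' => u / 2 < p a'), p a')
  else u

open Classical in
/-- The perturbed policy. (If `u` is so large that the perturbed weights are no distribution, then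
the policy is left as it is.) -/
def perturb (u : ℝ) (π : Policy S A) : Policy S A := fun s =>
  if h : perturbWeights u (π s) ∈ stdSimplex ℝ A then ⟨perturbWeights u (π s), h⟩ else π s

/-- The law of `(s, a)` when `s` has the stationary distribution of `π` and `a` has the law `π' s`:
the diagonal of the matrix `D` (if `π' = π`) or `D̃` (if `π'` is the perturbed policy). -/
def weight (M : Model S A) (π π' : Policy S A) : S × A → ℝ := fun x =>
  stationary M π x.1 * π' x.1 x.2

/-- The quadratic form `θ ↦ θᵀ Ψᵀ D (I - P) Ψ θ`. -/
def dirichlet (M : Model S A) (Ψ : Matrix (S × A) (Fin d) ℝ) (π π' : Policy S A)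
    (θ : Fin d → ℝ) : ℝ :=
  (Ψ.mulVec θ) ⬝ᵥ ((Matrix.diagonal (weight M π π') * (1 - pairMatrix M π)).mulVec (Ψ.mulVec θ))

/-- The quadratic form `θ ↦ θᵀ Ψᵀ D Ψ θ`, which is the squared `D`-norm of `Ψ θ`. -/
def normSq (M : Model S A) (Ψ : Matrix (S × A) (Fin d) ℝ) (π π' : Policy S A)
    (θ : Fin d → ℝ) : ℝ :=
  (Ψ.mulVec θ) ⬝ᵥ ((Matrix.diagonal (weight M π π')).mulVec (Ψ.mulVec θ))

/-- `b` is positive and at most the infimum of `xᵀ D (I - P) x` over the vectors `x` of the feature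
space with `D`-norm one (this infimum is the constant `1 - β`). -/
def IsModulus (M : Model S A) (Ψ : Matrix (S × A) (Fin d) ℝ) (π π' : Policy S A) (b : ℝ) : Prop :=
  0 < b ∧ ∀ θ : Fin d → ℝ, b * normSq M Ψ π π' θ ≤ dirichlet M Ψ π π' θ

/-- The requirement on the exploration level `u` for the policy `π`:
`u ≤ (1 - β) ν_min / ((|𝒜| - min_s |𝒜_s|) (8 + (1 - β) ν_min))`, and `0 < u < 1`. -/
def IsExploration (M : Model S A) (Ψ : Matrix (S × A) (Fin d) ℝ) (π : Policy S A) (u : ℝ) : Prop :=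
  0 < u ∧ u < 1 ∧ ∃ b : ℝ, IsModulus M Ψ π π b ∧
    ∀ s : S, u * (numRare u (π s) * (8 + b * ⨅ s', stationary M π s')) ≤
      b * ⨅ s', stationary M π s'

/-- The projected Bellman equation
`Ψᵀ D Ψ θ = Ψᵀ D P Ψ θ + Ψᵀ D (c - ρ 1)` with the weights of `(π, π')`. -/
def ProjectedBellman (M : Model S A) (Ψ : Matrix (S × A) (Fin d) ℝ) (π π' : Policy S A)
    (θ : Fin d → ℝ) : Prop :=
  (Ψ.transpose * Matrix.diagonal (weight M π π') * Ψ).mulVec θ =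
    (Ψ.transpose * Matrix.diagonal (weight M π π') * pairMatrix M π * Ψ).mulVec θ +
    (Ψ.transpose * Matrix.diagonal (weight M π π')).mulVec fun x => costVec M x - avgCost M π

open Classical in
/-- The solution of the projected Bellman equation of the policy `π` with exploration level `u`. -/
def thetaStar (M : Model S A) (Ψ : Matrix (S × A) (Fin d) ℝ) (u : ℝ) (π : Policy S A) :
    Fin d → ℝ :=
  if h : ∃ θ, ProjectedBellman M Ψ π (perturb u π) θ then h.choose else 0

/-- The distance of `Q` from the constant functions in the supremum norm. -/
def spanNorm (Q : S × A → ℝ) : ℝ := ⨅ b : ℝ, ‖fun x => Q x + b‖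

/-- The approximation error of the feature space, where `u π` is the exploration level that is
used for the policy `π`. -/
def approxError (M : Model S A) (Ψ : Matrix (S × A) (Fin d) ℝ) (u : Policy S A → ℝ) : ℝ :=
  ⨆ π : Policy S A, spanNorm fun x => Ψ.mulVec (thetaStar M Ψ (u π) π) x - diffQ M π x

/-! ### Sampling -/

/-- The probability mass function of a point of the simplex. -/
def draw {B : Type} [Fintype B] (p : stdSimplex ℝ B) : PMF B :=
  PMF.ofFintype (fun b => ENNReal.ofReal (p b)) <| by
    have h : ∑ b, ENNReal.ofReal (p b) = ENNReal.ofReal (∑ b, p b) :=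
      (ENNReal.ofReal_sum_of_nonneg fun b _ => p.2.1 b).symm
    exact (h.trans (congrArg ENNReal.ofReal p.2.2)).trans ENNReal.ofReal_one

/-- The expectation of `f` under `p` (below, `p` always has finite support). -/
def expect {B : Type} (p : PMF B) (f : B → ℝ) : ℝ := ∑' b, (p b).toReal * f b

/-- The current state of the trajectory, the action that the policy has chosen there, and the
number of state-action transitions that have been sampled so far. -/
structure Traj (S A : Type) where
  state : S
  action : A
  samples : ℕ

/-- An observation `{(s, a), (s', a')}`; the cost `c(s, a)` is a function of it. -/
structure Obs (S A : Type) where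
  cur : S × A
  next : S × A

/-- One transition of the trajectory under the policy `π`. -/
def step (M : Model S A) (π : Policy S A) (z : Traj S A) : PMF (Traj S A) :=
  (draw (M.trans z.state z.action)).bind fun s => (draw (π s)).map fun a => ⟨s, a, z.samples + 1⟩

/-- `n` transitions of the trajectory under the policy `π`. -/
def advance (M : Model S A) (π : Policy S A) : ℕ → Traj S A → PMF (Traj S A)
  | 0, z => PMF.pure z
  | n + 1, z => (step M π z).bind (advance M π n)

/-- Run the trajectory under `π` for `τ` steps to a state `s`; then draw `a ∼ π' s`,
`s' ∼ trans s a` and `a' ∼ π s'`, and observe `{(s, a), (s', a')}`. -/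
def explore (M : Model S A) (π π' : Policy S A) (τ : ℕ) (z : Traj S A) :
    PMF (Obs S A × Traj S A) :=
  (advance M π τ z).bind fun y =>
    (draw (π' y.state)).bind fun a =>
      (draw (M.trans y.state a)).bind fun s' =>
        (draw (π s')).map fun a' => (⟨(y.state, a), (s', a')⟩, ⟨s', a', y.samples + 1⟩)

/-- The stochastic temporal difference operator
`(⟨ψ(s, a) - ψ(s', a'), θ⟩ - c(s, a) + ρ) ψ(s, a)`. -/
def tdOperator (M : Model S A) (Ψ : Matrix (S × A) (Fin d) ℝ) (θ : Fin d → ℝ) (ρ : ℝ)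
    (ξ : Obs S A) : Fin d → ℝ :=
  ((Ψ ξ.cur - Ψ ξ.next) ⬝ᵥ θ - M.cost ξ.cur.1 ξ.cur.2 + ρ) • Ψ ξ.cur

/-! ### The critic: exploratory variance-reduced temporal difference learning -/

/-- The parameters of the critic: the number of epochs, the step size, the number `T` of inner
iterations, the batch sizes `N` and `N'`, and the numbers `τ` and `τ'` of skipped samples. -/
structure Params where
  epochs : ℕ
  η : ℝ
  T : ℕ
  N : ℕ
  N' : ℕ
  τ : ℕ
  τ' : ℕ

/-- The sum of the costs of `n` state-action samples, each of which is the last one of `τ' + 1`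
successive samples of the trajectory. -/
def costSum (M : Model S A) (π : Policy S A) (τ' : ℕ) : ℕ → Traj S A → PMF (ℝ × Traj S A)
  | 0, z => PMF.pure (0, z)
  | n + 1, z => (advance M π (τ' + 1) z).bind fun y =>
      (costSum M π τ' n y).map fun r => (M.cost y.state y.action + r.1, r.2)

/-- The sum of the stochastic operator at `(θ, ρ)` over `n` exploratory observations. -/
def operatorSum (M : Model S A) (Ψ : Matrix (S × A) (Fin d) ℝ) (π π' : Policy S A) (τ' : ℕ)
    (θ : Fin d → ℝ) (ρ : ℝ) : ℕ → Traj S A → PMF ((Fin d → ℝ) × Traj S A)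
  | 0, z => PMF.pure (0, z)
  | n + 1, z => (explore M π π' τ' z).bind fun r =>
      (operatorSum M Ψ π π' τ' θ ρ n r.2).map fun q => (tdOperator M Ψ θ ρ r.1 + q.1, q.2)

/-- `n` variance-reduced updates of `θ`, recentered at `θ₀` with the batch average `g`; the
iterates (before their updates) are added up in `acc`. -/
def innerLoop (M : Model S A) (Ψ : Matrix (S × A) (Fin d) ℝ) (π π' : Policy S A) (η : ℝ) (τ : ℕ)
    (θ₀ : Fin d → ℝ) (ρ : ℝ) (g : Fin d → ℝ) :
    ℕ → (Fin d → ℝ) → (Fin d → ℝ) → Traj S A → PMF ((Fin d → ℝ) × Traj S A)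
  | 0, _, acc, z => PMF.pure (acc, z)
  | n + 1, θ, acc, z => (explore M π π' τ z).bind fun r =>
      innerLoop M Ψ π π' η τ θ₀ ρ g n
        (θ - η • (tdOperator M Ψ θ ρ r.1 - tdOperator M Ψ θ₀ ρ r.1 + g)) (acc + θ) r.2

/-- One epoch: estimate the average cost, estimate the operator at `θ₀`, perform `T` updates
starting from `θ₀`, and return the average of the iterates. -/
def epoch (M : Model S A) (Ψ : Matrix (S × A) (Fin d) ℝ) (π π' : Policy S A) (prm : Params)
    (θ₀ : Fin d → ℝ) (z : Traj S A) : PMF ((Fin d → ℝ) × Traj S A) :=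
  (costSum M π prm.τ' prm.N' z).bind fun r =>
    (operatorSum M Ψ π π' prm.τ' θ₀ (r.1 / prm.N') prm.N r.2).bind fun q =>
      (innerLoop M Ψ π π' prm.η prm.τ θ₀ (r.1 / prm.N') ((prm.N : ℝ)⁻¹ • q.1) prm.T θ₀ 0 q.2).map
        fun w => ((prm.T : ℝ)⁻¹ • w.1, w.2)

/-- `n` consecutive epochs. -/
def runEpochs (M : Model S A) (Ψ : Matrix (S × A) (Fin d) ℝ) (π π' : Policy S A) (prm : Params) :
    ℕ → (Fin d → ℝ) → Traj S A → PMF ((Fin d → ℝ) × Traj S A)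
  | 0, θ, z => PMF.pure (θ, z)
  | n + 1, θ, z => (epoch M Ψ π π' prm θ z).bind fun r => runEpochs M Ψ π π' prm n r.1 r.2

/-- The critic for the policy `π` with exploration level `u`, initialized at `θ = 0`, with the
trajectory in the state `s` after `m` samples: the estimate of the differential Q-function, and
the trajectory afterwards. -/
def critic (M : Model S A) (Ψ : Matrix (S × A) (Fin d) ℝ) (u : ℝ) (prm : Params)
    (π : Policy S A) (s : S) (m : ℕ) : PMF ((S × A → ℝ) × Traj S A) :=
  (draw (π s)).bind fun a =>
    (runEpochs M Ψ π (perturb u π) prm prm.epochs 0 ⟨s, a, m⟩).map fun r => (Ψ.mulVec r.1, r.2)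

/-- The second moment `𝔼 min_b ‖Q + b 1‖_∞²` of the estimate of the critic, for the policy `π` and
a trajectory that is in the state `s`. -/
def criticSecondMoment (M : Model S A) (Ψ : Matrix (S × A) (Fin d) ℝ) (u : ℝ) (prm : Params)
    (π : Policy S A) (s : S) : ℝ :=
  expect (critic M Ψ u prm π s 0) fun r => spanNorm r.1 ^ 2

section Selection

open scoped Matrix.Norms.L2Operator

/-- `C_P` and `ϱ` are constants of geometric mixing that are valid for all policies. -/
def IsMixingRate (M : Model S A) (CP ϱ : ℝ) : Prop :=
  0 < CP ∧ 0 < ϱ ∧ ϱ < 1 ∧ ∀ (π : Policy S A) (t : ℕ) (s : S),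
    ∑ s', |(stateMatrix M π ^ t) s s' - stationary M π s'| ≤ CP * ϱ ^ t

/-- The constant `C_M`; the norms are spectral norms. -/
def biasConst (M : Model S A) (Ψ : Matrix (S × A) (Fin d) ℝ) (π π' : Policy S A) (CP : ℝ) : ℝ :=
  CP / √(⨅ x, weight M π π' x) * ‖Ψ‖ * ‖1 - pairMatrix M π‖

/-- The parameter selection of the critic for the policy `π` with exploration level `u`, where
`μ` is (a lower bound of) the smallest eigenvalue of the Gram matrix of the features, `C_P` and `ϱ`
are constants of geometric mixing, and `b` is the strong monotonicity modulus of the operator. -/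
def IsSelection (M : Model S A) (Ψ : Matrix (S × A) (Fin d) ℝ) (u μ CP ϱ : ℝ) (π : Policy S A)
    (prm : Params) : Prop :=
  ∃ b : ℝ, IsModulus M Ψ π (perturb u π) b ∧
    0 < prm.η ∧ prm.η ≤ b / 845 ∧
    64 / (μ * b * prm.η) ≤ prm.T ∧
    1160 / (μ * b ^ 2) ≤ prm.N ∧
    1 / (μ * b ^ 2) ≤ prm.N' ∧
    biasConst M Ψ π (perturb u π) CP * ϱ ^ prm.τ ≤ √μ * prm.η ∧
    CP * ϱ ^ prm.τ' ≤ ⨅ x, weight M π (perturb u π) x ∧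
    ϱ ^ prm.τ' ≤ 1 / (4 * max CP (max (biasConst M Ψ π (perturb u π) CP) (CP * ‖Ψ‖)) + 1)

end Selection

/-! ### The actor: stochastic policy mirror descent -/

/-- The Kullback-Leibler divergence of `p` from `q` (below, `q` is always positive). -/
def kl (p q : stdSimplex ℝ A) : ℝ := ∑ a, p a * Real.log (p a / q a)

open Classical in
/-- The mirror descent update: `π_{k+1} s` minimizes `lam * ⟨Q(s, ·), p⟩ + kl p (π_k s)` over the
distributions `p` on the actions. -/
def proxPolicy (lam : ℝ) (Q : S × A → ℝ) (π : Policy S A) : Policy S A := fun s =>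
  if h : ∃ p : stdSimplex ℝ A, ∀ q : stdSimplex ℝ A,
      lam * ∑ a, Q (s, a) * p a + kl p (π s) ≤ lam * ∑ a, Q (s, a) * q a + kl q (π s)
  then h.choose else π s

/-- The uniform policy. -/
def uniformPolicy [Nonempty A] : Policy S A := fun _ =>
  ⟨fun _ => (Fintype.card A : ℝ)⁻¹, fun _ => by positivity, by
    simp [Finset.sum_const, Fintype.card_ne_zero]⟩

/-- What is known before an iteration of the actor: the current policy, the current state of the
trajectory, and the number of state-action transitions that have been sampled so far. -/
structure Iterate (S A : Type) [Fintype A] where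
  policy : Policy S A
  state : S
  samples : ℕ

/-- The law of the situation after `k` iterations of stochastic policy mirror descent with the
step size `lam`, on a single trajectory that starts in the state `s₀`. -/
def spmd [Nonempty A] (M : Model S A) (Ψ : Matrix (S × A) (Fin d) ℝ) (u : Policy S A → ℝ)
    (prm : Params) (lam : ℝ) (s₀ : S) : ℕ → PMF (Iterate S A)
  | 0 => PMF.pure ⟨uniformPolicy, s₀, 0⟩
  | k + 1 => (spmd M Ψ u prm lam s₀ k).bind fun z =>
      (critic M Ψ (u z.policy) prm z.policy z.state z.samples).map fun r =>
        ⟨proxPolicy lam r.1 z.policy, r.2.state, r.2.samples⟩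

/-- The law of the output `π_r`, where `r` is uniform on `{0, …, K - 1}` and independent of the
iterates. -/
def spmdOutput [Nonempty A] (M : Model S A) (Ψ : Matrix (S × A) (Fin d) ℝ) (u : Policy S A → ℝ)
    (prm : Params) (lam : ℝ) (s₀ : S) (K : ℕ) (hK : 0 < K) : PMF (Policy S A) :=
  (PMF.uniformOfFinset (Finset.range K) (Finset.nonempty_range_iff.2 hK.ne')).bind fun r =>
    (spmd M Ψ u prm lam s₀ r).map Iterate.policy

/-- The step size `√(2 log |𝒜|) / (κ √K)`. -/
def stepSize (A : Type) [Fintype A] (κ : ℝ) (K : ℕ) : ℝ :=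
  √(2 * Real.log (Fintype.card A)) / (κ * √K)

/-- The quantity whose logarithm the complexity bounds contain: a product of the problem
parameters and their inverses. -/
def logArg (M : Model S A) (cbar μ ℓ ε : ℝ) : ℝ :=
  mixingTime M * (2 + cbar / ε) / (μ * ℓ)

end AMDP

end

/-! Only the bias of the critic has to be small; its second moment may stay of constant order, so
the number of samples per call of the critic depends on `ε` only through logarithms.

Actor. The one-step inequality of mirror descent (`proxPolicy_le`) is linear in the estimate `Q̂`,
up to `λ²` times its squared span norm. Conditionally on the current policy and state, the linear
term therefore sees just the mean of `Q̂`, and the performance difference lemma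
(`avgCost_sub_avgCost`) turns it into `ρ(π_k) - ρ(π)`, up to twice the span distance of this mean
from the true differential Q-function. Averaged over the stationary distribution of a fixed
comparator `π`, the relative entropies telescope (`spmd_sum_le`). What remains is `log|𝒜| / (λK) +
4λκ² + 2 · bias`, so that `K` of order `κ² log|𝒜| / ε²` suffices (`spmdOutput_le`).

Critic. Let `A = Ψᵀ D̃ (I - P) Ψ`. Given the batch average `g` at `θ₀`, the inner loop is a
stochastic iteration whose stationary mean step is `-η A (θ - θc)`, where the random point `θc`
solves `A (θ₀ - θc) = g`. Two quantities are followed. Second moments: `descent` and averaging pull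
the output towards `θc`, and batches of size `1 / (μ b²)` keep `θc` near `θ*`. So the expected
squared `D̃`-norm of the error is halved in each epoch, up to a floor `(‖θ*‖² + c̄²) / 2`
(`epoch_sq_le`). Means: the iteration is affine. With exactly stationary samples the mean error
would be multiplied by `R = T⁻¹ ∑_{i<T} (I - ηA)^i` in each epoch, with no noise floor, and `‖R‖ ≤
1/2` (`nrm_averageMap_le`). The true samples deviate from stationarity by a relative error `δ`,
which costs `δ` times a polynomial in the scale `X`; the second moments control the random factors
(`innerLoop_mean`, `epoch_mean`, `runEpochs_mean`). Of order `log X` epochs and `t_mix log X`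
skipped steps make both contributions at most `ε / 8`.

Perturbation. `A` stays strongly monotone (`Perturbed.isModulus`): the perturbed mass `δ` in each
state satisfies `δ ≤ b ν(s') / 8` for all `s'`, so the next state after a rare action, whatever its
law, contributes no more than a small multiple of the stationary average.

Complexity. The modulus is of order `1 / t_mix`, so one call of the critic takes about `1 / (μ b²) ·
t_mix · log² X`, that is `t_mix³ log² X / μ`, samples; the third logarithm comes from `log|𝒜| ≤ log
X` in `K`. -/

set_option linter.unusedSectionVars false

noncomputable section

namespace AMDP

variable {S A : Type} [Fintype S] [DecidableEq S] [Fintype A] [DecidableEq A] {d : ℕ}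

/-! ### Expectations of finitely supported laws -/

/-- A probability mass function with finite support. -/
class FinSupp {B : Type} (p : PMF B) : Prop where
  finite : p.support.Finite

section Expect

variable {B B' : Type}

instance finSupp_pure (b : B) : FinSupp (PMF.pure b) := ⟨by simp⟩

instance finSupp_bind (p : PMF B) (f : B → PMF B') [hp : FinSupp p] [hf : ∀ b, FinSupp (f b)] :
    FinSupp (p.bind f) :=
  ⟨by rw [PMF.support_bind]; exact hp.finite.biUnion fun b _ => (hf b).finite⟩

instance finSupp_map (p : PMF B) (f : B → B') [hp : FinSupp p] : FinSupp (p.map f) :=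
  ⟨by rw [PMF.support_map]; exact hp.finite.image f⟩

instance finSupp_of_finite [Finite B] (p : PMF B) : FinSupp p := ⟨Set.toFinite _⟩

theorem expect_eq_sum_of_subset (p : PMF B) (f : B → ℝ) (s : Finset B)
    (hs : ∀ b, b ∉ s → p b = 0) : expect p f = ∑ b ∈ s, (p b).toReal * f b :=
  tsum_eq_sum fun b hb => by simp [hs b hb]

theorem expect_eq_sum (p : PMF B) [hp : FinSupp p] (f : B → ℝ) :
    expect p f = ∑ b ∈ hp.finite.toFinset, (p b).toReal * f b :=
  expect_eq_sum_of_subset p f _ fun b hb => by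
    simpa [PMF.mem_support_iff] using hb

theorem expect_fintype [Fintype B] (p : PMF B) (f : B → ℝ) :
    expect p f = ∑ b, (p b).toReal * f b :=
  expect_eq_sum_of_subset p f _ (by simp)

theorem sum_toReal_eq_one (p : PMF B) [hp : FinSupp p] :
    ∑ b ∈ hp.finite.toFinset, (p b).toReal = 1 := by
  rw [← ENNReal.toReal_sum fun b _ => p.apply_ne_top b, ← ENNReal.toReal_one, ← p.tsum_coe]
  congr 1
  refine (tsum_eq_sum fun b hb => ?_).symm
  simpa [PMF.mem_support_iff] using hb

@[simp] theorem expect_const (p : PMF B) [FinSupp p] (c : ℝ) : expect p (fun _ => c) = c := by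
  rw [expect_eq_sum, ← Finset.sum_mul, sum_toReal_eq_one, one_mul]

@[simp] theorem expect_pure (b : B) (f : B → ℝ) : expect (PMF.pure b) f = f b := by
  classical
  rw [expect_eq_sum_of_subset _ f {b} fun x hx => by simpa [PMF.pure_apply] using hx]
  simp

theorem expect_add (p : PMF B) [FinSupp p] (f g : B → ℝ) :
    expect p (fun b => f b + g b) = expect p f + expect p g := by
  simp only [expect_eq_sum, mul_add, Finset.sum_add_distrib]

theorem expect_sub (p : PMF B) [FinSupp p] (f g : B → ℝ) :
    expect p (fun b => f b - g b) = expect p f - expect p g := by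
  simp only [expect_eq_sum, mul_sub, Finset.sum_sub_distrib]

theorem expect_const_mul (p : PMF B) [FinSupp p] (c : ℝ) (f : B → ℝ) :
    expect p (fun b => c * f b) = c * expect p f := by
  simp only [expect_eq_sum, Finset.mul_sum]
  exact Finset.sum_congr rfl fun b _ => by ring

theorem expect_mul_const (p : PMF B) [FinSupp p] (f : B → ℝ) (c : ℝ) :
    expect p (fun b => f b * c) = expect p f * c := by
  simp only [mul_comm _ c, expect_const_mul]

theorem expect_neg (p : PMF B) [FinSupp p] (f : B → ℝ) :
    expect p (fun b => - f b) = - expect p f := by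
  simp only [expect_eq_sum, mul_neg, Finset.sum_neg_distrib]

theorem expect_sum {ι : Type} (p : PMF B) [FinSupp p] (s : Finset ι) (f : ι → B → ℝ) :
    expect p (fun b => ∑ i ∈ s, f i b) = ∑ i ∈ s, expect p (f i) := by
  simp only [expect_eq_sum, Finset.mul_sum]
  exact Finset.sum_comm

theorem expect_mono_support (p : PMF B) [FinSupp p] {f g : B → ℝ}
    (h : ∀ b ∈ p.support, f b ≤ g b) : expect p f ≤ expect p g := by
  simp only [expect_eq_sum]
  exact Finset.sum_le_sum fun b hb =>
    mul_le_mul_of_nonneg_left (h b (by simpa using hb)) ENNReal.toReal_nonneg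

theorem expect_mono (p : PMF B) [FinSupp p] {f g : B → ℝ} (h : ∀ b, f b ≤ g b) :
    expect p f ≤ expect p g :=
  expect_mono_support p fun b _ => h b

theorem expect_le_const (p : PMF B) [FinSupp p] {f : B → ℝ} {c : ℝ} (h : ∀ b, f b ≤ c) :
    expect p f ≤ c := by
  simpa using expect_mono p (g := fun _ => c) h

theorem expect_nonneg (p : PMF B) [FinSupp p] {f : B → ℝ} (h : ∀ b, 0 ≤ f b) :
    0 ≤ expect p f := by
  simpa using expect_mono p (f := fun _ => 0) h

theorem abs_expect_le (p : PMF B) [FinSupp p] (f : B → ℝ) :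
    |expect p f| ≤ expect p fun b => |f b| :=
  abs_le.2 ⟨by rw [← expect_neg]; exact expect_mono p fun b => neg_abs_le _,
    expect_mono p fun b => le_abs_self _⟩

theorem sq_expect_le (p : PMF B) [FinSupp p] (f : B → ℝ) :
    expect p f ^ 2 ≤ expect p fun b => f b ^ 2 := by
  have h : 0 ≤ expect p fun b => (f b - expect p f) ^ 2 := expect_nonneg p fun b => sq_nonneg _
  have e : (expect p fun b => (f b - expect p f) ^ 2)
      = (expect p fun b => f b ^ 2) - expect p f ^ 2 := by
    have : (fun b => (f b - expect p f) ^ 2)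
        = fun b => (f b ^ 2 - 2 * expect p f * f b) + expect p f ^ 2 := by
      funext b; ring
    rw [this, expect_add, expect_sub, expect_const_mul, expect_const]
    ring
  linarith

theorem expect_bind (p : PMF B) (f : B → PMF B') [hp : FinSupp p] [hf : ∀ b, FinSupp (f b)]
    (g : B' → ℝ) : expect (p.bind f) g = expect p fun b => expect (f b) g := by
  classical
  -- One finite set carries all the laws `f b` that matter, so every series becomes a finite sum and
  -- the sums can be exchanged.
  let s : Finset B' := hp.finite.toFinset.biUnion fun b => (hf b).finite.toFinset
  have hs : ∀ b ∈ hp.finite.toFinset, ∀ x, x ∉ s → f b x = 0 := by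
    intro b hb x hx
    by_contra h
    exact hx (Finset.mem_biUnion.2 ⟨b, hb, by simpa [PMF.mem_support_iff] using h⟩)
  have happ : ∀ x, ((p.bind f) x).toReal =
      ∑ b ∈ hp.finite.toFinset, (p b).toReal * (f b x).toReal := by
    intro x
    rw [PMF.bind_apply, tsum_eq_sum (s := hp.finite.toFinset)
      fun b hb => by
        have : p b = 0 := by simpa [PMF.mem_support_iff] using hb
        simp [this],
      ENNReal.toReal_sum fun b _ => ENNReal.mul_ne_top (p.apply_ne_top b) ((f b).apply_ne_top x)]
    simp only [ENNReal.toReal_mul]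
  rw [expect_eq_sum_of_subset (p.bind f) g s, expect_eq_sum p]
  · simp only [happ, Finset.sum_mul]
    rw [Finset.sum_comm]
    refine Finset.sum_congr rfl fun b hb => ?_
    rw [expect_eq_sum_of_subset (f b) g s (hs b hb), Finset.mul_sum]
    exact Finset.sum_congr rfl fun x _ => by ring
  · intro x hx
    rw [PMF.bind_apply, ENNReal.tsum_eq_zero]
    intro b
    by_cases hb : b ∈ hp.finite.toFinset
    · simp [hs b hb x hx]
    · have : p b = 0 := by simpa [PMF.mem_support_iff] using hb
      simp [this]

theorem expect_map (p : PMF B) (f : B → B') [FinSupp p] (g : B' → ℝ) :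
    expect (p.map f) g = expect p fun b => g (f b) := by
  have : p.map f = p.bind fun b => PMF.pure (f b) := rfl
  rw [this, expect_bind]
  simp

theorem expect_draw [Fintype B] (p : stdSimplex ℝ B) (f : B → ℝ) :
    expect (draw p) f = ∑ b, p b * f b := by
  rw [expect_fintype]
  refine Finset.sum_congr rfl fun b _ => ?_
  rw [draw, PMF.ofFintype_apply, ENNReal.toReal_ofReal (stdSimplex.zero_le p b)]

/-- The mean of a random vector. -/
def vmean (p : PMF B) (f : B → Fin d → ℝ) : Fin d → ℝ := fun i => expect p fun b => f b i

theorem dotProduct_vmean (p : PMF B) [FinSupp p] (w : Fin d → ℝ) (f : B → Fin d → ℝ) :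
    w ⬝ᵥ vmean p f = expect p fun b => w ⬝ᵥ f b := by
  simp only [dotProduct, vmean, expect_sum, expect_const_mul]

theorem vmean_add (p : PMF B) [FinSupp p] (f g : B → Fin d → ℝ) :
    vmean p (fun b => f b + g b) = vmean p f + vmean p g := by
  funext i; simp [vmean, expect_add]

theorem vmean_sub (p : PMF B) [FinSupp p] (f g : B → Fin d → ℝ) :
    vmean p (fun b => f b - g b) = vmean p f - vmean p g := by
  funext i; simp [vmean, expect_sub]

theorem vmean_smul (p : PMF B) [FinSupp p] (c : ℝ) (f : B → Fin d → ℝ) :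
    vmean p (fun b => c • f b) = c • vmean p f := by
  funext i; simp [vmean, expect_const_mul]

@[simp] theorem vmean_const (p : PMF B) [FinSupp p] (v : Fin d → ℝ) :
    vmean p (fun _ => v) = v := by
  funext i; simp [vmean]

theorem vmean_bind (p : PMF B) (f : B → PMF B') [FinSupp p] [∀ b, FinSupp (f b)]
    (g : B' → Fin d → ℝ) : vmean (p.bind f) g = vmean p fun b => vmean (f b) g := by
  funext i; simp [vmean, expect_bind]

theorem vmean_map (p : PMF B) (f : B → B') [FinSupp p] (g : B' → Fin d → ℝ) :
    vmean (p.map f) g = vmean p fun b => g (f b) := by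
  funext i; simp [vmean, expect_map]

theorem map_vmean (p : PMF B) [FinSupp p] (L : (Fin d → ℝ) →ₗ[ℝ] (Fin d → ℝ))
    (f : B → Fin d → ℝ) : L (vmean p f) = vmean p fun b => L (f b) := by
  funext i
  have h : ∀ v, L v i = (fun j => L (Pi.single j 1) i) ⬝ᵥ v := by
    intro v
    conv_lhs => rw [pi_eq_sum_univ' v]
    simp [dotProduct, mul_comm]
  rw [h, dotProduct_vmean]
  change _ = expect p fun b => L (f b) i
  congr 1
  funext b
  rw [h (f b)]

end Expect

/-! ### The Euclidean norm of plain vectors -/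

/-- The Euclidean norm. -/
def nrm (v : Fin d → ℝ) : ℝ := ‖(WithLp.toLp 2 v : EuclideanSpace ℝ (Fin d))‖

theorem nrm_nonneg (v : Fin d → ℝ) : 0 ≤ nrm v := norm_nonneg _

theorem nrm_sq (v : Fin d → ℝ) : nrm v ^ 2 = v ⬝ᵥ v := by
  rw [nrm, EuclideanSpace.real_norm_sq_eq]
  simp [dotProduct, sq]

theorem nrm_add_le (v w : Fin d → ℝ) : nrm (v + w) ≤ nrm v + nrm w := by
  simpa [nrm] using norm_add_le (WithLp.toLp 2 v : EuclideanSpace ℝ (Fin d)) (WithLp.toLp 2 w)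

theorem nrm_sub_le (v w : Fin d → ℝ) : nrm (v - w) ≤ nrm v + nrm w := by
  simpa [nrm] using norm_sub_le (WithLp.toLp 2 v : EuclideanSpace ℝ (Fin d)) (WithLp.toLp 2 w)

theorem nrm_smul (c : ℝ) (v : Fin d → ℝ) : nrm (c • v) = |c| * nrm v := by
  simpa [nrm] using norm_smul c (WithLp.toLp 2 v : EuclideanSpace ℝ (Fin d))

@[simp] theorem nrm_zero : nrm (0 : Fin d → ℝ) = 0 := by simp [nrm]

theorem nrm_neg (v : Fin d → ℝ) : nrm (-v) = nrm v := by
  simp [nrm]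

theorem abs_dotProduct_le (v w : Fin d → ℝ) : |v ⬝ᵥ w| ≤ nrm v * nrm w := by
  have h := abs_real_inner_le_norm (WithLp.toLp 2 w : EuclideanSpace ℝ (Fin d)) (WithLp.toLp 2 v)
  rw [EuclideanSpace.inner_eq_star_dotProduct] at h
  simpa [nrm, mul_comm] using h

theorem nrm_sum_le {ι : Type} (s : Finset ι) (f : ι → Fin d → ℝ) :
    nrm (∑ i ∈ s, f i) ≤ ∑ i ∈ s, nrm (f i) := by
  classical
  induction s using Finset.induction_on with
  | empty => simp
  | insert a s ha ih =>
    rw [Finset.sum_insert ha, Finset.sum_insert ha]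
    exact (nrm_add_le _ _).trans (by linarith)

theorem nrm_add_sq_le (v w : Fin d → ℝ) : nrm (v + w) ^ 2 ≤ 2 * nrm v ^ 2 + 2 * nrm w ^ 2 := by
  have := nrm_add_le v w
  nlinarith [nrm_nonneg v, nrm_nonneg w, nrm_nonneg (v + w), sq_nonneg (nrm v - nrm w)]

theorem nrm_sub_sq_le (v w : Fin d → ℝ) : nrm (v - w) ^ 2 ≤ 2 * nrm v ^ 2 + 2 * nrm w ^ 2 := by
  have := nrm_sub_le v w
  nlinarith [nrm_nonneg v, nrm_nonneg w, nrm_nonneg (v - w), sq_nonneg (nrm v - nrm w)]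

/-- A vector is bounded by `c` in norm as soon as its inner products are. -/
theorem nrm_le_of_dotProduct_le {v : Fin d → ℝ} {c : ℝ} (hc : 0 ≤ c)
    (h : ∀ w, w ⬝ᵥ v ≤ nrm w * c) : nrm v ≤ c := by
  by_contra! hlt
  have h1 := h v
  rw [← nrm_sq] at h1
  nlinarith [nrm_nonneg v]

theorem nrm_vmean_le {B : Type} (p : PMF B) [FinSupp p] (f : B → Fin d → ℝ) :
    nrm (vmean p f) ≤ expect p fun b => nrm (f b) := by
  refine nrm_le_of_dotProduct_le (expect_nonneg p fun b => nrm_nonneg _) fun w => ?_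
  rw [dotProduct_vmean, ← expect_const_mul]
  exact expect_mono p fun b => (le_abs_self _).trans (abs_dotProduct_le _ _)

open Matrix Finset

/-! ### Stochastic matrices -/

/-- A signed measure of total mass zero does not notice when the same vector `ν` is subtracted from
all rows (Dobrushin contraction). The vector is arbitrary: it is taken to be the stationary
distribution, zero (no expansion), or a constant minorant (Doeblin). -/
theorem sum_abs_vecMul_le {P : Matrix S S ℝ} {ν : S → ℝ} {c : ℝ}
    (hP : ∀ s, ∑ s', |P s s' - ν s'| ≤ c) (v : S → ℝ) (hv : ∑ s, v s = 0) :
    ∑ s', |∑ s, v s * P s s'| ≤ c * ∑ s, |v s| := by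
  have e : ∀ s', ∑ s, v s * P s s' = ∑ s, v s * (P s s' - ν s') := by
    intro s'
    simp only [mul_sub, sum_sub_distrib, ← sum_mul, hv, zero_mul, sub_zero]
  calc ∑ s', |∑ s, v s * P s s'| ≤ ∑ s', ∑ s, |v s| * |P s s' - ν s'| := by
        refine sum_le_sum fun s' _ => ?_
        rw [e]
        refine (abs_sum_le_sum_abs _ _).trans (sum_le_sum fun s _ => ?_)
        rw [abs_mul]
    _ = ∑ s, |v s| * ∑ s', |P s s' - ν s'| := by
        rw [sum_comm]; simp only [mul_sum]
    _ ≤ ∑ s, |v s| * c := sum_le_sum fun s _ => mul_le_mul_of_nonneg_left (hP s) (abs_nonneg _)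
    _ = c * ∑ s, |v s| := by rw [← sum_mul, mul_comm]

/-- The constant vector is a right fixed vector, so `1 - P` is singular and there is a left fixed
vector `v`. The triangle inequality gives `|v| ≤ |v| P` entrywise; both sides have the same sum,
hence they agree and `|v|` can be normalized. -/
theorem exists_stationary_of_rowStochastic [Nonempty S] {P : Matrix S S ℝ}
    (hP : P ∈ rowStochastic ℝ S) :
    ∃ ν : stdSimplex ℝ S, ∀ s', ∑ s, ν s * P s s' = ν s' := by
  have hdet : (1 - P).det = 0 := by
    rw [← exists_mulVec_eq_zero_iff]
    refine ⟨1, one_ne_zero, ?_⟩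
    rw [sub_mulVec, one_mulVec, hP.2, sub_self]
  obtain ⟨v, hv0, hv⟩ := exists_vecMul_eq_zero_iff.2 hdet
  have hv' : ∀ s', ∑ s, v s * P s s' = v s' := by
    intro s'
    have h := congrFun hv s'
    rw [vecMul_sub, vecMul_one] at h
    simp only [Pi.sub_apply, Pi.zero_apply, vecMul, dotProduct] at h
    linarith
  have hle : ∀ s' ∈ univ, |v s'| ≤ ∑ s, |v s| * P s s' := by
    intro s' _
    conv_lhs => rw [← hv' s']
    refine (abs_sum_le_sum_abs _ _).trans (sum_le_sum fun s _ => ?_)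
    rw [abs_mul, abs_of_nonneg (hP.1 s s')]
  have hsum : ∑ s', |v s'| = ∑ s', ∑ s, |v s| * P s s' := by
    rw [sum_comm]
    refine sum_congr rfl fun s _ => ?_
    rw [← mul_sum, sum_row_of_mem_rowStochastic hP, mul_one]
  have heq := (sum_eq_sum_iff_of_le hle).1 hsum
  have hpos : 0 < ∑ s, |v s| := by
    obtain ⟨s, hs⟩ := Function.ne_iff.1 hv0
    exact sum_pos' (fun _ _ => abs_nonneg _) ⟨s, mem_univ s, abs_pos.2 hs⟩
  refine ⟨⟨fun s => |v s| / ∑ s, |v s|, fun s => by positivity, ?_⟩, fun s' => ?_⟩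
  · rw [← sum_div, div_self hpos.ne']
  · change ∑ s, |v s| / (∑ s, |v s|) * P s s' = |v s'| / ∑ s, |v s|
    rw [heq s' (mem_univ s'), sum_div]
    exact sum_congr rfl fun s _ => by ring

/-- An irreducible and aperiodic matrix is primitive. -/
theorem exists_pow_pos_of_irreducible_of_aperiodic {P : Matrix S S ℝ} (h : P.IsIrreducible)
    (ha : IsAperiodic P) : ∃ n, ∀ s s', 0 < (P ^ n) s s' := by
  have hnn := h.nonneg
  have hadd : ∀ m n i j k, 0 < (P ^ m) i j → 0 < (P ^ n) j k → 0 < (P ^ (m + n)) i k := by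
    intro m n i j k h1 h2
    rw [pow_add, mul_apply]
    exact sum_pos' (fun l _ => mul_nonneg (pow_apply_nonneg hnn m i l) (pow_apply_nonneg hnn n l k))
      ⟨j, mem_univ j, mul_pos h1 h2⟩
  have hret : ∀ s, ∃ n, ∀ m ≥ n, 0 < (P ^ m) s s := by
    intro s
    let R : Set ℕ := {n | 0 < n ∧ 0 < (P ^ n) s s}
    -- The return times generate an additive semigroup, and by aperiodicity their gcd is one, so the
    -- semigroup contains all large integers.
    have hgcd : Nat.setGcd R = 1 :=
      ha s _ fun n hn hpos => Nat.setGcd_dvd_of_mem (s := R) ⟨hn, hpos⟩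
    obtain ⟨n, hn⟩ := Nat.exists_mem_closure_of_ge R
    refine ⟨n, fun m hm => ?_⟩
    have hcl := hn m hm (by rw [hgcd]; exact one_dvd m)
    refine AddSubmonoid.closure_induction (motive := fun m _ => 0 < (P ^ m) s s) ?_ ?_ ?_ hcl
    · exact fun x hx => hx.2
    · simp
    · exact fun x y _ _ hx hy => hadd x y s s s hx hy
  choose n hn using hret
  choose k hk0 hk using (isIrreducible_iff_exists_pow_pos hnn).1 h
  refine ⟨univ.sup n + univ.sup (fun q : S × S => k q.1 q.2), fun s s' => ?_⟩
  have h1 : n s ≤ univ.sup n := le_sup (mem_univ s)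
  have h2 : k s s' ≤ univ.sup (fun q : S × S => k q.1 q.2) :=
    le_sup (f := fun q : S × S => k q.1 q.2) (mem_univ (s, s'))
  obtain ⟨r, hr⟩ := Nat.exists_eq_add_of_le h2
  have := hadd (univ.sup n + r) (k s s') s s s' (hn s _ (by omega)) (hk s s')
  rwa [show univ.sup n + r + k s s' = univ.sup n + (k s s' + r) by omega, ← hr] at this

/-! ### The chains of a Markov decision process -/

theorem stateMatrix_mem (M : Model S A) (π : Policy S A) :
    stateMatrix M π ∈ rowStochastic ℝ S := by
  rw [mem_rowStochastic_iff_sum]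
  refine ⟨fun s s' => sum_nonneg fun a _ =>
    mul_nonneg (stdSimplex.zero_le _ _) (stdSimplex.zero_le _ _), fun s => ?_⟩
  simp only [stateMatrix, of_apply]
  rw [sum_comm]
  simp [← mul_sum]

theorem pairMatrix_mem (M : Model S A) (π : Policy S A) :
    pairMatrix M π ∈ rowStochastic ℝ (S × A) := by
  rw [mem_rowStochastic_iff_sum]
  refine ⟨fun s s' => mul_nonneg (stdSimplex.zero_le _ _) (stdSimplex.zero_le _ _), fun x => ?_⟩
  simp [pairMatrix, Fintype.sum_prod_type, ← mul_sum]

section Stationary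

variable [Nonempty S] (M : Model S A) (π : Policy S A)

theorem exists_isStationary : ∃ ν, IsStationary M π ν :=
  exists_stationary_of_rowStochastic (stateMatrix_mem M π)

theorem stationary_eq : stationary M π = ⇑(exists_isStationary M π).choose := by
  rw [stationary, dif_pos (exists_isStationary M π)]

theorem stationary_nonneg (s : S) : 0 ≤ stationary M π s := by
  rw [stationary_eq]; exact stdSimplex.zero_le _ _

theorem sum_stationary : ∑ s, stationary M π s = 1 := by
  rw [stationary_eq]; exact stdSimplex.sum_eq_one _

theorem sum_stationary_mul (s' : S) :
    ∑ s, stationary M π s * stateMatrix M π s s' = stationary M π s' := by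
  rw [stationary_eq]; exact (exists_isStationary M π).choose_spec s'

theorem stationary_le_one (s : S) : stationary M π s ≤ 1 := by
  rw [stationary_eq]; exact stdSimplex.le_one _ _

theorem sum_stationary_mul_pow (t : ℕ) (s' : S) :
    ∑ s, stationary M π s * (stateMatrix M π ^ t) s s' = stationary M π s' := by
  induction t generalizing s' with
  | zero => simp [one_apply]
  | succ t ih =>
    simp only [pow_succ, mul_apply, mul_sum]
    rw [sum_comm]
    simp only [← mul_assoc, ← sum_mul, ih]
    exact sum_stationary_mul M π s'

/-- The distance of the law of the chain at time `t` from stationarity. -/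
def mixDist (t : ℕ) (s : S) : ℝ := ∑ s', |(stateMatrix M π ^ t) s s' - stationary M π s'|

theorem mixDist_add_le {m : ℕ} {c : ℝ} {ν : S → ℝ}
    (h : ∀ s, ∑ s', |(stateMatrix M π ^ m) s s' - ν s'| ≤ c) (t : ℕ) (s : S) :
    mixDist M π (t + m) s ≤ c * mixDist M π t s := by
  have := sum_abs_vecMul_le h
    (fun r => (stateMatrix M π ^ t) s r - stationary M π r) (by
      rw [sum_sub_distrib, sum_stationary,
        sum_row_of_mem_rowStochastic (pow_mem (stateMatrix_mem M π) t), sub_self])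
  refine le_trans (le_of_eq ?_) this
  refine sum_congr rfl fun s' _ => ?_
  simp only [sub_mul, sum_sub_distrib, sum_stationary_mul_pow, pow_add, mul_apply]

theorem mixDist_le_two (t : ℕ) (s : S) : mixDist M π t s ≤ 2 := by
  calc mixDist M π t s ≤ ∑ s', ((stateMatrix M π ^ t) s s' + stationary M π s') := by
        refine sum_le_sum fun s' _ => abs_le.2 ⟨?_, ?_⟩
        · have := pow_apply_nonneg (stateMatrix_mem M π).1 t s s'
          linarith
        · have := stationary_nonneg M π s'
          linarith
    _ = 2 := by
        rw [sum_add_distrib, sum_stationary,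
          sum_row_of_mem_rowStochastic (pow_mem (stateMatrix_mem M π) t)]
        norm_num

theorem mixDist_add_le_self (m t : ℕ) (s : S) : mixDist M π (t + m) s ≤ mixDist M π t s := by
  have := mixDist_add_le M π (m := m) (c := 1) (ν := 0) (fun s => by
    refine le_of_eq ?_
    rw [← sum_row_of_mem_rowStochastic (pow_mem (stateMatrix_mem M π) m) s]
    refine sum_congr rfl fun s' _ => ?_
    rw [Pi.zero_apply, sub_zero, abs_of_nonneg (pow_apply_nonneg (stateMatrix_mem M π).1 m s s'),
      ]) t s
  linarith

theorem mixDist_mul_le {m : ℕ} {c : ℝ} {ν : S → ℝ} (hc : 0 ≤ c)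
    (h : ∀ s, ∑ s', |(stateMatrix M π ^ m) s s' - ν s'| ≤ c) (k : ℕ) (s : S) :
    mixDist M π (k * m) s ≤ 2 * c ^ k := by
  induction k with
  | zero => simpa using mixDist_le_two M π (0 * m) s
  | succ k ih =>
    rw [Nat.succ_mul]
    refine (mixDist_add_le M π h _ s).trans ?_
    rw [pow_succ]
    nlinarith

/-- The set of which the mixing time of a policy is the least element. -/
def mixingSet : Set ℕ :=
  {t : ℕ | 1 ≤ t ∧ ∀ q : stdSimplex ℝ S,
    ∑ s', |(∑ s, q s * (stateMatrix M π ^ t) s s') - stationary M π s'| ≤ 1 / 2}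

theorem mem_mixingSet_iff (t : ℕ) :
    t ∈ mixingSet M π ↔ 1 ≤ t ∧ ∀ s, mixDist M π t s ≤ 1 / 2 := by
  refine and_congr_right fun _ => ⟨fun h s => ?_, fun h q => ?_⟩
  · have := h (stdSimplex.vertex s)
    simpa [Pi.single_apply, mixDist] using this
  · have hq : ∀ s', (∑ s, q s * (stateMatrix M π ^ t) s s') - stationary M π s'
        = ∑ s, q s * ((stateMatrix M π ^ t) s s' - stationary M π s') := by
      intro s'
      simp only [mul_sub, sum_sub_distrib, ← sum_mul, stdSimplex.sum_eq_one, one_mul]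
    calc _ ≤ ∑ s', ∑ s, q s * |(stateMatrix M π ^ t) s s' - stationary M π s'| := by
          refine sum_le_sum fun s' _ => ?_
          rw [hq]
          refine (abs_sum_le_sum_abs _ _).trans (sum_le_sum fun s _ => ?_)
          rw [abs_mul, abs_of_nonneg (stdSimplex.zero_le q s)]
      _ = ∑ s, q s * mixDist M π t s := by
          rw [sum_comm]; simp only [mixDist, mul_sum]
      _ ≤ ∑ s, q s * (1 / 2) :=
          sum_le_sum fun s _ => mul_le_mul_of_nonneg_left (h s) (stdSimplex.zero_le q s)
      _ = 1 / 2 := by rw [← sum_mul, stdSimplex.sum_eq_one, one_mul]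

variable {M}

/-- Doeblin's argument: some power of the matrix has all entries at least `m > 0`, so its rows are
within `1 - |S| m < 1` of the constant vector `m`, and the distance to stationarity contracts by
this factor. -/
theorem mixingSet_nonempty (hM : IsErgodic M) : (mixingSet M π).Nonempty := by
  obtain ⟨n, hn⟩ := exists_pow_pos_of_irreducible_of_aperiodic (hM π).1 (hM π).2
  obtain ⟨q, -, hq⟩ := exists_min_image univ (fun q : S × S => (stateMatrix M π ^ n) q.1 q.2)
    univ_nonempty
  set m := (stateMatrix M π ^ n) q.1 q.2
  have hm : 0 < m := hn _ _
  have hS : (0 : ℝ) < Fintype.card S := by exact_mod_cast Fintype.card_pos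
  have hle : ∀ s s', m ≤ (stateMatrix M π ^ n) s s' := fun s s' => hq (s, s') (mem_univ _)
  have hrow : ∀ s, ∑ s', |(stateMatrix M π ^ n) s s' - (fun _ => m) s'|
      ≤ 1 - Fintype.card S * m := by
    intro s
    rw [← sum_row_of_mem_rowStochastic (pow_mem (stateMatrix_mem M π) n) s]
    refine le_of_eq ?_
    simp only [fun s' => abs_of_nonneg (sub_nonneg.2 (hle s s')), sum_sub_distrib, sum_const,
      card_univ, nsmul_eq_mul]
  have h0 : 0 ≤ 1 - Fintype.card S * m :=
    (sum_nonneg fun s' _ => abs_nonneg _).trans (hrow (Classical.arbitrary S))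
  have h1 : 1 - Fintype.card S * m < 1 := by have := mul_pos hS hm; linarith
  -- The distance starts at no more than 2, so a factor below `1/4` brings it below `1/2`. The extra
  -- step in `k * n + 1` only makes the time positive.
  obtain ⟨k, hk⟩ := exists_pow_lt_of_lt_one (show (0 : ℝ) < 1 / 4 by norm_num) h1
  refine ⟨k * n + 1, (mem_mixingSet_iff M π _).2 ⟨by omega, fun s => ?_⟩⟩
  have h2 := mixDist_mul_le M π h0 hrow k s
  have h3 := mixDist_add_le_self M π 1 (k * n) s
  linarith

theorem policyMixingTime_mem (hM : IsErgodic M) : policyMixingTime M π ∈ mixingSet M π :=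
  Nat.sInf_mem (mixingSet_nonempty π hM)

variable [Nonempty A]

/-- An unbounded supremum of natural numbers has the default value 0, so a nonzero mixing time
certifies that the mixing times of the policies are bounded. -/
theorem policyMixingTime_le (h : mixingTime M ≠ 0) : policyMixingTime M π ≤ mixingTime M := by
  refine le_ciSup (f := fun π => policyMixingTime M π) ?_ π
  by_contra hb
  exact h (Nat.sSup_of_not_bddAbove hb)

theorem mixDist_mixingTime_le (hM : IsErgodic M) (h : mixingTime M ≠ 0) (s : S) :
    mixDist M π (mixingTime M) s ≤ 1 / 2 := by
  obtain ⟨k, hk⟩ := Nat.exists_eq_add_of_le (policyMixingTime_le π h)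
  rw [hk]
  exact (mixDist_add_le_self M π k _ s).trans
    (((mem_mixingSet_iff M π _).1 (policyMixingTime_mem π hM)).2 s)

/-- The rate of geometric mixing that the mixing time gives. -/
def mixingRate (M : Model S A) : ℝ := (1 / 2 : ℝ) ^ ((mixingTime M : ℝ)⁻¹)

theorem mixingRate_pos : 0 < mixingRate M := Real.rpow_pos_of_pos (by norm_num) _

theorem mixingRate_lt_one (h : mixingTime M ≠ 0) : mixingRate M < 1 :=
  Real.rpow_lt_one (by norm_num) (by norm_num) (by positivity)

theorem mixingRate_pow (h : mixingTime M ≠ 0) : mixingRate M ^ mixingTime M = 1 / 2 :=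
  Real.rpow_inv_natCast_pow (by norm_num) h

/-- Each block of `t_mix` steps halves a distance that is at most 2 initially; rounding `t` down to
whole blocks loses one more factor 2. This explains the constant 4. -/
theorem isMixingRate_mixingRate (hM : IsErgodic M) (h : mixingTime M ≠ 0) :
    IsMixingRate M 4 (mixingRate M) := by
  refine ⟨by norm_num, mixingRate_pos, mixingRate_lt_one h, fun π t s => ?_⟩
  change mixDist M π t s ≤ _
  set n := mixingTime M
  have h1 : mixDist M π (t / n * n) s ≤ 2 * (1 / 2) ^ (t / n) :=
    mixDist_mul_le M π (by norm_num) (fun s => mixDist_mixingTime_le π hM h s) _ s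
  have h2 : mixDist M π t s ≤ mixDist M π (t / n * n) s := by
    have := mixDist_add_le_self M π (t % n) (t / n * n) s
    rwa [Nat.div_add_mod'] at this
  have h3 : (1 / 2 : ℝ) ^ (t / n + 1) ≤ mixingRate M ^ t := by
    rw [← mixingRate_pow h, ← pow_mul]
    refine pow_le_pow_of_le_one mixingRate_pos.le (mixingRate_lt_one h).le ?_
    exact (Nat.lt_mul_div_succ t (Nat.pos_of_ne_zero h)).le
  rw [pow_succ] at h3
  linarith

end Stationary

/-! ### Perturbed policies -/

section Weights

open Classical in
/-- The mass of the actions that are not rare. -/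
def commonMass (u : ℝ) (p : stdSimplex ℝ A) : ℝ := ∑ a ∈ univ.filter (fun a => u / 2 < p a), p a

variable {u : ℝ} (p : stdSimplex ℝ A)

theorem commonMass_le_one : commonMass u p ≤ 1 := by
  classical
  rw [← stdSimplex.sum_eq_one p]
  exact sum_le_sum_of_subset_of_nonneg (filter_subset _ _) fun a _ _ => stdSimplex.zero_le p a

theorem le_commonMass : 1 - numRare u p * u / 2 ≤ commonMass u p := by
  classical
  have h := sum_filter_add_sum_filter_not univ (fun a => u / 2 < p a) (fun a => p a)
  rw [stdSimplex.sum_eq_one] at h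
  have h2 : ∑ a ∈ univ.filter (fun a => ¬ u / 2 < p a), p a ≤ numRare u p * (u / 2) := by
    rw [numRare, ← nsmul_eq_mul]
    refine sum_le_card_nsmul _ _ _ fun a ha => ?_
    simpa using ha
  rw [commonMass]
  linarith

theorem sum_rare : (∑ a, if u / 2 < p a then 0 else u) = numRare u p * u := by
  classical
  rw [← sum_filter_add_sum_filter_not univ (fun a => u / 2 < p a)]
  rw [sum_congr rfl (g := fun _ => 0) fun a ha => if_pos (by simpa using ha),
    sum_congr rfl (g := fun _ => u) fun a ha => if_neg (by simpa using ha)]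
  simp [numRare]

variable {p}

theorem commonMass_pos (hu : 0 < u) (h : numRare u p * u < 1) : 0 < commonMass u p := by
  have := le_commonMass (u := u) p
  have : 0 ≤ numRare u p * u := by positivity
  linarith

theorem perturbWeights_mem (hu : 0 < u) (h : numRare u p * u < 1) :
    perturbWeights u p ∈ stdSimplex ℝ A := by
  classical
  have hpos := commonMass_pos hu h
  refine ⟨fun a => ?_, ?_⟩
  · rw [perturbWeights]
    split_ifs
    · exact mul_nonneg (stdSimplex.zero_le p a) (div_nonneg (by linarith) hpos.le)
    · exact hu.le
  · rw [← sum_filter_add_sum_filter_not univ (fun a => u / 2 < p a),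
      sum_congr rfl (f := perturbWeights u p) (g := fun a => p a * ((1 - numRare u p * u) / commonMass u p))
        fun a ha => if_pos (by simpa using ha),
      sum_congr rfl (f := perturbWeights u p) (s₂ := univ.filter (fun a => ¬ u / 2 < p a))
        (g := fun _ => u) fun a ha =>
        if_neg (by simpa using ha), ← sum_mul]
    change commonMass u p * ((1 - numRare u p * u) / commonMass u p) + _ = _
    rw [mul_div_cancel₀ _ hpos.ne']
    simp [numRare]

theorem perturb_apply {π : Policy S A} {s : S} (hu : 0 < u) (h : numRare u (π s) * u < 1) (a : A) :
    perturb u π s a = perturbWeights u (π s) a := by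
  rw [perturb, dif_pos (perturbWeights_mem hu h)]
  rfl

theorem perturbWeights_rare {a : A} (ha : ¬ u / 2 < p a) : perturbWeights u p a = u :=
  if_neg ha

/-- With `r` rare actions, `1 - r u ≤ 1 - r u / 2 ≤ commonMass ≤ 1`, so the scaling factor `(1 - r
u) / commonMass` lies between `1 - r u` and 1. -/
theorem perturbWeights_common {a : A} (hu : 0 < u) (h : numRare u p * u < 1) (ha : u / 2 < p a) :
    (1 - numRare u p * u) * p a ≤ perturbWeights u p a ∧ perturbWeights u p a ≤ p a := by
  classical
  have hpos := commonMass_pos hu h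
  have hle := commonMass_le_one (u := u) p
  have hge := le_commonMass (u := u) p
  have h0 : 0 ≤ numRare u p * u := by positivity
  have hpa := stdSimplex.zero_le p a
  have e : perturbWeights u p a = p a * ((1 - numRare u p * u) / commonMass u p) := if_pos ha
  rw [e]
  constructor
  · rw [mul_comm]
    refine mul_le_mul_of_nonneg_left ?_ hpa
    rw [le_div_iff₀ hpos]
    nlinarith
  · refine mul_le_of_le_one_right hpa ?_
    rw [div_le_one hpos]
    linarith

end Weights

/-! ### Quadratic forms -/

section Forms

variable (M : Model S A) (π π' : Policy S A)

/-- The conditional expectation of `g` at the next state-action pair. -/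
def nextMean (g : S × A → ℝ) (x : S × A) : ℝ := ∑ y, pairMatrix M π x y * g y

theorem normSq_eq (Ψ : Matrix (S × A) (Fin d) ℝ) (θ : Fin d → ℝ) :
    normSq M Ψ π π' θ = ∑ x, weight M π π' x * (Ψ.mulVec θ) x ^ 2 := by
  simp only [normSq, dotProduct, mulVec_diagonal]
  exact sum_congr rfl fun x _ => by ring

theorem dirichlet_eq (Ψ : Matrix (S × A) (Fin d) ℝ) (θ : Fin d → ℝ) :
    dirichlet M Ψ π π' θ = ∑ x, weight M π π' x *
      ((Ψ.mulVec θ) x * ((Ψ.mulVec θ) x - nextMean M π (Ψ.mulVec θ) x)) := by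
  simp only [dirichlet, dotProduct, ← mulVec_mulVec, mulVec_diagonal, sub_mulVec, one_mulVec,
    Pi.sub_apply]
  refine sum_congr rfl fun x _ => ?_
  change _ * (_ * (_ - nextMean M π (Ψ.mulVec θ) x)) = _
  ring

theorem nextMean_eq (g : S × A → ℝ) (x : S × A) :
    nextMean M π g x = ∑ s', M.trans x.1 x.2 s' * ∑ a, π s' a * g (s', a) := by
  simp only [nextMean, pairMatrix, of_apply, Fintype.sum_prod_type, mul_sum, mul_assoc]

theorem sq_sum_simplex_le {B : Type} [Fintype B] (p : stdSimplex ℝ B) (f : B → ℝ) :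
    (∑ b, p b * f b) ^ 2 ≤ ∑ b, p b * f b ^ 2 := by
  simpa [expect_draw] using sq_expect_le (draw p) f

theorem sq_nextMean_le (g : S × A → ℝ) (x : S × A) :
    nextMean M π g x ^ 2 ≤ nextMean M π (fun y => g y ^ 2) x := by
  rw [nextMean_eq, nextMean_eq]
  refine (sq_sum_simplex_le _ _).trans (sum_le_sum fun s' _ => ?_)
  exact mul_le_mul_of_nonneg_left (sq_sum_simplex_le _ _) (stdSimplex.zero_le _ _)

variable [Nonempty S]

theorem weight_nonneg (x : S × A) : 0 ≤ weight M π π' x :=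
  mul_nonneg (stationary_nonneg M π _) (stdSimplex.zero_le _ _)

theorem sum_weight : ∑ x, weight M π π' x = 1 := by
  simp only [weight, Fintype.sum_prod_type, ← mul_sum, stdSimplex.sum_eq_one, mul_one,
    sum_stationary]

theorem sum_weight_mul_trans (f : S → ℝ) :
    ∑ x, weight M π π x * ∑ s', M.trans x.1 x.2 s' * f s' = ∑ s', stationary M π s' * f s' := by
  calc _ = ∑ s', (∑ s, stationary M π s * stateMatrix M π s s') * f s' := by
        simp only [weight, Fintype.sum_prod_type, mul_sum, stateMatrix, of_apply, sum_mul]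
        conv_rhs => rw [sum_comm]
        refine sum_congr rfl fun s _ => ?_
        rw [sum_comm]
        exact sum_congr rfl fun s' _ => sum_congr rfl fun a _ => by ring
    _ = _ := by simp only [sum_stationary_mul]

theorem sum_weight_mul_nextMean (g : S × A → ℝ) :
    ∑ x, weight M π π x * nextMean M π g x = ∑ x, weight M π π x * g x := by
  simp only [nextMean_eq, sum_weight_mul_trans]
  simp only [weight, Fintype.sum_prod_type, mul_sum, mul_assoc]

/-- Expand `(x + y)² ≥ 0` with `y` the conditional mean of `x` at the next pair, and use Jensen's
inequality and stationarity. The purpose is the bound `b ≤ 2` for each modulus `b`, valid unless the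
norm vanishes. -/
theorem dirichlet_le_two_mul_normSq (Ψ : Matrix (S × A) (Fin d) ℝ) (θ : Fin d → ℝ) :
    dirichlet M Ψ π π θ ≤ 2 * normSq M Ψ π π θ := by
  rw [dirichlet_eq, normSq_eq]
  set g := Ψ.mulVec θ
  have h1 : ∑ x, weight M π π x * nextMean M π g x ^ 2 ≤ ∑ x, weight M π π x * g x ^ 2 := by
    rw [← sum_weight_mul_nextMean M π fun y => g y ^ 2]
    exact sum_le_sum fun x _ => mul_le_mul_of_nonneg_left (sq_nextMean_le M π g x)
      (weight_nonneg M π π x)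
  have h2 : ∑ x, weight M π π x * (g x * (g x - nextMean M π g x)) ≤
      ∑ x, (3 / 2 * (weight M π π x * g x ^ 2)
        + 1 / 2 * (weight M π π x * nextMean M π g x ^ 2)) := by
    refine sum_le_sum fun x _ => ?_
    have := mul_nonneg (weight_nonneg M π π x) (sq_nonneg (g x + nextMean M π g x))
    nlinarith
  rw [sum_add_distrib, ← mul_sum, ← mul_sum] at h2
  linarith

end Forms

/-! ### The modulus of the perturbed operator -/

section Modulus

variable [Nonempty S] {M : Model S A} {Ψ : Matrix (S × A) (Fin d) ℝ} {π : Policy S A} {u b : ℝ}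

/-- The perturbed policy with exploration level `u` is close to `π`: each state has at most the
mass `δ` of perturbed actions, where `δ` is small compared to the stationary distribution. -/
structure Perturbed (M : Model S A) (π : Policy S A) (u b δ : ℝ) : Prop where
  u_pos : 0 < u
  rare_le : ∀ s, numRare u (π s) * u ≤ δ
  lt_one : δ < 1
  delta_le : ∀ s, δ ≤ b * stationary M π s / 8
  delta_le_div : δ ≤ b / (8 + b)
  delta_nonneg : 0 ≤ δ

theorem IsExploration.exists_perturbed (h : IsExploration M Ψ π u) {b₀ : ℝ}
    (hb₀ : IsModulus M Ψ π π b₀) (hν : ∀ s, 0 < stationary M π s) :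
    ∃ b δ, b₀ ≤ b ∧ IsModulus M Ψ π π b ∧ Perturbed M π u b δ := by
  obtain ⟨hu, -, b₁, hb₁, hle⟩ := h
  set m := ⨅ s', stationary M π s'
  have hm : ∀ s, m ≤ stationary M π s := fun s => ciInf_le (Set.finite_range _).bddBelow s
  have hm0 : 0 < m := by
    obtain ⟨s, hs⟩ := exists_eq_ciInf_of_finite (f := fun s' => stationary M π s')
    rw [show m = _ from hs.symm]; exact hν s
  have hm1 : m ≤ 1 := (hm (Classical.arbitrary S)).trans (stationary_le_one M π _)
  -- The bound `b m / (8 + b m)` for the perturbed mass increases with `b`, so the larger of the two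
  -- moduli satisfies the exploration requirement too, and it is still a modulus.
  set b := max b₀ b₁
  have hb : 0 < b := lt_max_of_lt_left hb₀.1
  have hbm : 0 < b * m := mul_pos hb hm0
  refine ⟨b, b * m / (8 + b * m), le_max_left _ _, ⟨hb, fun θ => ?_⟩, hu, fun s => ?_, ?_,
    fun s => ?_, ?_, by positivity⟩
  · rcases max_choice b₀ b₁ with h | h
    · rw [show b = b₀ from h]; exact hb₀.2 θ
    · rw [show b = b₁ from h]; exact hb₁.2 θ
  · have h1 := hle s
    have h2 : b₁ * m ≤ b * m := mul_le_mul_of_nonneg_right (le_max_right _ _) hm0.le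
    have h3 : 0 < b₁ * m := mul_pos hb₁.1 hm0
    have h4 : numRare u (π s) * u ≤ b₁ * m / (8 + b₁ * m) := by
      rw [le_div_iff₀ (by positivity)]; linarith
    refine h4.trans ?_
    rw [div_le_div_iff₀ (by positivity) (by positivity)]
    nlinarith
  · rw [div_lt_one (by positivity)]; linarith
  · rw [div_le_div_iff₀ (by positivity) (by norm_num)]
    have := hm s
    have h5 : b * m ≤ b * stationary M π s := mul_le_mul_of_nonneg_left this hb.le
    nlinarith [mul_nonneg hbm.le (hbm.le.trans h5)]
  · rw [div_le_div_iff₀ (by positivity) (by positivity)]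
    nlinarith

variable {δ : ℝ} (h : Perturbed M π u b δ)
include h

theorem Perturbed.numRare_lt (s : S) : numRare u (π s) * u < 1 :=
  (h.rare_le s).trans_lt h.lt_one

open Classical in
/-- The rare part of a perturbed policy. -/
theorem Perturbed.pointwise (s : S) (a : A) (x y : ℝ) :
    π s a * (x * (x - y)) - δ * (π s a * (3 / 2 * x ^ 2 + 1 / 2 * y ^ 2))
      + (if u / 2 < π s a then 0 else u) * (1 / 4 * x ^ 2 - 1 / 2 * y ^ 2)
      ≤ perturb u π s a * (x * (x - y)) := by
  rw [perturb_apply h.u_pos (h.numRare_lt s)]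
  have hp := stdSimplex.zero_le (π s) a
  have hδ := h.delta_nonneg
  have hr := h.rare_le s
  have hq1 : x * (x - y) ≤ 3 / 2 * x ^ 2 + 1 / 2 * y ^ 2 := by nlinarith [sq_nonneg (x + y)]
  have hq2 : 1 / 2 * x ^ 2 - 1 / 2 * y ^ 2 ≤ x * (x - y) := by nlinarith [sq_nonneg (x - y)]
  by_cases ha : u / 2 < π s a
  · rw [if_pos ha]
    obtain ⟨h1, h2⟩ := perturbWeights_common h.u_pos (h.numRare_lt s) ha
    set q := perturbWeights u (π s) a
    have h3 : π s a - q ≤ δ * π s a := by nlinarith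
    have h4 : (π s a - q) * (x * (x - y)) ≤ (π s a - q) * (3 / 2 * x ^ 2 + 1 / 2 * y ^ 2) :=
      mul_le_mul_of_nonneg_left hq1 (by linarith)
    have h5 : (π s a - q) * (3 / 2 * x ^ 2 + 1 / 2 * y ^ 2)
        ≤ (δ * π s a) * (3 / 2 * x ^ 2 + 1 / 2 * y ^ 2) :=
      mul_le_mul_of_nonneg_right h3 (by positivity)
    nlinarith
  · rw [if_neg ha, perturbWeights_rare ha]
    push Not at ha
    -- Raising a rare probability to `u` adds a mass between `u / 2` and `u`; hence the coefficients
    -- `1/4` of `x²` and `1/2` of `y²` in the rare part.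
    have h4 : (u - π s a) * (1 / 2 * x ^ 2 - 1 / 2 * y ^ 2) ≤ (u - π s a) * (x * (x - y)) :=
      mul_le_mul_of_nonneg_left hq2 (by linarith)
    have h5 : 0 ≤ δ * (π s a * (3 / 2 * x ^ 2 + 1 / 2 * y ^ 2)) := by positivity
    have h6 : 0 ≤ (u / 2 - π s a) * x ^ 2 := mul_nonneg (by linarith) (sq_nonneg x)
    have h7 : 0 ≤ π s a * y ^ 2 := mul_nonneg hp (sq_nonneg y)
    nlinarith

open Classical in
theorem Perturbed.le_add (s : S) (a : A) :
    perturb u π s a ≤ π s a + if u / 2 < π s a then 0 else u := by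
  rw [perturb_apply h.u_pos (h.numRare_lt s)]
  have hp := stdSimplex.zero_le (π s) a
  by_cases ha : u / 2 < π s a
  · rw [if_pos ha, add_zero]
    exact (perturbWeights_common h.u_pos (h.numRare_lt s) ha).2
  · rw [if_neg ha, perturbWeights_rare ha]
    linarith

theorem Perturbed.mul_le (hδ : δ ≤ 1 / 5) (s : S) (a : A) :
    π s a ≤ 5 / 4 * perturb u π s a := by
  rw [perturb_apply h.u_pos (h.numRare_lt s)]
  have hp := stdSimplex.zero_le (π s) a
  have hr := h.rare_le s
  have hu := h.u_pos
  by_cases ha : u / 2 < π s a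
  · have := (perturbWeights_common h.u_pos (h.numRare_lt s) ha).1
    nlinarith
  · rw [perturbWeights_rare ha]
    linarith

open Classical in
/-- The weight of the rare actions. -/
theorem Perturbed.sum_rare_le (f : S × A → ℝ) {c : ℝ} (hc : 0 ≤ c)
    (hf : ∀ x, δ * f x ≤ δ * c) :
    ∑ x : S × A, stationary M π x.1 * ((if u / 2 < π x.1 x.2 then 0 else u) * f x) ≤ δ * c := by
  -- The hypothesis on `f` says nothing when `δ = 0`, but then there are no rare actions, because `u
  -- > 0`.
  rcases eq_or_lt_of_le h.delta_nonneg with h0 | h0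
  · have hz : ∀ s a, (if u / 2 < π s a then 0 else u) = 0 := by
      intro s a
      have h1 : ∑ a, (if u / 2 < π s a then 0 else u) = 0 := by
        refine le_antisymm ?_ (sum_nonneg fun a _ => by split_ifs; exacts [le_rfl, h.u_pos.le])
        rw [sum_rare, h0]; exact h.rare_le s
      exact (sum_eq_zero_iff_of_nonneg fun a _ => by
        split_ifs; exacts [le_rfl, h.u_pos.le]).1 h1 a (mem_univ a)
    simp [hz, ← h0]
  · have hf' : ∀ x, f x ≤ c := fun x => le_of_mul_le_mul_left (hf x) h0
    calc _ ≤ ∑ x : S × A, stationary M π x.1 * ((if u / 2 < π x.1 x.2 then 0 else u) * c) := by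
          refine sum_le_sum fun x _ => mul_le_mul_of_nonneg_left
            (mul_le_mul_of_nonneg_left (hf' x) ?_) (stationary_nonneg M π _)
          split_ifs; exacts [le_rfl, h.u_pos.le]
      _ = ∑ s, stationary M π s * (numRare u (π s) * u * c) := by
          rw [Fintype.sum_prod_type]
          refine sum_congr rfl fun s _ => ?_
          change ∑ a, stationary M π s * ((if u / 2 < π s a then 0 else u) * c) = _
          rw [← mul_sum, ← sum_mul, sum_rare]
      _ ≤ ∑ s, stationary M π s * (δ * c) :=
          sum_le_sum fun s _ => mul_le_mul_of_nonneg_left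
            (mul_le_mul_of_nonneg_right (h.rare_le s) hc) (stationary_nonneg M π _)
      _ = δ * c := by rw [← sum_mul, sum_stationary, one_mul]

/-- The next state of a pair with small stationary mass. -/
theorem Perturbed.delta_mul_sum_le (p : stdSimplex ℝ S) (f : S → ℝ) (hf : ∀ s, 0 ≤ f s) :
    δ * ∑ s', p s' * f s' ≤ b / 8 * ∑ s', stationary M π s' * f s' := by
  rw [mul_sum, mul_sum]
  refine sum_le_sum fun s' _ => ?_
  have h1 : p s' * f s' ≤ f s' := mul_le_of_le_one_left (hf s') (stdSimplex.le_one p s')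
  -- The factor `δ` pays for replacing an arbitrary law `p ≤ 1` of the next state by the stationary
  -- one.
  have h2 : δ * f s' ≤ b * stationary M π s' / 8 * f s' :=
    mul_le_mul_of_nonneg_right (h.delta_le s') (hf s')
  have h3 : δ * (p s' * f s') ≤ δ * f s' := mul_le_mul_of_nonneg_left h1 h.delta_nonneg
  nlinarith

theorem Perturbed.delta_mul_nextMean_le (g : S × A → ℝ) (x : S × A) :
    δ * nextMean M π g x ^ 2 ≤ b / 8 * ∑ x, weight M π π x * g x ^ 2 := by
  refine (mul_le_mul_of_nonneg_left (sq_nextMean_le M π g x) h.delta_nonneg).trans ?_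
  rw [nextMean_eq]
  refine (h.delta_mul_sum_le _ _ fun s' => sum_nonneg fun a _ =>
    mul_nonneg (stdSimplex.zero_le _ _) (sq_nonneg _)).trans (le_of_eq ?_)
  simp only [weight, Fintype.sum_prod_type, mul_sum, mul_assoc]

open Classical in
/-- The lower bound for the perturbed quadratic form. -/
theorem Perturbed.isModulus (hb : IsModulus M Ψ π π b) :
    IsModulus M Ψ π (perturb u π) (min (b / 2) (1 / 4)) := by
  refine ⟨lt_min (by linarith [hb.1]) (by norm_num), fun θ => ?_⟩
  have hmod := hb.2 θ
  rw [normSq_eq, dirichlet_eq] at hmod ⊢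
  set g := Ψ.mulVec θ
  set N := ∑ x, weight M π π x * g x ^ 2
  set r : S × A → ℝ := fun x => if u / 2 < π x.1 x.2 then 0 else u
  set F := ∑ x, stationary M π x.1 * (r x * g x ^ 2)
  have hr : ∀ x, 0 ≤ r x := fun x => by
    change 0 ≤ (if u / 2 < π x.1 x.2 then 0 else u)
    split_ifs; exacts [le_rfl, h.u_pos.le]
  have hN0 : 0 ≤ N := sum_nonneg fun x _ => mul_nonneg (weight_nonneg M π π x) (sq_nonneg _)
  have hF0 : 0 ≤ F := sum_nonneg fun x _ =>
    mul_nonneg (stationary_nonneg M π _) (mul_nonneg (hr x) (sq_nonneg _))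
  have h1 : ∑ x, weight M π π x * nextMean M π g x ^ 2 ≤ N := by
    rw [show N = _ from (sum_weight_mul_nextMean M π fun y => g y ^ 2).symm]
    exact sum_le_sum fun x _ => mul_le_mul_of_nonneg_left (sq_nextMean_le M π g x)
      (weight_nonneg M π π x)
  have h2 : ∑ x, stationary M π x.1 * (r x * nextMean M π g x ^ 2) ≤ b / 8 * N := by
    rcases eq_or_lt_of_le h.delta_nonneg with h0 | h0
    · have := h.sum_rare_le (fun x => nextMean M π g x ^ 2) (c := 0) le_rfl
        (by simp [← h0])
      have hb' : 0 ≤ b / 8 * N := mul_nonneg (by linarith [hb.1]) hN0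
      simp only [← h0, zero_mul] at this
      exact this.trans hb'
    · have hc : 0 ≤ b / 8 * N / δ := div_nonneg (mul_nonneg (by linarith [hb.1]) hN0) h0.le
      have e : δ * (b / 8 * N / δ) = b / 8 * N := mul_div_cancel₀ _ h0.ne'
      have := h.sum_rare_le (fun x => nextMean M π g x ^ 2) hc
        (fun x => by rw [e]; exact h.delta_mul_nextMean_le g x)
      rwa [e] at this
  have h3 : ∑ x, weight M π (perturb u π) x * g x ^ 2 ≤ N + F := by
    rw [← sum_add_distrib]
    refine sum_le_sum fun x _ => ?_
    have := mul_le_mul_of_nonneg_left (h.le_add x.1 x.2) (stationary_nonneg M π x.1)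
    have := mul_le_mul_of_nonneg_right this (sq_nonneg (g x))
    simp only [weight]
    refine this.trans (le_of_eq ?_)
    simp only [r]
    ring
  have h4 : (∑ x, weight M π π x * (g x * (g x - nextMean M π g x)))
      - δ * (3 / 2 * N + 1 / 2 * ∑ x, weight M π π x * nextMean M π g x ^ 2)
      + (1 / 4 * F - 1 / 2 * ∑ x, stationary M π x.1 * (r x * nextMean M π g x ^ 2))
      ≤ ∑ x, weight M π (perturb u π) x * (g x * (g x - nextMean M π g x)) := by
    simp only [N, F, mul_sum, ← sum_add_distrib, ← sum_sub_distrib]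
    refine sum_le_sum fun x _ => ?_
    have := mul_le_mul_of_nonneg_left (h.pointwise x.1 x.2 (g x) (nextMean M π g x))
      (stationary_nonneg M π x.1)
    simp only [weight]
    refine le_trans (le_of_eq ?_) (this.trans (le_of_eq ?_))
    · simp only [r]; ring
    · ring
  have h5 : δ ≤ b / 8 := by
    refine (h.delta_le (Classical.arbitrary S)).trans ?_
    have := stationary_le_one M π (Classical.arbitrary S)
    nlinarith [hb.1]
  have h6 : δ * (3 / 2 * N + 1 / 2 * ∑ x, weight M π π x * nextMean M π g x ^ 2)
      ≤ b / 8 * (2 * N) := by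
    have h7 : 0 ≤ ∑ x, weight M π π x * nextMean M π g x ^ 2 :=
      sum_nonneg fun x _ => mul_nonneg (weight_nonneg M π π x) (sq_nonneg _)
    exact mul_le_mul h5 (by linarith) (by positivity) (by linarith [hb.1])
  have hbN : 0 ≤ b * N := mul_nonneg hb.1.le hN0
  have h8 : min (b / 2) (1 / 4) * ∑ x, weight M π (perturb u π) x * g x ^ 2
      ≤ b / 2 * N + 1 / 4 * F := by
    refine (mul_le_mul_of_nonneg_left h3 (le_min (by linarith [hb.1]) (by norm_num))).trans ?_
    rw [mul_add]
    exact add_le_add (mul_le_mul_of_nonneg_right (min_le_left _ _) hN0)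
      (mul_le_mul_of_nonneg_right (min_le_right _ _) hF0)
  -- Balance: of `b N`, the shrinking of the common actions takes `b N / 4` and the next states of
  -- the rare actions take `b N / 16`, which leaves more than `b N / 2`; the term `F / 4` is kept.
  linarith

/-- The second moment of `g` at the next state-action pair under the perturbed weights. -/
theorem Perturbed.sum_nextMean_sq_le (hb : IsModulus M Ψ π π b) (θ : Fin d → ℝ) :
    ∑ x, weight M π (perturb u π) x * nextMean M π (fun y => (Ψ.mulVec θ) y ^ 2) x
      ≤ 25 / 16 * normSq M Ψ π (perturb u π) θ := by
  classical
  have hmod := (hb.2 θ).trans (dirichlet_le_two_mul_normSq M π Ψ θ)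
  rw [normSq_eq] at hmod ⊢
  set g := Ψ.mulVec θ
  set N := ∑ x, weight M π π x * g x ^ 2
  have hN0 : 0 ≤ N := sum_nonneg fun x _ => mul_nonneg (weight_nonneg M π π x) (sq_nonneg _)
  have hn0 : ∀ x, 0 ≤ nextMean M π (fun y => g y ^ 2) x := fun x =>
    (sq_nonneg _).trans (sq_nextMean_le M π g x)
  set r : S × A → ℝ := fun x => if u / 2 < π x.1 x.2 then 0 else u
  have hd : ∀ x, δ * nextMean M π (fun y => g y ^ 2) x ≤ b / 8 * N := by
    intro x
    rw [nextMean_eq]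
    refine (h.delta_mul_sum_le _ _ fun s' => sum_nonneg fun a _ =>
      mul_nonneg (stdSimplex.zero_le _ _) (sq_nonneg _)).trans (le_of_eq ?_)
    simp only [N, weight, Fintype.sum_prod_type, mul_sum, mul_assoc]
  have h2 : ∑ x, stationary M π x.1 * (r x * nextMean M π (fun y => g y ^ 2) x) ≤ b / 8 * N := by
    rcases eq_or_lt_of_le h.delta_nonneg with h0 | h0
    · have := h.sum_rare_le (nextMean M π (fun y => g y ^ 2)) (c := 0) le_rfl
        (by simp [← h0])
      have hb' : 0 ≤ b / 8 * N := mul_nonneg (by linarith [hb.1]) hN0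
      simp only [← h0, zero_mul] at this
      exact this.trans hb'
    · have hc : 0 ≤ b / 8 * N / δ := div_nonneg (mul_nonneg (by linarith [hb.1]) hN0) h0.le
      have e : δ * (b / 8 * N / δ) = b / 8 * N := mul_div_cancel₀ _ h0.ne'
      have := h.sum_rare_le (nextMean M π (fun y => g y ^ 2)) hc
        (fun x => by rw [e]; exact hd x)
      rwa [e] at this
  have h3 : ∑ x, weight M π (perturb u π) x * nextMean M π (fun y => g y ^ 2) x
      ≤ N + b / 8 * N := by
    refine le_trans ?_ (add_le_add (sum_weight_mul_nextMean M π fun y => g y ^ 2).le h2)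
    rw [← sum_add_distrib]
    refine sum_le_sum fun x _ => ?_
    have := mul_le_mul_of_nonneg_left (h.le_add x.1 x.2) (stationary_nonneg M π x.1)
    have := mul_le_mul_of_nonneg_right this (hn0 x)
    simp only [weight]
    refine this.trans (le_of_eq ?_)
    simp only [r]
    ring
  -- If `N > 0` then `b ≤ 2`, so `δ ≤ b / (8 + b) ≤ 1/5`. The final constant is `(1 + 1/4) · 5/4 =
  -- 25/16`.
  have h4 : N ≤ 5 / 4 * ∑ x, weight M π (perturb u π) x * g x ^ 2 := by
    rcases eq_or_lt_of_le hN0 with h0 | h0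
    · rw [← h0]
      exact mul_nonneg (by norm_num)
        (sum_nonneg fun x _ => mul_nonneg (weight_nonneg M π _ x) (sq_nonneg _))
    · have hb2 : b ≤ 2 := le_of_mul_le_mul_right hmod h0
      have hδ : δ ≤ 1 / 5 := by
        refine h.delta_le_div.trans ?_
        rw [div_le_div_iff₀ (by linarith [hb.1]) (by norm_num)]
        linarith
      rw [mul_sum]
      refine sum_le_sum fun x _ => ?_
      have := mul_le_mul_of_nonneg_left (h.mul_le hδ x.1 x.2) (stationary_nonneg M π x.1)
      have := mul_le_mul_of_nonneg_right this (sq_nonneg (g x))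
      simp only [weight]
      linarith
  have h5 : b / 8 * N ≤ 1 / 4 * N := by linarith
  linarith

end Modulus

/-! ### Finite support of the sampling laws -/

section Support

variable (M : Model S A) (Ψ : Matrix (S × A) (Fin d) ℝ) (π π' : Policy S A)

instance finSupp_step (z : Traj S A) : FinSupp (step M π z) := by
  unfold step; infer_instance

instance finSupp_advance (n : ℕ) (z : Traj S A) : FinSupp (advance M π n z) := by
  induction n generalizing z with
  | zero => exact finSupp_pure z
  | succ n ih => exact finSupp_bind _ _

instance finSupp_explore (τ : ℕ) (z : Traj S A) : FinSupp (explore M π π' τ z) := by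
  unfold explore; infer_instance

instance finSupp_costSum (τ' n : ℕ) (z : Traj S A) : FinSupp (costSum M π τ' n z) := by
  induction n generalizing z with
  | zero => exact finSupp_pure _
  | succ n ih => exact finSupp_bind _ _

instance finSupp_operatorSum (τ' : ℕ) (θ : Fin d → ℝ) (ρ : ℝ) (n : ℕ) (z : Traj S A) :
    FinSupp (operatorSum M Ψ π π' τ' θ ρ n z) := by
  induction n generalizing z with
  | zero => exact finSupp_pure _
  | succ n ih => exact finSupp_bind _ _

instance finSupp_innerLoop (η : ℝ) (τ : ℕ) (θ₀ : Fin d → ℝ) (ρ : ℝ) (g : Fin d → ℝ) (n : ℕ)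
    (θ acc : Fin d → ℝ) (z : Traj S A) :
    FinSupp (innerLoop M Ψ π π' η τ θ₀ ρ g n θ acc z) := by
  induction n generalizing θ acc z with
  | zero => exact finSupp_pure _
  | succ n ih => exact finSupp_bind _ _

instance finSupp_epoch (prm : Params) (θ : Fin d → ℝ) (z : Traj S A) :
    FinSupp (epoch M Ψ π π' prm θ z) := by
  unfold epoch; infer_instance

instance finSupp_runEpochs (prm : Params) (n : ℕ) (θ : Fin d → ℝ) (z : Traj S A) :
    FinSupp (runEpochs M Ψ π π' prm n θ z) := by
  induction n generalizing θ z with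
  | zero => exact finSupp_pure _
  | succ n ih => exact finSupp_bind _ _

instance finSupp_critic (u : ℝ) (prm : Params) (s : S) (m : ℕ) :
    FinSupp (critic M Ψ u prm π s m) := by
  unfold critic; infer_instance

instance finSupp_spmd [Nonempty A] (u : Policy S A → ℝ) (prm : Params) (lam : ℝ) (s₀ : S)
    (k : ℕ) : FinSupp (spmd M Ψ u prm lam s₀ k) := by
  induction k with
  | zero => exact finSupp_pure _
  | succ k ih => exact finSupp_bind _ _

end Support

/-! ### The number of samples -/

section Count

variable {M : Model S A} {Ψ : Matrix (S × A) (Fin d) ℝ} {π π' : Policy S A}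

theorem samples_step {z y : Traj S A} (h : y ∈ (step M π z).support) :
    y.samples = z.samples + 1 := by
  simp only [step, PMF.mem_support_bind_iff, PMF.mem_support_map_iff] at h
  obtain ⟨s, -, a, -, rfl⟩ := h
  rfl

theorem samples_advance {n : ℕ} {z y : Traj S A} (h : y ∈ (advance M π n z).support) :
    y.samples = z.samples + n := by
  induction n generalizing z with
  | zero => simp only [advance, PMF.support_pure, Set.mem_singleton_iff] at h; rw [h]; rfl
  | succ n ih =>
    simp only [advance, PMF.mem_support_bind_iff] at h
    obtain ⟨x, hx, hy⟩ := h
    rw [ih hy, samples_step hx]; ring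

theorem samples_explore {τ : ℕ} {z : Traj S A} {r : Obs S A × Traj S A}
    (h : r ∈ (explore M π π' τ z).support) : r.2.samples = z.samples + (τ + 1) := by
  simp only [explore, PMF.mem_support_bind_iff, PMF.mem_support_map_iff] at h
  obtain ⟨y, hy, a, -, s, -, a', -, rfl⟩ := h
  simp only [samples_advance hy]; ring

theorem samples_costSum {τ' n : ℕ} {z : Traj S A} {r : ℝ × Traj S A}
    (h : r ∈ (costSum M π τ' n z).support) : r.2.samples = z.samples + n * (τ' + 1) := by
  induction n generalizing z r with
  | zero => simp only [costSum, PMF.support_pure, Set.mem_singleton_iff] at h; rw [h]; simp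
  | succ n ih =>
    simp only [costSum, PMF.mem_support_bind_iff, PMF.mem_support_map_iff] at h
    obtain ⟨y, hy, q, hq, rfl⟩ := h
    simp only [ih hq, samples_advance hy]; ring

theorem samples_operatorSum {τ' n : ℕ} {θ : Fin d → ℝ} {ρ : ℝ} {z : Traj S A}
    {r : (Fin d → ℝ) × Traj S A} (h : r ∈ (operatorSum M Ψ π π' τ' θ ρ n z).support) :
    r.2.samples = z.samples + n * (τ' + 1) := by
  induction n generalizing z r with
  | zero => simp only [operatorSum, PMF.support_pure, Set.mem_singleton_iff] at h; rw [h]; simp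
  | succ n ih =>
    simp only [operatorSum, PMF.mem_support_bind_iff, PMF.mem_support_map_iff] at h
    obtain ⟨y, hy, q, hq, rfl⟩ := h
    simp only [ih hq, samples_explore hy]; ring

theorem samples_innerLoop {η : ℝ} {τ : ℕ} {θ₀ : Fin d → ℝ} {ρ : ℝ} {g : Fin d → ℝ} {n : ℕ}
    {θ acc : Fin d → ℝ} {z : Traj S A} {r : (Fin d → ℝ) × Traj S A}
    (h : r ∈ (innerLoop M Ψ π π' η τ θ₀ ρ g n θ acc z).support) :
    r.2.samples = z.samples + n * (τ + 1) := by
  induction n generalizing θ acc z with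
  | zero => simp only [innerLoop, PMF.support_pure, Set.mem_singleton_iff] at h; rw [h]; simp
  | succ n ih =>
    simp only [innerLoop, PMF.mem_support_bind_iff] at h
    obtain ⟨y, hy, hq⟩ := h
    rw [ih hq, samples_explore hy]; ring

/-- The number of samples in each epoch of the critic. -/
def Params.epochSamples (prm : Params) : ℕ :=
  (prm.N' + prm.N) * (prm.τ' + 1) + prm.T * (prm.τ + 1)

theorem samples_epoch {prm : Params} {θ : Fin d → ℝ} {z : Traj S A}
    {r : (Fin d → ℝ) × Traj S A} (h : r ∈ (epoch M Ψ π π' prm θ z).support) :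
    r.2.samples = z.samples + prm.epochSamples := by
  simp only [epoch, PMF.mem_support_bind_iff, PMF.mem_support_map_iff] at h
  obtain ⟨x, hx, y, hy, w, hw, rfl⟩ := h
  simp only [samples_innerLoop hw, samples_operatorSum hy, samples_costSum hx,
    Params.epochSamples]
  ring

theorem samples_runEpochs {prm : Params} {n : ℕ} {θ : Fin d → ℝ} {z : Traj S A}
    {r : (Fin d → ℝ) × Traj S A} (h : r ∈ (runEpochs M Ψ π π' prm n θ z).support) :
    r.2.samples = z.samples + n * prm.epochSamples := by
  induction n generalizing θ z with
  | zero => simp only [runEpochs, PMF.support_pure, Set.mem_singleton_iff] at h; rw [h]; simp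
  | succ n ih =>
    simp only [runEpochs, PMF.mem_support_bind_iff] at h
    obtain ⟨y, hy, hq⟩ := h
    rw [ih hq, samples_epoch hy]; ring

theorem samples_critic {u : ℝ} {prm : Params} {s : S} {m : ℕ} {r : (S × A → ℝ) × Traj S A}
    (h : r ∈ (critic M Ψ u prm π s m).support) :
    r.2.samples = m + prm.epochs * prm.epochSamples := by
  simp only [critic, PMF.mem_support_bind_iff, PMF.mem_support_map_iff] at h
  obtain ⟨a, -, w, hw, rfl⟩ := h
  simp only [samples_runEpochs hw]

theorem samples_spmd [Nonempty A] {u : Policy S A → ℝ} {prm : Params} {lam : ℝ} {s₀ : S} {k : ℕ}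
    {z : Iterate S A} (h : z ∈ (spmd M Ψ u prm lam s₀ k).support) :
    z.samples = k * (prm.epochs * prm.epochSamples) := by
  induction k generalizing z with
  | zero => simp only [spmd, PMF.support_pure, Set.mem_singleton_iff] at h; rw [h]; simp
  | succ k ih =>
    simp only [spmd, PMF.mem_support_bind_iff, PMF.mem_support_map_iff] at h
    obtain ⟨y, hy, r, hr, rfl⟩ := h
    simp only [samples_critic hr, ih hy]; ring

end Count

/-! ### The law of the critic does not depend on the number of previous samples -/

section Shift

variable (M : Model S A) (Ψ : Matrix (S × A) (Fin d) ℝ) (π π' : Policy S A)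

/-- Increase the sample counter by `k`. -/
def Traj.shift (k : ℕ) (z : Traj S A) : Traj S A := ⟨z.state, z.action, z.samples + k⟩

theorem step_shift (k : ℕ) (z : Traj S A) :
    step M π (z.shift k) = (step M π z).map (Traj.shift k) := by
  simp only [step, PMF.map_bind, PMF.map_comp, Traj.shift, Function.comp_def, add_right_comm]

theorem advance_shift (k n : ℕ) (z : Traj S A) :
    advance M π n (z.shift k) = (advance M π n z).map (Traj.shift k) := by
  induction n generalizing z with
  | zero => simp [advance, PMF.pure_map]
  | succ n ih =>
    simp only [advance, step_shift, PMF.map_bind, PMF.bind_map, Function.comp_def, ih]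

theorem explore_shift (k τ : ℕ) (z : Traj S A) :
    explore M π π' τ (z.shift k) =
      (explore M π π' τ z).map (fun r => (r.1, r.2.shift k)) := by
  rw [explore, advance_shift]
  simp only [explore, PMF.map_bind, PMF.bind_map, PMF.map_comp, Function.comp_def,
    Traj.shift, add_right_comm]

theorem costSum_shift (k τ' n : ℕ) (z : Traj S A) :
    costSum M π τ' n (z.shift k) = (costSum M π τ' n z).map (fun r => (r.1, r.2.shift k)) := by
  induction n generalizing z with
  | zero => simp [costSum, PMF.pure_map]
  | succ n ih =>
    simp only [costSum, advance_shift, PMF.map_bind, PMF.bind_map, PMF.map_comp,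
      Function.comp_def, ih]
    rfl

theorem operatorSum_shift (k τ' : ℕ) (θ : Fin d → ℝ) (ρ : ℝ) (n : ℕ) (z : Traj S A) :
    operatorSum M Ψ π π' τ' θ ρ n (z.shift k) =
      (operatorSum M Ψ π π' τ' θ ρ n z).map (fun r => (r.1, r.2.shift k)) := by
  induction n generalizing z with
  | zero => simp [operatorSum, PMF.pure_map]
  | succ n ih =>
    simp only [operatorSum, explore_shift, PMF.map_bind, PMF.bind_map, PMF.map_comp,
      Function.comp_def, ih]

theorem innerLoop_shift (k : ℕ) (η : ℝ) (τ : ℕ) (θ₀ : Fin d → ℝ) (ρ : ℝ) (g : Fin d → ℝ)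
    (n : ℕ) (θ acc : Fin d → ℝ) (z : Traj S A) :
    innerLoop M Ψ π π' η τ θ₀ ρ g n θ acc (z.shift k) =
      (innerLoop M Ψ π π' η τ θ₀ ρ g n θ acc z).map (fun r => (r.1, r.2.shift k)) := by
  induction n generalizing θ acc z with
  | zero => simp [innerLoop, PMF.pure_map]
  | succ n ih =>
    simp only [innerLoop, explore_shift, PMF.map_bind, PMF.bind_map, Function.comp_def, ih]

theorem epoch_shift (k : ℕ) (prm : Params) (θ : Fin d → ℝ) (z : Traj S A) :
    epoch M Ψ π π' prm θ (z.shift k) =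
      (epoch M Ψ π π' prm θ z).map (fun r => (r.1, r.2.shift k)) := by
  simp only [epoch, costSum_shift, operatorSum_shift, innerLoop_shift, PMF.map_bind, PMF.bind_map,
    PMF.map_comp, Function.comp_def]

theorem runEpochs_shift (k : ℕ) (prm : Params) (n : ℕ) (θ : Fin d → ℝ) (z : Traj S A) :
    runEpochs M Ψ π π' prm n θ (z.shift k) =
      (runEpochs M Ψ π π' prm n θ z).map (fun r => (r.1, r.2.shift k)) := by
  induction n generalizing θ z with
  | zero => simp [runEpochs, PMF.pure_map]
  | succ n ih =>
    simp only [runEpochs, epoch_shift, PMF.map_bind, PMF.bind_map, Function.comp_def, ih]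

theorem critic_shift (u : ℝ) (prm : Params) (s : S) (m : ℕ) :
    critic M Ψ u prm π s m =
      (critic M Ψ u prm π s 0).map (fun r => (r.1, r.2.shift m)) := by
  have e : ∀ a, (⟨s, a, m⟩ : Traj S A) = Traj.shift m ⟨s, a, 0⟩ := fun a => by
    simp [Traj.shift]
  simp only [critic, e, runEpochs_shift, PMF.map_bind, PMF.map_comp, Function.comp_def]

/-- The second moment is defined with the sample counter at 0, whereas the actor calls the critic
with any value of the counter. -/
theorem expect_critic_samples (u : ℝ) (prm : Params) (s : S) (m : ℕ) (f : (S × A → ℝ) → ℝ) :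
    expect (critic M Ψ u prm π s m) (fun r => f r.1) =
      expect (critic M Ψ u prm π s 0) (fun r => f r.1) := by
  rw [critic_shift, expect_map]

end Shift

/-! ### Approximate stationarity of the observations -/

section Oracle

variable [Nonempty S] (M : Model S A) (π π' : Policy S A)

/-- The law of a pair with the state stationary for `π` and the action drawn from `π'`. -/
def pairLaw : PMF (S × A) :=
  (draw (exists_isStationary M π).choose).bind fun s => (draw (π' s)).map fun a => (s, a)

/-- The law of an exploratory observation from the stationary state. -/
def obsLaw : PMF (Obs S A) :=
  (pairLaw M π π').bind fun x => (draw (M.trans x.1 x.2)).bind fun s' =>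
    (draw (π s')).map fun a' => ⟨x, (s', a')⟩

instance finSupp_obsLaw : FinSupp (obsLaw M π π') := by
  unfold obsLaw; infer_instance

theorem expect_pairLaw (f : S × A → ℝ) :
    expect (pairLaw M π π') f = ∑ x, weight M π π' x * f x := by
  simp only [pairLaw, expect_bind, expect_map, expect_draw, weight, Fintype.sum_prod_type,
    stationary_eq, mul_sum, mul_assoc]

theorem expect_obsLaw (f : Obs S A → ℝ) :
    expect (obsLaw M π π') f =
      ∑ x, weight M π π' x * nextMean M π (fun y => f ⟨x, y⟩) x := by
  simp only [obsLaw, expect_bind, expect_map, expect_draw, expect_pairLaw, nextMean_eq]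

theorem expect_obsLaw_eq (f : Obs S A → ℝ) :
    expect (obsLaw M π π') f = ∑ s, stationary M π s * expect (draw (π' s)) fun a =>
      nextMean M π (fun y => f ⟨(s, a), y⟩) (s, a) := by
  simp only [expect_obsLaw, expect_draw, weight, Fintype.sum_prod_type, mul_sum, mul_assoc]

theorem expect_step (g : S × A → ℝ) (z : Traj S A) :
    expect (step M π z) (fun y => g (y.state, y.action)) =
      nextMean M π g (z.state, z.action) := by
  simp only [step, expect_bind, expect_map, expect_draw, nextMean_eq]

/-- The first transition uses the action that has been drawn already; only from the second one on is
the state a Markov chain with matrix `stateMatrix`. So `n + 1` steps produce its `n`-th power. -/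
theorem expect_advance (n : ℕ) (g : S × A → ℝ) (z : Traj S A) :
    expect (advance M π (n + 1) z) (fun y => g (y.state, y.action)) =
      ∑ s', M.trans z.state z.action s' *
        (stateMatrix M π ^ n).mulVec (fun s => ∑ a, π s a * g (s, a)) s' := by
  induction n generalizing z with
  | zero =>
    rw [advance, expect_bind]
    simp only [advance, expect_pure, expect_step, nextMean_eq, pow_zero, one_mulVec]
  | succ n ih =>
    rw [advance, expect_bind]
    simp only [ih]
    rw [expect_step M π fun x => ∑ s', M.trans x.1 x.2 s' *
        (stateMatrix M π ^ n).mulVec (fun s => ∑ a, π s a * g (s, a)) s', nextMean_eq]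
    refine sum_congr rfl fun s' _ => ?_
    congr 1
    rw [pow_succ', ← mulVec_mulVec]
    generalize (stateMatrix M π ^ n).mulVec (fun s => ∑ a, π s a * g (s, a)) = F
    simp only [mulVec, dotProduct, stateMatrix, of_apply, mul_sum, sum_mul]
    rw [sum_comm]
    simp only [mul_assoc]

/-- After `n` steps the law of the chain is close to the stationary one, relative to the latter. -/
def Mixes (n : ℕ) (δ : ℝ) : Prop :=
  ∀ s s', |(stateMatrix M π ^ n) s s' - stationary M π s'| ≤ δ * stationary M π s'

variable {M π} {n : ℕ} {δ : ℝ}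

/-- Closeness relative to the stationary mass, rather than in total variation, makes the error
proportional to the stationary mean of `|f|`. No supremum of `f` enters, so the estimate can be
applied to quadratic quantities of the features. -/
theorem Mixes.abs_sub_le (h : Mixes M π n δ) (p : stdSimplex ℝ S) (f : S → ℝ) :
    |∑ s', p s' * (stateMatrix M π ^ n).mulVec f s' - ∑ s, stationary M π s * f s|
      ≤ δ * ∑ s, stationary M π s * |f s| := by
  have e : ∑ s', p s' * (stateMatrix M π ^ n).mulVec f s' - ∑ s, stationary M π s * f s
      = ∑ s', p s' * ∑ s, ((stateMatrix M π ^ n) s' s - stationary M π s) * f s := by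
    simp only [mulVec, dotProduct, sub_mul, sum_sub_distrib, mul_sub, ← sum_mul,
      stdSimplex.sum_eq_one, one_mul]
  rw [e]
  calc _ ≤ ∑ s', p s' * ∑ s, |((stateMatrix M π ^ n) s' s - stationary M π s) * f s| := by
        refine (abs_sum_le_sum_abs _ _).trans (sum_le_sum fun s' _ => ?_)
        rw [abs_mul, abs_of_nonneg (stdSimplex.zero_le p s')]
        exact mul_le_mul_of_nonneg_left (abs_sum_le_sum_abs _ _) (stdSimplex.zero_le p s')
    _ ≤ ∑ s', p s' * ∑ s, δ * (stationary M π s * |f s|) := by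
        refine sum_le_sum fun s' _ => mul_le_mul_of_nonneg_left (sum_le_sum fun s _ => ?_)
          (stdSimplex.zero_le p s')
        rw [abs_mul, ← mul_assoc]
        exact mul_le_mul_of_nonneg_right (h s' s) (abs_nonneg _)
    _ = _ := by rw [← sum_mul, stdSimplex.sum_eq_one, one_mul, ← mul_sum]

/-- The cost samples are nearly stationary. -/
theorem Mixes.abs_advance_sub_le (h : Mixes M π n δ) (hδ : 0 ≤ δ) (g : S × A → ℝ)
    (z : Traj S A) :
    |expect (advance M π (n + 1) z) (fun y => g (y.state, y.action)) - expect (pairLaw M π π) g|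
      ≤ δ * expect (pairLaw M π π) fun x => |g x| := by
  have e : ∀ f : S × A → ℝ, expect (pairLaw M π π) f =
      ∑ s, stationary M π s * ∑ a, π s a * f (s, a) := by
    intro f
    simp only [expect_pairLaw, weight, Fintype.sum_prod_type, mul_sum, mul_assoc]
  rw [expect_advance, e, e]
  refine (h.abs_sub_le _ _).trans (mul_le_mul_of_nonneg_left (sum_le_sum fun s _ => ?_) hδ)
  refine mul_le_mul_of_nonneg_left ?_ (stationary_nonneg M π s)
  simpa [expect_draw] using abs_expect_le (draw (π s)) fun a => g (s, a)

/-- The exploratory observations are nearly stationary. -/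
theorem Mixes.abs_explore_sub_le (h : Mixes M π n δ) (hδ : 0 ≤ δ) (f : Obs S A → ℝ)
    (z : Traj S A) :
    |expect (explore M π π' (n + 1) z) (fun r => f r.1) - expect (obsLaw M π π') f|
      ≤ δ * expect (obsLaw M π π') fun ξ => |f ξ| := by
  -- The observation depends on the past only through the state in which the skipped steps end; `F`
  -- is the conditional mean given this state.
  set F : S → ℝ := fun s => expect (draw (π' s)) fun a =>
    nextMean M π (fun y => f ⟨(s, a), y⟩) (s, a) with hF
  have e : expect (explore M π π' (n + 1) z) (fun r => f r.1)
      = expect (advance M π (n + 1) z) (fun y => (fun x : S × A => F x.1) (y.state, y.action)) := by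
    rw [explore, expect_bind]
    simp only [expect_bind, expect_map, expect_draw, hF, nextMean_eq]
  rw [e, expect_advance M π n fun x : S × A => F x.1, expect_obsLaw_eq, expect_obsLaw_eq]
  simp only [← sum_mul, stdSimplex.sum_eq_one, one_mul]
  refine (h.abs_sub_le _ F).trans (mul_le_mul_of_nonneg_left (sum_le_sum fun s _ => ?_) hδ)
  refine mul_le_mul_of_nonneg_left ?_ (stationary_nonneg M π s)
  refine (abs_expect_le _ _).trans (expect_mono _ fun a => ?_)
  simp only [nextMean]
  refine (abs_sum_le_sum_abs _ _).trans (le_of_eq (sum_congr rfl fun y _ => ?_))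
  rw [abs_mul, abs_of_nonneg ((pairMatrix_mem M π).1 _ _)]

end Oracle

/-! ### The projected operator -/

section Operator

variable (M : Model S A) (Ψ : Matrix (S × A) (Fin d) ℝ) (π π' : Policy S A)

/-- The operator `Ψᵀ D̃ (I - P) Ψ`. -/
def projOp : (Fin d → ℝ) →ₗ[ℝ] (Fin d → ℝ) :=
  (Ψ.transpose * diagonal (weight M π π') * (1 - pairMatrix M π) * Ψ).mulVecLin

/-- The linear part of the stochastic operator. -/
def tdLin (ξ : Obs S A) (v : Fin d → ℝ) : Fin d → ℝ := ((Ψ ξ.cur - Ψ ξ.next) ⬝ᵥ v) • Ψ ξ.cur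

theorem tdOperator_eq (θ : Fin d → ℝ) (ρ : ℝ) (ξ : Obs S A) :
    tdOperator M Ψ θ ρ ξ = tdLin Ψ ξ θ - (costVec M ξ.cur - ρ) • Ψ ξ.cur := by
  rw [tdOperator, tdLin, ← sub_smul, costVec]
  congr 1
  ring

theorem tdLin_sub (ξ : Obs S A) (v w : Fin d → ℝ) :
    tdLin Ψ ξ (v - w) = tdLin Ψ ξ v - tdLin Ψ ξ w := by
  rw [tdLin, dotProduct_sub, sub_smul]; rfl

theorem tdOperator_sub (θ θ₀ : Fin d → ℝ) (ρ : ℝ) (ξ : Obs S A) :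
    tdOperator M Ψ θ ρ ξ - tdOperator M Ψ θ₀ ρ ξ = tdLin Ψ ξ (θ - θ₀) := by
  rw [tdOperator_eq, tdOperator_eq, tdLin_sub]
  abel

theorem dotProduct_tdLin (w : Fin d → ℝ) (ξ : Obs S A) (v : Fin d → ℝ) :
    w ⬝ᵥ tdLin Ψ ξ v = (Ψ ξ.cur ⬝ᵥ w) * ((Ψ ξ.cur - Ψ ξ.next) ⬝ᵥ v) := by
  rw [tdLin, dotProduct_smul, smul_eq_mul, dotProduct_comm w, mul_comm]

theorem dotProduct_projOp (w v : Fin d → ℝ) :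
    w ⬝ᵥ projOp M Ψ π π' v = ∑ x, weight M π π' x *
      ((Ψ.mulVec w) x * ((Ψ.mulVec v) x - nextMean M π (Ψ.mulVec v) x)) := by
  have e : projOp M Ψ π π' v = Ψ.transpose.mulVec ((diagonal (weight M π π')).mulVec
      ((1 - pairMatrix M π).mulVec (Ψ.mulVec v))) := by
    simp only [projOp, mulVecLin_apply, mulVec_mulVec, Matrix.mul_assoc]
  rw [e, dotProduct_mulVec, vecMul_transpose]
  simp only [dotProduct, mulVec_diagonal, sub_mulVec, one_mulVec, Pi.sub_apply]
  refine sum_congr rfl fun x _ => ?_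
  change _ * (_ * (_ - nextMean M π (Ψ.mulVec v) x)) = _
  ring

theorem dirichlet_eq_dotProduct (v : Fin d → ℝ) :
    dirichlet M Ψ π π' v = v ⬝ᵥ projOp M Ψ π π' v := by
  rw [dirichlet_eq, dotProduct_projOp]

theorem projectedBellman_iff (θ : Fin d → ℝ) :
    ProjectedBellman M Ψ π π' θ ↔ projOp M Ψ π π' θ =
      (Ψ.transpose * diagonal (weight M π π')).mulVec fun x => costVec M x - avgCost M π := by
  rw [ProjectedBellman, projOp, mulVecLin_apply, Matrix.mul_sub, Matrix.mul_one, Matrix.sub_mul,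
    sub_mulVec, sub_eq_iff_eq_add']

variable [Nonempty S]

theorem nextMean_const (c : ℝ) (x : S × A) : nextMean M π (fun _ => c) x = c := by
  rw [nextMean, ← sum_mul, sum_row_of_mem_rowStochastic (pairMatrix_mem M π), one_mul]

theorem expect_obsLaw_cur (f : S × A → ℝ) :
    expect (obsLaw M π π') (fun ξ => f ξ.cur) = ∑ x, weight M π π' x * f x := by
  simp only [expect_obsLaw, nextMean_const]

theorem expect_obsLaw_next (f : S × A → ℝ) :
    expect (obsLaw M π π') (fun ξ => f ξ.next) = ∑ x, weight M π π' x * nextMean M π f x := by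
  simp only [expect_obsLaw]

theorem vmean_tdLin (v : Fin d → ℝ) :
    vmean (obsLaw M π π') (fun ξ => tdLin Ψ ξ v) = projOp M Ψ π π' v := by
  refine dotProduct_eq _ _ fun w => ?_
  rw [dotProduct_comm, dotProduct_comm _ w, dotProduct_vmean, dotProduct_projOp, expect_obsLaw]
  refine sum_congr rfl fun x _ => ?_
  congr 1
  simp only [dotProduct_tdLin, sub_dotProduct]
  simp only [nextMean]
  rw [mul_sub, mul_sum, ← one_mul ((Ψ *ᵥ w) x * (Ψ *ᵥ v) x),
    ← sum_row_of_mem_rowStochastic (pairMatrix_mem M π) x, sum_mul, ← sum_sub_distrib]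
  refine sum_congr rfl fun y _ => ?_
  simp only [mulVec]
  ring

theorem vmean_cost (c : ℝ) :
    vmean (obsLaw M π π') (fun ξ => (costVec M ξ.cur - c) • Ψ ξ.cur) =
      (Ψ.transpose * diagonal (weight M π π')).mulVec fun x => costVec M x - c := by
  refine dotProduct_eq _ _ fun w => ?_
  rw [dotProduct_comm, dotProduct_comm _ w, dotProduct_vmean, ← mulVec_mulVec, dotProduct_mulVec,
    vecMul_transpose,
    expect_obsLaw_cur M π π' fun x => w ⬝ᵥ ((costVec M x - c) • Ψ x)]
  rw [dotProduct]
  refine sum_congr rfl fun x _ => ?_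
  rw [mulVec_diagonal, dotProduct_smul, smul_eq_mul, dotProduct_comm]
  simp only [mulVec]
  ring

theorem expect_pairLaw_cost : expect (pairLaw M π π) (costVec M) = avgCost M π := by
  rw [expect_pairLaw]
  simp only [avgCost, weight, Fintype.sum_prod_type, mul_sum, mul_assoc, costVec]

end Operator

/-! ### The setting of the analysis of the critic for one policy -/

/-- The properties of a policy, its perturbation and the features that the analysis uses. -/
structure CriticSetting [Nonempty S] (M : Model S A) (Ψ : Matrix (S × A) (Fin d) ℝ)
    (π π' : Policy S A) (b μ cbar δ : ℝ) (n : ℕ) : Prop where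
  feature_le : ∀ x, Ψ x ⬝ᵥ Ψ x ≤ 1
  cost_le : ∀ x, |costVec M x| ≤ cbar
  modulus : IsModulus M Ψ π π' b
  b_le : b ≤ 1
  mu_pos : 0 < μ
  mu_le : μ ≤ 1
  gram : ∀ θ : Fin d → ℝ, μ * (θ ⬝ᵥ θ) ≤ normSq M Ψ π π' θ
  next_le : ∀ θ : Fin d → ℝ, ∑ x, weight M π π' x *
    nextMean M π (fun y => (Ψ.mulVec θ) y ^ 2) x ≤ 25 / 16 * normSq M Ψ π π' θ
  delta_nonneg : 0 ≤ δ
  delta_le : δ ≤ b / 1000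
  mixes : ∀ m, n ≤ m → Mixes M π m δ

namespace CriticSetting

variable [Nonempty S] {M : Model S A} {Ψ : Matrix (S × A) (Fin d) ℝ}
  {π π' : Policy S A} {b μ cbar δ : ℝ} {n : ℕ} (h : CriticSetting M Ψ π π' b μ cbar δ n)
include h

local notation "hq" => normSq M Ψ π π'
local notation "𝒜" => projOp M Ψ π π'

theorem b_pos : 0 < b := h.modulus.1

theorem delta_le_one : δ ≤ 1 := by
  have := h.delta_le
  have := h.b_le
  linarith

theorem nrm_feature_le (x : S × A) : nrm (Ψ x) ≤ 1 := by
  have := h.feature_le x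
  rw [← nrm_sq] at this
  nlinarith [nrm_nonneg (Ψ x)]

theorem normSq_nonneg (v : Fin d → ℝ) : 0 ≤ hq v := by
  rw [normSq_eq]
  exact sum_nonneg fun x _ => mul_nonneg (weight_nonneg M π π' x) (sq_nonneg _)

theorem normSq_add_le (v w : Fin d → ℝ) : hq (v + w) ≤ 2 * hq v + 2 * hq w := by
  simp only [normSq_eq, mul_sum, ← sum_add_distrib]
  refine sum_le_sum fun x _ => ?_
  rw [mulVec_add, Pi.add_apply]
  have := mul_nonneg (weight_nonneg M π π' x) (sq_nonneg ((Ψ *ᵥ v) x - (Ψ *ᵥ w) x))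
  nlinarith

theorem normSq_sub_le (v w : Fin d → ℝ) : hq (v - w) ≤ 2 * hq v + 2 * hq w := by
  simp only [normSq_eq, mul_sum, ← sum_add_distrib]
  refine sum_le_sum fun x _ => ?_
  rw [mulVec_sub, Pi.sub_apply]
  have := mul_nonneg (weight_nonneg M π π' x) (sq_nonneg ((Ψ *ᵥ v) x + (Ψ *ᵥ w) x))
  nlinarith

theorem normSq_smul (c : ℝ) (v : Fin d → ℝ) : hq (c • v) = c ^ 2 * hq v := by
  simp only [normSq_eq, mul_sum]
  refine sum_congr rfl fun x _ => ?_
  rw [mulVec_smul, Pi.smul_apply, smul_eq_mul]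
  ring

theorem normSq_zero : normSq M Ψ π π' 0 = 0 := by
  simp [normSq]

theorem mulVec_sq_le (v : Fin d → ℝ) (x : S × A) : (Ψ *ᵥ v) x ^ 2 ≤ nrm v ^ 2 := by
  have h1 := abs_dotProduct_le (Ψ x) v
  have h2 := h.nrm_feature_le x
  have h3 : |(Ψ *ᵥ v) x| ≤ nrm v := h1.trans (mul_le_of_le_one_left (nrm_nonneg v) h2)
  exact sq_le_sq' (by linarith [neg_abs_le ((Ψ *ᵥ v) x)]) ((le_abs_self _).trans h3)

theorem normSq_le (v : Fin d → ℝ) : hq v ≤ nrm v ^ 2 := by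
  rw [normSq_eq]
  calc _ ≤ ∑ x, weight M π π' x * nrm v ^ 2 := sum_le_sum fun x _ =>
        mul_le_mul_of_nonneg_left (h.mulVec_sq_le v x) (weight_nonneg M π π' x)
    _ = _ := by rw [← sum_mul, sum_weight, one_mul]

theorem mu_mul_le (v : Fin d → ℝ) : μ * nrm v ^ 2 ≤ hq v := by
  rw [nrm_sq]; exact h.gram v

theorem nrm_sq_le (v : Fin d → ℝ) : nrm v ^ 2 ≤ hq v / μ := by
  rw [le_div_iff₀ h.mu_pos, mul_comm]; exact h.mu_mul_le v

theorem modulus_le (v : Fin d → ℝ) : b * hq v ≤ v ⬝ᵥ 𝒜 v := by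
  rw [← dirichlet_eq_dotProduct]; exact h.modulus.2 v

theorem expect_cur_sq (v : Fin d → ℝ) :
    expect (obsLaw M π π') (fun ξ => (Ψ ξ.cur ⬝ᵥ v) ^ 2) = hq v := by
  rw [expect_obsLaw_cur M π π' fun x => (Ψ x ⬝ᵥ v) ^ 2, normSq_eq]
  rfl

/-- The square of the difference is at most twice the sum of the squares, and the next pair costs
`25/16`; the constant `2 + 25/8` is rounded up to 6. -/
theorem expect_diff_sq_le (v : Fin d → ℝ) :
    expect (obsLaw M π π') (fun ξ => ((Ψ ξ.cur - Ψ ξ.next) ⬝ᵥ v) ^ 2) ≤ 6 * hq v := by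
  have h1 : expect (obsLaw M π π') (fun ξ => (Ψ ξ.next ⬝ᵥ v) ^ 2) ≤ 25 / 16 * hq v := by
    rw [expect_obsLaw_next M π π' fun x => (Ψ x ⬝ᵥ v) ^ 2]
    exact h.next_le v
  have h2 : expect (obsLaw M π π') (fun ξ => ((Ψ ξ.cur - Ψ ξ.next) ⬝ᵥ v) ^ 2)
      ≤ expect (obsLaw M π π')
        (fun ξ => 2 * (Ψ ξ.cur ⬝ᵥ v) ^ 2 + 2 * (Ψ ξ.next ⬝ᵥ v) ^ 2) := by
    refine expect_mono _ fun ξ => ?_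
    rw [sub_dotProduct]
    nlinarith [sq_nonneg (Ψ ξ.cur ⬝ᵥ v + Ψ ξ.next ⬝ᵥ v)]
  rw [expect_add, expect_const_mul, expect_const_mul, h.expect_cur_sq] at h2
  have := h.normSq_nonneg v
  linarith

theorem nrm_tdLin_sq_le (ξ : Obs S A) (v : Fin d → ℝ) :
    nrm (tdLin Ψ ξ v) ^ 2 ≤ ((Ψ ξ.cur - Ψ ξ.next) ⬝ᵥ v) ^ 2 := by
  rw [tdLin, nrm_smul, mul_pow, sq_abs]
  refine mul_le_of_le_one_right (sq_nonneg _) ?_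
  rw [nrm_sq]; exact h.feature_le _

theorem nrm_tdLin_le (ξ : Obs S A) (v : Fin d → ℝ) : nrm (tdLin Ψ ξ v) ≤ 2 * nrm v := by
  rw [tdLin, nrm_smul]
  have h1 := abs_dotProduct_le (Ψ ξ.cur - Ψ ξ.next) v
  have h2 := nrm_sub_le (Ψ ξ.cur) (Ψ ξ.next)
  have h3 := h.nrm_feature_le ξ.cur
  have h4 := h.nrm_feature_le ξ.next
  have h5 := nrm_nonneg v
  have h6 : |(Ψ ξ.cur - Ψ ξ.next) ⬝ᵥ v| ≤ 2 * nrm v :=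
    h1.trans (mul_le_mul_of_nonneg_right (by linarith) h5)
  exact (mul_le_of_le_one_right (abs_nonneg _) h3).trans h6

/-- Jensen's inequality for the mean of `tdLin`. A bound by the `D̃`-norm, with no factor `1 / μ`,
lets terms of order `η²` be absorbed into the contraction `η b`. -/
theorem nrm_projOp_sq_le (v : Fin d → ℝ) : nrm (𝒜 v) ^ 2 ≤ 6 * hq v := by
  have h1 : nrm (𝒜 v) ≤ expect (obsLaw M π π') fun ξ => nrm (tdLin Ψ ξ v) := by
    rw [← vmean_tdLin]; exact nrm_vmean_le _ _
  calc nrm (𝒜 v) ^ 2 ≤ (expect (obsLaw M π π') fun ξ => nrm (tdLin Ψ ξ v)) ^ 2 :=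
        pow_le_pow_left₀ (nrm_nonneg _) h1 2
    _ ≤ expect (obsLaw M π π') fun ξ => nrm (tdLin Ψ ξ v) ^ 2 := sq_expect_le _ _
    _ ≤ _ := (expect_mono _ fun ξ => h.nrm_tdLin_sq_le ξ v).trans (h.expect_diff_sq_le v)

/-- Chain `μ b ‖v‖² ≤ b ‖Ψ v‖² ≤ ⟨v, A v⟩ ≤ ‖v‖ ‖A v‖`; this is the quantitative invertibility of
the projected operator. -/
theorem mu_b_mul_nrm_le (v : Fin d → ℝ) : μ * b * nrm v ≤ nrm (𝒜 v) := by
  rcases eq_or_lt_of_le (nrm_nonneg v) with h0 | h0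
  · rw [← h0, mul_zero]; exact nrm_nonneg _
  · refine le_of_mul_le_mul_left ?_ h0
    have h1 := (le_abs_self _).trans (abs_dotProduct_le v (𝒜 v))
    have h2 := h.modulus_le v
    have h3 := mul_le_mul_of_nonneg_left (h.mu_mul_le v) h.b_pos.le
    nlinarith

theorem projOp_injective : Function.Injective 𝒜 := by
  rw [← LinearMap.ker_eq_bot, LinearMap.ker_eq_bot']
  intro v hv
  have h1 := h.mu_b_mul_nrm_le v
  rw [hv, nrm_zero] at h1
  have h2 : nrm v ≤ 0 := by
    have := mul_pos h.mu_pos h.b_pos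
    by_contra! h3
    nlinarith
  have h3 : nrm v = 0 := le_antisymm h2 (nrm_nonneg v)
  simpa [nrm] using h3

theorem exists_projOp_eq (g : Fin d → ℝ) : ∃ v, 𝒜 v = g :=
  (LinearMap.injective_iff_surjective.1 h.projOp_injective) g

/-- The samples are nearly stationary. -/
theorem abs_explore_sub_le (f : Obs S A → ℝ) (z : Traj S A) :
    |expect (explore M π π' (n + 1) z) (fun r => f r.1) - expect (obsLaw M π π') f|
      ≤ δ * expect (obsLaw M π π') fun ξ => |f ξ| :=
  (h.mixes n le_rfl).abs_explore_sub_le π' h.delta_nonneg f z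

theorem expect_explore_le (f : Obs S A → ℝ) (hf : ∀ ξ, 0 ≤ f ξ) (z : Traj S A) :
    expect (explore M π π' (n + 1) z) (fun r => f r.1) ≤ 2 * expect (obsLaw M π π') f := by
  have h1 := (le_abs_self _).trans (h.abs_explore_sub_le f z)
  simp only [fun ξ => abs_of_nonneg (hf ξ)] at h1
  have h2 := expect_nonneg (obsLaw M π π') hf
  have h3 := mul_le_mul_of_nonneg_right h.delta_le_one h2
  linarith

theorem nrm_vmean_explore_sub_le (f : Obs S A → Fin d → ℝ) (z : Traj S A) :
    nrm (vmean (explore M π π' (n + 1) z) (fun r => f r.1) - vmean (obsLaw M π π') f)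
      ≤ δ * expect (obsLaw M π π') fun ξ => nrm (f ξ) := by
  have h0 : 0 ≤ expect (obsLaw M π π') fun ξ => nrm (f ξ) :=
    expect_nonneg _ fun ξ => nrm_nonneg _
  refine nrm_le_of_dotProduct_le (mul_nonneg h.delta_nonneg h0) fun w => ?_
  rw [dotProduct_sub, dotProduct_vmean, dotProduct_vmean]
  refine (le_abs_self _).trans ((h.abs_explore_sub_le (fun ξ => w ⬝ᵥ f ξ) z).trans ?_)
  have h1 : expect (obsLaw M π π') (fun ξ => |w ⬝ᵥ f ξ|)
      ≤ nrm w * expect (obsLaw M π π') fun ξ => nrm (f ξ) := by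
    rw [← expect_const_mul]
    exact expect_mono _ fun ξ => abs_dotProduct_le _ _
  have := mul_le_mul_of_nonneg_left h1 h.delta_nonneg
  linarith

/-- One step of the inner loop contracts towards the point `θc`. -/
theorem descent {η : ℝ} (hη : 0 < η) (hηb : η ≤ b / 10000) (θ θ₀ θc : Fin d → ℝ) (ρ : ℝ)
    (z : Traj S A) :
    expect (explore M π π' (n + 1) z) (fun r => nrm (θ - η • (tdOperator M Ψ θ ρ r.1
        - tdOperator M Ψ θ₀ ρ r.1 + 𝒜 (θ₀ - θc)) - θc) ^ 2)
      ≤ nrm (θ - θc) ^ 2 - η * b * hq (θ - θc) + η * b / 40 * hq (θ₀ - θc) := by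
  set Δ := θ - θc with hΔ
  set Δ₁ := θ₀ - θc with hΔ₁
  set v := θ - θ₀ with hv
  have hvΔ : v = Δ - Δ₁ := by rw [hv, hΔ, hΔ₁]; abel
  have hqv : hq v ≤ 2 * hq Δ + 2 * hq Δ₁ := by rw [hvΔ]; exact h.normSq_sub_le _ _
  have hb := h.b_pos
  have hδ := h.delta_nonneg
  have h0 := h.normSq_nonneg Δ
  have h1 := h.normSq_nonneg Δ₁
  set L := expect (explore M π π' (n + 1) z)
    (fun r => (Ψ r.1.cur ⬝ᵥ Δ) * ((Ψ r.1.cur - Ψ r.1.next) ⬝ᵥ v)) with hL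
  set R := expect (explore M π π' (n + 1) z)
    (fun r => ((Ψ r.1.cur - Ψ r.1.next) ⬝ᵥ v) ^ 2) with hR
  have hstep : expect (explore M π π' (n + 1) z) (fun r => nrm (θ - η • (tdOperator M Ψ θ ρ r.1
        - tdOperator M Ψ θ₀ ρ r.1 + 𝒜 Δ₁) - θc) ^ 2)
      ≤ (nrm Δ ^ 2 - 2 * η * (Δ ⬝ᵥ 𝒜 Δ₁) + 12 * η ^ 2 * hq Δ₁) - 2 * η * L + 2 * η ^ 2 * R := by
    rw [hL, hR, ← expect_const_mul, ← expect_const_mul,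
      ← expect_const (explore M π π' (n + 1) z)
        (nrm Δ ^ 2 - 2 * η * (Δ ⬝ᵥ 𝒜 Δ₁) + 12 * η ^ 2 * hq Δ₁),
      ← expect_sub, ← expect_add]
    refine expect_mono _ fun r => ?_
    rw [tdOperator_sub]
    have e1 : θ - η • (tdLin Ψ r.1 (θ - θ₀) + 𝒜 Δ₁) - θc
        = Δ - η • (tdLin Ψ r.1 v + 𝒜 Δ₁) := by rw [hΔ]; abel
    have e2 : nrm (Δ - η • (tdLin Ψ r.1 v + 𝒜 Δ₁)) ^ 2 = nrm Δ ^ 2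
        - 2 * η * (Δ ⬝ᵥ tdLin Ψ r.1 v + Δ ⬝ᵥ 𝒜 Δ₁)
        + η ^ 2 * nrm (tdLin Ψ r.1 v + 𝒜 Δ₁) ^ 2 := by
      rw [nrm_sq, nrm_sq, nrm_sq, ← dotProduct_add]
      simp only [sub_dotProduct, dotProduct_sub, smul_dotProduct, dotProduct_smul, smul_eq_mul]
      rw [dotProduct_comm (tdLin Ψ r.1 v + 𝒜 Δ₁) Δ]
      ring
    rw [e1, e2, dotProduct_tdLin]
    have e3 := nrm_add_sq_le (tdLin Ψ r.1 v) (𝒜 Δ₁)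
    have e4 := h.nrm_tdLin_sq_le r.1 v
    have e5 := h.nrm_projOp_sq_le Δ₁
    have e6 : η ^ 2 * nrm (tdLin Ψ r.1 v + 𝒜 Δ₁) ^ 2
        ≤ η ^ 2 * (2 * ((Ψ r.1.cur - Ψ r.1.next) ⬝ᵥ v) ^ 2 + 12 * hq Δ₁) :=
      mul_le_mul_of_nonneg_left (by linarith) (sq_nonneg η)
    linarith
  have hRle : R ≤ 12 * hq v := by
    have := h.expect_explore_le (fun ξ => ((Ψ ξ.cur - Ψ ξ.next) ⬝ᵥ v) ^ 2)
      (fun ξ => sq_nonneg _) z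
    have := h.expect_diff_sq_le v
    linarith
  -- Under stationarity the cross term has mean `⟨Δ, A v⟩`. The deviation is `δ` times the mean of a
  -- product of two factors, whose second moments are `‖ΨΔ‖²` and at most `6 ‖Ψv‖²`.
  have hLge : Δ ⬝ᵥ 𝒜 v - δ * (1 / 2 * hq Δ + 3 * hq v) ≤ L := by
    have e1 := (abs_le.1 (h.abs_explore_sub_le
      (fun ξ => (Ψ ξ.cur ⬝ᵥ Δ) * ((Ψ ξ.cur - Ψ ξ.next) ⬝ᵥ v)) z)).1
    have e2 : expect (obsLaw M π π') (fun ξ => (Ψ ξ.cur ⬝ᵥ Δ) * ((Ψ ξ.cur - Ψ ξ.next) ⬝ᵥ v))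
        = Δ ⬝ᵥ 𝒜 v := by
      rw [← vmean_tdLin, dotProduct_vmean]
      simp only [dotProduct_tdLin]
    have e3 : expect (obsLaw M π π')
        (fun ξ => |(Ψ ξ.cur ⬝ᵥ Δ) * ((Ψ ξ.cur - Ψ ξ.next) ⬝ᵥ v)|)
        ≤ 1 / 2 * hq Δ + 3 * hq v := by
      have e4 : expect (obsLaw M π π')
          (fun ξ => |(Ψ ξ.cur ⬝ᵥ Δ) * ((Ψ ξ.cur - Ψ ξ.next) ⬝ᵥ v)|)
          ≤ expect (obsLaw M π π') (fun ξ => 1 / 2 * (Ψ ξ.cur ⬝ᵥ Δ) ^ 2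
            + 1 / 2 * ((Ψ ξ.cur - Ψ ξ.next) ⬝ᵥ v) ^ 2) := by
        refine expect_mono _ fun ξ => ?_
        rw [abs_mul]
        have := sq_nonneg (|Ψ ξ.cur ⬝ᵥ Δ| - |(Ψ ξ.cur - Ψ ξ.next) ⬝ᵥ v|)
        have a1 := sq_abs (Ψ ξ.cur ⬝ᵥ Δ)
        have a2 := sq_abs ((Ψ ξ.cur - Ψ ξ.next) ⬝ᵥ v)
        nlinarith
      rw [expect_add, expect_const_mul, expect_const_mul, h.expect_cur_sq] at e4
      have := h.expect_diff_sq_le v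
      linarith
    have e5 := mul_le_mul_of_nonneg_left e3 hδ
    rw [e2] at e1
    linarith
  have hsum : b * hq Δ ≤ Δ ⬝ᵥ 𝒜 v + Δ ⬝ᵥ 𝒜 Δ₁ := by
    rw [← dotProduct_add, ← map_add, hvΔ, sub_add_cancel]
    exact h.modulus_le Δ
  -- The mixing errors and the terms of order `η²` together are at most `0.018 η b` times each of
  -- the two forms. The contraction `2 η b` thus retains more than half of its size, and `1/40`
  -- suffices for the form at the anchor.
  have k1 : η * δ * (13 * hq Δ + 12 * hq Δ₁) ≤ η * (b / 1000) * (13 * hq Δ + 12 * hq Δ₁) :=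
    mul_le_mul_of_nonneg_right (mul_le_mul_of_nonneg_left h.delta_le hη.le) (by linarith)
  have k2 : η ^ 2 * (48 * hq Δ + 60 * hq Δ₁) ≤ η * (b / 10000) * (48 * hq Δ + 60 * hq Δ₁) := by
    rw [sq]
    exact mul_le_mul_of_nonneg_right (mul_le_mul_of_nonneg_left hηb hη.le) (by linarith)
  have k3 : 2 * η * (b * hq Δ) ≤ 2 * η * (Δ ⬝ᵥ 𝒜 v + Δ ⬝ᵥ 𝒜 Δ₁) :=
    mul_le_mul_of_nonneg_left hsum (by linarith)
  have k4 : 2 * η * (Δ ⬝ᵥ 𝒜 v - δ * (1 / 2 * hq Δ + 3 * hq v)) ≤ 2 * η * L :=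
    mul_le_mul_of_nonneg_left hLge (by linarith)
  have k5 : 2 * η ^ 2 * R ≤ 2 * η ^ 2 * (12 * (2 * hq Δ + 2 * hq Δ₁)) :=
    mul_le_mul_of_nonneg_left (by linarith) (by positivity)
  have k6 : η * δ * (6 * hq v) ≤ η * δ * (6 * (2 * hq Δ + 2 * hq Δ₁)) :=
    mul_le_mul_of_nonneg_left (by linarith) (by positivity)
  have k7 : 0 ≤ η * b * hq Δ := by positivity
  have k8 : 0 ≤ η * b * hq Δ₁ := by positivity
  refine hstep.trans ?_
  linarith

end CriticSetting

/-! ### Sums over batches of nearly stationary samples -/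

section Batch

variable {Ω Z : Type}

/-- The sum of `f` over `n` successive samples. -/
def batchSum (smp : Z → PMF (Ω × Z)) (f : Ω → ℝ) : ℕ → Z → PMF (ℝ × Z)
  | 0, z => PMF.pure (0, z)
  | n + 1, z => (smp z).bind fun r => (batchSum smp f n r.2).map fun q => (f r.1 + q.1, q.2)

instance finSupp_batchSum (smp : Z → PMF (Ω × Z)) [∀ z, FinSupp (smp z)] (f : Ω → ℝ) (n : ℕ)
    (z : Z) : FinSupp (batchSum smp f n z) := by
  induction n generalizing z with
  | zero => exact finSupp_pure _
  | succ n ih => exact finSupp_bind _ _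

variable (smp : Z → PMF (Ω × Z)) [∀ z, FinSupp (smp z)] (o : PMF Ω) [FinSupp o] {δ : ℝ}

/-- By the Markov property each further sample adds one conditional error. Since `f` is centered
before the mixing estimate is applied, the error is relative to the mean absolute deviation. -/
theorem batchSum_mean
    (hs : ∀ (z : Z) (f : Ω → ℝ),
      |expect (smp z) (fun r => f r.1) - expect o f| ≤ δ * expect o fun ξ => |f ξ|)
    (f : Ω → ℝ) (n : ℕ) (z : Z) :
    |expect (batchSum smp f n z) (fun r => r.1) - n * expect o f|
      ≤ n * (δ * expect o fun ξ => |f ξ - expect o f|) := by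
  induction n generalizing z with
  | zero => simp [batchSum]
  | succ n ih =>
    set m := expect o f
    have e : expect (batchSum smp f (n + 1) z) (fun r => r.1) - (n + 1 : ℕ) * m =
        expect (smp z) (fun r => f r.1 - m) +
        expect (smp z) (fun r => expect (batchSum smp f n r.2) (fun q => q.1) - n * m) := by
      rw [batchSum, expect_bind]
      simp only [expect_map, expect_add, expect_sub, expect_const]
      push_cast
      ring
    have h1 : |expect (smp z) (fun r => f r.1 - m)| ≤ δ * expect o fun ξ => |f ξ - m| := by
      have := hs z fun ξ => f ξ - m
      rwa [expect_sub o f, expect_const, sub_self, sub_zero] at this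
    have h2 : |expect (smp z) (fun r => expect (batchSum smp f n r.2) (fun q => q.1) - n * m)|
        ≤ n * (δ * expect o fun ξ => |f ξ - m|) :=
      (abs_expect_le _ _).trans (expect_le_const _ fun r => ih r.2)
    rw [e]
    refine (abs_add_le _ _).trans ?_
    push_cast
    linarith

/-- Expand the square of the first sample plus the rest. Given the first sample, the rest has mean
at most `n δ` times the mean absolute deviation, so the correlations add only a term of order `δ
n²`; the factor 2 is the price for nonstationary second moments. -/
theorem batchSum_variance (hδ : 0 ≤ δ) (hδ1 : δ ≤ 1)
    (hs : ∀ (z : Z) (f : Ω → ℝ),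
      |expect (smp z) (fun r => f r.1) - expect o f| ≤ δ * expect o fun ξ => |f ξ|)
    (f : Ω → ℝ) (n : ℕ) (z : Z) :
    expect (batchSum smp f n z) (fun r => (r.1 - n * expect o f) ^ 2)
      ≤ 2 * (expect o fun ξ => (f ξ - expect o f) ^ 2) * (n + 2 * δ * n ^ 2) := by
  have hmean := batchSum_mean smp o hs f
  induction n generalizing z with
  | zero => simp [batchSum]
  | succ n ih =>
    set m := expect o f with hm
    set v := expect o fun ξ => (f ξ - m) ^ 2 with hv
    set a := expect o fun ξ => |f ξ - m| with ha
    have ha0 : 0 ≤ a := expect_nonneg _ fun ξ => abs_nonneg _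
    have hv0 : 0 ≤ v := expect_nonneg _ fun ξ => sq_nonneg _
    have hav : a ^ 2 ≤ v := by
      refine (sq_expect_le o _).trans (le_of_eq ?_)
      simp only [sq_abs, hv]
    have h2 : ∀ g : Ω → ℝ, (∀ ξ, 0 ≤ g ξ) → expect (smp z) (fun r => g r.1) ≤ 2 * expect o g := by
      intro g hg
      have h1 := (le_abs_self _).trans (hs z g)
      simp only [fun ξ => abs_of_nonneg (hg ξ)] at h1
      have := mul_le_mul_of_nonneg_right hδ1 (expect_nonneg o hg)
      linarith
    have e : expect (batchSum smp f (n + 1) z) (fun r => (r.1 - (n + 1 : ℕ) * m) ^ 2) ≤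
        expect (smp z) (fun r => (f r.1 - m) ^ 2) +
        expect (smp z) (fun r => |f r.1 - m|) * (2 * (n * (δ * a))) +
        2 * v * (n + 2 * δ * n ^ 2) := by
      rw [batchSum, expect_bind, ← expect_mul_const, ← expect_add,
        ← expect_const (smp z) (2 * v * (n + 2 * δ * n ^ 2)), ← expect_add]
      refine expect_mono _ fun r => ?_
      rw [expect_map]
      have e1 : (fun q : ℝ × Z => (f r.1 + q.1 - (n + 1 : ℕ) * m) ^ 2) = fun q =>
          ((f r.1 - m) ^ 2 + 2 * (f r.1 - m) * (q.1 - n * m)) + (q.1 - n * m) ^ 2 := by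
        funext q; push_cast; ring
      simp only [e1, expect_add, expect_const_mul, expect_sub, expect_const]
      have e2 := ih r.2
      have e3 : 2 * (f r.1 - m) * (expect (batchSum smp f n r.2) (fun q => q.1) - n * m)
          ≤ |f r.1 - m| * (2 * (n * (δ * a))) := by
        calc _ ≤ |2 * (f r.1 - m) * (expect (batchSum smp f n r.2) (fun q => q.1) - n * m)| :=
              le_abs_self _
          _ = 2 * (|f r.1 - m| * |expect (batchSum smp f n r.2) (fun q => q.1) - n * m|) := by
              rw [abs_mul, abs_mul, abs_two, mul_assoc]
          _ ≤ 2 * (|f r.1 - m| * (n * (δ * a))) := by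
              have := mul_le_mul_of_nonneg_left (hmean n r.2) (abs_nonneg (f r.1 - m))
              linarith
          _ = _ := by ring
      have e4 : expect (batchSum smp f n r.2) (fun q => (q.1 - n * m) ^ 2)
          ≤ 2 * v * (n + 2 * δ * n ^ 2) := e2
      linarith
    have h3 := h2 (fun ξ => (f ξ - m) ^ 2) fun ξ => sq_nonneg _
    have h4 := h2 (fun ξ => |f ξ - m|) fun ξ => abs_nonneg _
    have hc : 0 ≤ 2 * ((n : ℝ) * (δ * a)) := by positivity
    have h5 := mul_le_mul_of_nonneg_right h4 hc
    have h6 : 2 * a * (2 * (n * (δ * a))) ≤ 4 * (n * δ) * v := by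
      have := mul_le_mul_of_nonneg_left hav (show 0 ≤ 4 * ((n : ℝ) * δ) by positivity)
      linarith
    have h7 : 0 ≤ v * δ := mul_nonneg hv0 hδ
    have h8 : 0 ≤ v * δ * n := by positivity
    push_cast
    push_cast at e
    nlinarith

theorem expect_sq_sub_le (f : Ω → ℝ) :
    (expect o fun ξ => (f ξ - expect o f) ^ 2) ≤ expect o fun ξ => f ξ ^ 2 := by
  have : (fun ξ => (f ξ - expect o f) ^ 2)
      = fun ξ => (f ξ ^ 2 - 2 * expect o f * f ξ) + expect o f ^ 2 := by
    funext b; ring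
  rw [this, expect_add, expect_sub, expect_const_mul, expect_const]
  nlinarith [sq_nonneg (expect o f)]

/-- The error of a batch average. -/
theorem batchAverage (hδ : 0 ≤ δ) (hδ1 : δ ≤ 1)
    (hs : ∀ (z : Z) (f : Ω → ℝ),
      |expect (smp z) (fun r => f r.1) - expect o f| ≤ δ * expect o fun ξ => |f ξ|)
    (f : Ω → ℝ) {n : ℕ} (hn : 0 < n) (hnδ : δ ≤ 1 / n) (z : Z) :
    expect (batchSum smp f n z) (fun r => (r.1 / n - expect o f) ^ 2)
      ≤ 6 * (expect o fun ξ => f ξ ^ 2) / n ∧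
    (expect (batchSum smp f n z) (fun r => r.1 / n - expect o f)) ^ 2
      ≤ δ ^ 2 * expect o fun ξ => f ξ ^ 2 := by
  have hn' : (0 : ℝ) < n := by exact_mod_cast hn
  have hvar := batchSum_variance smp o hδ hδ1 hs f n z
  have hmean := batchSum_mean smp o hs f n z
  set m := expect o f with hm
  set v := expect o fun ξ => (f ξ - m) ^ 2 with hv
  set a := expect o fun ξ => |f ξ - m| with ha
  have ha0 : 0 ≤ a := expect_nonneg _ fun ξ => abs_nonneg _
  have hv0 : 0 ≤ v := expect_nonneg _ fun ξ => sq_nonneg _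
  have hav : a ^ 2 ≤ v := by
    refine (sq_expect_le o _).trans (le_of_eq ?_)
    simp only [sq_abs, hv]
  have hvle : v ≤ expect o fun ξ => f ξ ^ 2 := expect_sq_sub_le o f
  constructor
  · have e : (fun r : ℝ × Z => (r.1 / n - m) ^ 2) = fun r => (1 / n ^ 2) * (r.1 - n * m) ^ 2 := by
      funext r; field_simp
    rw [e, expect_const_mul]
    have h1 : δ * n ≤ 1 := by rwa [le_div_iff₀ hn'] at hnδ
    -- Since `δ n ≤ 1`, the correlation term is of the order of the independent one.
    have h2 : 2 * v * (n + 2 * δ * n ^ 2) ≤ 6 * v * n := by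
      nlinarith [mul_nonneg hv0 hn'.le]
    calc _ ≤ 1 / (n : ℝ) ^ 2 * (6 * v * n) :=
          mul_le_mul_of_nonneg_left (hvar.trans h2) (by positivity)
      _ = 6 * v / n := by field_simp
      _ ≤ _ := by gcongr
  · have e : (fun r : ℝ × Z => r.1 / n - m) = fun r => (1 / n) * (r.1 - n * m) := by
      funext r; field_simp
    rw [e, expect_const_mul, expect_sub, expect_const, mul_pow, ← sq_abs (_ - _)]
    have h1 := pow_le_pow_left₀ (abs_nonneg _) hmean 2
    calc _ ≤ (1 / (n : ℝ)) ^ 2 * (n * (δ * a)) ^ 2 :=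
          mul_le_mul_of_nonneg_left h1 (by positivity)
      _ = δ ^ 2 * a ^ 2 := by field_simp
      _ ≤ _ := mul_le_mul_of_nonneg_left (hav.trans hvle) (sq_nonneg δ)

end Batch

/-- Reduces the vector batch to scalar ones: batch bounds hold in each coordinate and are then
summed into Euclidean norms. -/
theorem operatorSum_map (M : Model S A) (Ψ : Matrix (S × A) (Fin d) ℝ) (π π' : Policy S A)
    (τ' : ℕ) (θ : Fin d → ℝ) (ρ : ℝ) (i : Fin d) (n : ℕ) (z : Traj S A) :
    (operatorSum M Ψ π π' τ' θ ρ n z).map (fun q => (q.1 i, q.2)) =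
      batchSum (explore M π π' τ') (fun ξ => tdOperator M Ψ θ ρ ξ i) n z := by
  induction n generalizing z with
  | zero => simp [operatorSum, batchSum, PMF.pure_map]
  | succ n ih =>
    simp only [operatorSum, batchSum, ← ih, PMF.map_bind, PMF.map_comp, Function.comp_def]
    rfl

/-- The last state-action pair of `τ' + 1` samples. -/
def costSample (M : Model S A) (π : Policy S A) (τ' : ℕ) (z : Traj S A) :
    PMF ((S × A) × Traj S A) :=
  (advance M π (τ' + 1) z).map fun y => ((y.state, y.action), y)

instance finSupp_costSample (M : Model S A) (π : Policy S A) (τ' : ℕ) (z : Traj S A) :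
    FinSupp (costSample M π τ' z) := by
  unfold costSample; infer_instance

theorem costSum_eq (M : Model S A) (π : Policy S A) (τ' n : ℕ) (z : Traj S A) :
    costSum M π τ' n z = batchSum (costSample M π τ') (costVec M) n z := by
  induction n generalizing z with
  | zero => rfl
  | succ n ih =>
    simp only [costSum, batchSum, costSample, ih, PMF.bind_map, Function.comp_def]
    rfl

/-! ### Errors of the cost average and of the operator average -/

namespace CriticSetting

variable [Nonempty S] {M : Model S A} {Ψ : Matrix (S × A) (Fin d) ℝ}
  {π π' : Policy S A} {b μ cbar δ : ℝ} {n : ℕ} (h : CriticSetting M Ψ π π' b μ cbar δ n)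
include h

local notation "hq" => normSq M Ψ π π'
local notation "𝒜" => projOp M Ψ π π'

theorem expect_cost_sq_le : expect (pairLaw M π π) (fun x => costVec M x ^ 2) ≤ cbar ^ 2 :=
  have : FinSupp (pairLaw M π π) := finSupp_of_finite _
  expect_le_const _ fun x => sq_le_sq' (by linarith [neg_abs_le (costVec M x), h.cost_le x])
    ((le_abs_self _).trans (h.cost_le x))

/-- The error of the estimate of the average cost. -/
theorem costSum_error {N' : ℕ} (hN : 0 < N') (hδ : δ ≤ 1 / N') (z : Traj S A) :
    expect (costSum M π (n + 1) N' z) (fun r => (r.1 / N' - avgCost M π) ^ 2)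
      ≤ 6 * cbar ^ 2 / N' ∧
    (expect (costSum M π (n + 1) N' z) (fun r => r.1 / N' - avgCost M π)) ^ 2
      ≤ δ ^ 2 * cbar ^ 2 := by
  have hs : ∀ (z : Traj S A) (f : S × A → ℝ),
      |expect (costSample M π (n + 1) z) (fun r => f r.1) - expect (pairLaw M π π) f|
      ≤ δ * expect (pairLaw M π π) fun ξ => |f ξ| := by
    intro z f
    rw [costSample, expect_map]
    exact (h.mixes (n + 1) (Nat.le_succ n)).abs_advance_sub_le h.delta_nonneg f z
  have key := batchAverage (costSample M π (n + 1)) (pairLaw M π π) h.delta_nonneg h.delta_le_one hs (costVec M) hN hδ z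
  rw [← costSum_eq, expect_pairLaw_cost] at key
  refine ⟨key.1.trans ?_, key.2.trans ?_⟩
  · gcongr
    exact h.expect_cost_sq_le
  · exact mul_le_mul_of_nonneg_left h.expect_cost_sq_le (sq_nonneg δ)

/-- The mean of the stochastic operator. -/
theorem vmean_tdOperator (θ : Fin d → ℝ) (ρ : ℝ) {θs : Fin d → ℝ}
    (hθs : ProjectedBellman M Ψ π π' θs) :
    vmean (obsLaw M π π') (fun ξ => tdOperator M Ψ θ ρ ξ) =
      𝒜 (θ - θs) + (ρ - avgCost M π) • vmean (obsLaw M π π') fun ξ => Ψ ξ.cur := by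
  rw [map_sub, (projectedBellman_iff M Ψ π π' θs).1 hθs, ← vmean_cost, ← vmean_tdLin,
    ← vmean_smul, ← vmean_sub, ← vmean_add]
  congr 1
  funext ξ
  rw [tdOperator_eq, sub_smul, sub_smul, sub_smul]
  abel

/-- A bound of the second moment of the stochastic operator. -/
def noise (M : Model S A) (Ψ : Matrix (S × A) (Fin d) ℝ) (π π' : Policy S A) (cbar : ℝ)
    (θ θs : Fin d → ℝ) (r : ℝ) : ℝ :=
  24 * normSq M Ψ π π' (θ - θs) + 24 * nrm θs ^ 2 + 16 * cbar ^ 2 + 4 * r ^ 2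

/-- The linear part contributes `2 · 6 ‖Ψθ‖²`, and splitting `θ` around `θs` doubles it to 24. The
cost part splits as `c - ρ = (c - avgCost) - (ρ - avgCost)`, with `|c - avgCost| ≤ 2 c̄`. -/
theorem expect_nrm_tdOperator_sq_le (θ θs : Fin d → ℝ) (ρ : ℝ) :
    expect (obsLaw M π π') (fun ξ => nrm (tdOperator M Ψ θ ρ ξ) ^ 2)
      ≤ noise M Ψ π π' cbar θ θs (ρ - avgCost M π) := by
  have hρ : |avgCost M π| ≤ cbar := by
    rw [← expect_pairLaw_cost]
    have : FinSupp (pairLaw M π π) := finSupp_of_finite _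
    exact (abs_expect_le _ _).trans (expect_le_const _ fun x => h.cost_le x)
  have h1 : expect (obsLaw M π π') (fun ξ => nrm (tdOperator M Ψ θ ρ ξ) ^ 2)
      ≤ expect (obsLaw M π π') (fun ξ => 2 * ((Ψ ξ.cur - Ψ ξ.next) ⬝ᵥ θ) ^ 2
        + (16 * cbar ^ 2 + 4 * (ρ - avgCost M π) ^ 2)) := by
    refine expect_mono _ fun ξ => ?_
    rw [tdOperator_eq]
    refine (nrm_sub_sq_le _ _).trans ?_
    have e1 := h.nrm_tdLin_sq_le ξ θ
    have e2 : nrm ((costVec M ξ.cur - ρ) • Ψ ξ.cur) ^ 2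
        ≤ 8 * cbar ^ 2 + 2 * (ρ - avgCost M π) ^ 2 := by
      rw [nrm_smul, mul_pow, sq_abs]
      have f1 : nrm (Ψ ξ.cur) ^ 2 ≤ 1 := by rw [nrm_sq]; exact h.feature_le _
      refine (mul_le_of_le_one_right (sq_nonneg _) f1).trans ?_
      have f2 := abs_le.1 (h.cost_le ξ.cur)
      have f3 := abs_le.1 hρ
      have f4 : (costVec M ξ.cur - avgCost M π) ^ 2 ≤ (2 * cbar) ^ 2 :=
        sq_le_sq' (by linarith) (by linarith)
      nlinarith [sq_nonneg ((costVec M ξ.cur - avgCost M π) + (ρ - avgCost M π))]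
    linarith
  rw [expect_add, expect_const_mul, expect_const] at h1
  have h2 := h.expect_diff_sq_le θ
  have h3 : hq θ ≤ 2 * hq (θ - θs) + 2 * hq θs := by
    have := h.normSq_add_le (θ - θs) θs
    rwa [sub_add_cancel] at this
  have h4 := h.normSq_le θs
  rw [noise]
  linarith

/-- The error of the batch average of the stochastic operator. -/
theorem operatorSum_error {N : ℕ} (hN : 0 < N) (hδ : δ ≤ 1 / N) (θ θs : Fin d → ℝ) (ρ : ℝ)
    (z : Traj S A) :
    expect (operatorSum M Ψ π π' (n + 1) θ ρ N z) (fun q => nrm ((N : ℝ)⁻¹ • q.1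
        - vmean (obsLaw M π π') (fun ξ => tdOperator M Ψ θ ρ ξ)) ^ 2)
      ≤ 6 * noise M Ψ π π' cbar θ θs (ρ - avgCost M π) / N ∧
    nrm (vmean (operatorSum M Ψ π π' (n + 1) θ ρ N z) (fun q => (N : ℝ)⁻¹ • q.1
        - vmean (obsLaw M π π') (fun ξ => tdOperator M Ψ θ ρ ξ))) ^ 2
      ≤ δ ^ 2 * noise M Ψ π π' cbar θ θs (ρ - avgCost M π) := by
  have key : ∀ i : Fin d, _ := fun i => batchAverage (explore M π π' (n + 1)) (obsLaw M π π')
    h.delta_nonneg h.delta_le_one (fun z f => h.abs_explore_sub_le f z)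
    (fun ξ => tdOperator M Ψ θ ρ ξ i) hN hδ z
  simp only [← operatorSum_map, expect_map] at key
  have hv : ∑ i, expect (obsLaw M π π') (fun ξ => tdOperator M Ψ θ ρ ξ i ^ 2)
      ≤ noise M Ψ π π' cbar θ θs (ρ - avgCost M π) := by
    rw [← expect_sum]
    refine le_trans (le_of_eq ?_) (h.expect_nrm_tdOperator_sq_le θ θs ρ)
    congr 1
    funext ξ
    rw [nrm_sq, dotProduct]
    exact sum_congr rfl fun i _ => sq _
  have e : ∀ (q : (Fin d → ℝ) × Traj S A) (i : Fin d), ((N : ℝ)⁻¹ • q.1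
        - vmean (obsLaw M π π') (fun ξ => tdOperator M Ψ θ ρ ξ)) i
      = q.1 i / N - expect (obsLaw M π π') (fun ξ => tdOperator M Ψ θ ρ ξ i) := by
    intro q i
    rw [Pi.sub_apply, Pi.smul_apply, smul_eq_mul, inv_mul_eq_div]
    rfl
  constructor
  · simp only [nrm_sq, dotProduct, e, ← sq, expect_sum]
    refine (sum_le_sum fun i _ => (key i).1).trans ?_
    rw [← sum_div, ← mul_sum]
    gcongr
  · rw [nrm_sq]
    have e' : ∀ i, vmean (operatorSum M Ψ π π' (n + 1) θ ρ N z) (fun q => (N : ℝ)⁻¹ • q.1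
        - vmean (obsLaw M π π') (fun ξ => tdOperator M Ψ θ ρ ξ)) i
        = expect (operatorSum M Ψ π π' (n + 1) θ ρ N z) fun q =>
          q.1 i / N - expect (obsLaw M π π') (fun ξ => tdOperator M Ψ θ ρ ξ i) := by
      intro i
      simp only [← e]
      rfl
    simp only [dotProduct, e', ← sq]
    refine (sum_le_sum fun i _ => (key i).2).trans ?_
    rw [← mul_sum]
    exact mul_le_mul_of_nonneg_left hv (sq_nonneg δ)

end CriticSetting

/-- The requirements on the parameters of the critic that the analysis uses. -/
structure GoodParams (b μ δ : ℝ) (n : ℕ) (prm : Params) : Prop where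
  eta_pos : 0 < prm.η
  eta_le : prm.η ≤ b / 10000
  T_ge : 64 / (μ * b * prm.η) ≤ prm.T
  N_ge : 20000 / (μ * b ^ 2) ≤ prm.N
  N'_ge : 20000 / (μ * b ^ 2) ≤ prm.N'
  tau : prm.τ = n + 1
  tau' : prm.τ' = n + 1
  delta_N : δ ≤ 1 / prm.N
  delta_N' : δ ≤ 1 / prm.N'

/-! ### The linear maps that govern the means of the inner loop -/

section Maps

variable (M : Model S A) (Ψ : Matrix (S × A) (Fin d) ℝ) (π π' : Policy S A)

/-- The mean of one step of the inner loop. -/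
def stepMap (η : ℝ) : Module.End ℝ (Fin d → ℝ) := 1 - η • projOp M Ψ π π'

/-- The mean of the sum of the iterates of the inner loop. -/
def sumMap (η : ℝ) (k : ℕ) : Module.End ℝ (Fin d → ℝ) := ∑ i ∈ range k, stepMap M Ψ π π' η ^ i

/-- The mean of the output of the inner loop. -/
def averageMap (η : ℝ) (T : ℕ) : Module.End ℝ (Fin d → ℝ) := (T : ℝ)⁻¹ • sumMap M Ψ π π' η T

theorem stepMap_apply (η : ℝ) (v : Fin d → ℝ) :
    stepMap M Ψ π π' η v = v - η • projOp M Ψ π π' v := rfl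

theorem sumMap_succ (η : ℝ) (k : ℕ) (v : Fin d → ℝ) :
    sumMap M Ψ π π' η (k + 1) v = v + sumMap M Ψ π π' η k (stepMap M Ψ π π' η v) := by
  simp only [sumMap, sum_range_succ', LinearMap.add_apply, LinearMap.sum_apply, pow_zero,
    Module.End.one_apply, pow_succ, Module.End.mul_apply]
  rw [add_comm]

theorem smul_projOp_sumMap (η : ℝ) (k : ℕ) (v : Fin d → ℝ) :
    η • projOp M Ψ π π' (sumMap M Ψ π π' η k v) = v - (stepMap M Ψ π π' η ^ k) v := by
  have h := LinearMap.congr_fun (mul_neg_geom_sum (stepMap M Ψ π π' η) k) v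
  rw [stepMap, sub_sub_cancel] at h
  exact h

end Maps

/-! ### Second moment and mean of the inner loop -/

namespace CriticSetting

variable [Nonempty S] {M : Model S A} {Ψ : Matrix (S × A) (Fin d) ℝ}
  {π π' : Policy S A} {b μ cbar δ : ℝ} {n : ℕ} (h : CriticSetting M Ψ π π' b μ cbar δ n)
include h

local notation "hq" => normSq M Ψ π π'
local notation "𝒜" => projOp M Ψ π π'

theorem eq_zero_of_normSq {v : Fin d → ℝ} (hv : hq v ≤ 0) : v = 0 := by
  have h1 := h.mu_mul_le v
  have h3 : nrm v = 0 := by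
    have := h.mu_pos
    by_contra hne
    have : 0 < nrm v ^ 2 := by positivity
    nlinarith
  simpa [nrm] using h3

/-- An incremental Cauchy-Schwarz inequality: the square of a sum of `m` vectors is at most `m`
times the sum `Y` of their squares. For `m = 0` the hypothesis forces `x = 0`, as the form is
definite. -/
theorem normSq_add_le_of_le {x y : Fin d → ℝ} {m : ℕ} {Y : ℝ} (hY : 0 ≤ Y)
    (hx : hq x ≤ m * Y) : hq (x + y) ≤ (m + 1) * (Y + hq y) := by
  rcases Nat.eq_zero_or_pos m with rfl | hm
  · rw [h.eq_zero_of_normSq (v := x) (by simpa using hx)]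
    simpa using hY
  · have hm' : (0 : ℝ) < m := by exact_mod_cast hm
    have key : m * hq (x + y) ≤ (m + 1) * (hq x + m * hq y) := by
      simp only [normSq_eq, mul_sum, ← sum_add_distrib]
      refine sum_le_sum fun a _ => ?_
      rw [mulVec_add, Pi.add_apply]
      have := mul_nonneg (weight_nonneg M π π' a) (sq_nonneg ((Ψ *ᵥ x) a - m * (Ψ *ᵥ y) a))
      nlinarith
    have h2 : (m + 1) * (hq x + m * hq y) ≤ (m + 1) * (m * Y + m * hq y) :=
      mul_le_mul_of_nonneg_left (by linarith) (by positivity)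
    refine le_of_mul_le_mul_left ?_ hm'
    linarith

/-- The second moment of the sum of the iterates of the inner loop. -/
theorem innerLoop_sq_le {η : ℝ} (hη : 0 < η) (hηb : η ≤ b / 10000) (θ₀ θc : Fin d → ℝ) (ρ : ℝ)
    (k m : ℕ) {Y : ℝ} (hY : 0 ≤ Y) (θ acc : Fin d → ℝ)
    (hacc : hq (acc - (m : ℝ) • θc) ≤ m * Y) (z : Traj S A) :
    expect (innerLoop M Ψ π π' η (n + 1) θ₀ ρ (𝒜 (θ₀ - θc)) k θ acc z)
        (fun r => hq (r.1 - ((m : ℝ) + k) • θc))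
      ≤ (m + k) * (Y + nrm (θ - θc) ^ 2 / (η * b) + k * (hq (θ₀ - θc) / 40)) := by
  have hηb' : 0 < η * b := mul_pos hη h.b_pos
  induction k generalizing m Y θ acc z with
  | zero =>
    have : 0 ≤ nrm (θ - θc) ^ 2 / (η * b) := by positivity
    simp only [innerLoop, expect_pure, Nat.cast_zero, add_zero, zero_mul]
    exact hacc.trans (mul_le_mul_of_nonneg_left (by linarith) (by positivity))
  | succ k ih =>
    rw [innerLoop, expect_bind]
    have hΔ := h.normSq_nonneg (θ - θc)
    have hacc' : hq (acc + θ - ((m + 1 : ℕ) : ℝ) • θc) ≤ (m + 1 : ℕ) * (Y + hq (θ - θc)) := by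
      have e : acc + θ - ((m + 1 : ℕ) : ℝ) • θc = (acc - (m : ℝ) • θc) + (θ - θc) := by
        push_cast; rw [add_smul, one_smul]; abel
      rw [e]
      push_cast
      exact h.normSq_add_le_of_le hY hacc
    have hstep := fun r : Obs S A × Traj S A => ih (m + 1) (Y := Y + hq (θ - θc)) (by linarith)
      (θ - η • (tdOperator M Ψ θ ρ r.1 - tdOperator M Ψ θ₀ ρ r.1 + 𝒜 (θ₀ - θc))) (acc + θ)
      hacc' r.2
    have e2 : ((m + 1 : ℕ) : ℝ) + k = (m : ℝ) + (k + 1 : ℕ) := by push_cast; ring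
    simp only [e2] at hstep
    refine (expect_mono _ hstep).trans ?_
    have hd := h.descent hη hηb θ θ₀ θc ρ z
    rw [expect_const_mul]
    refine mul_le_mul_of_nonneg_left ?_ (by positivity)
    rw [expect_add, expect_add, expect_const, expect_const]
    -- The potential `‖θ - θc‖² / (η b)` drops on average by the form at `θ - θc` that has just been
    -- added to `Y`, up to `1/40` of the form at the anchor.
    have e3 : expect (explore M π π' (n + 1) z) (fun r => nrm (θ - η • (tdOperator M Ψ θ ρ r.1
        - tdOperator M Ψ θ₀ ρ r.1 + 𝒜 (θ₀ - θc)) - θc) ^ 2 / (η * b))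
        ≤ (nrm (θ - θc) ^ 2 - η * b * hq (θ - θc) + η * b / 40 * hq (θ₀ - θc)) / (η * b) := by
      simp only [div_eq_mul_inv _ (η * b), expect_mul_const]
      exact mul_le_mul_of_nonneg_right hd (by positivity)
    have e4 : (nrm (θ - θc) ^ 2 - η * b * hq (θ - θc) + η * b / 40 * hq (θ₀ - θc)) / (η * b)
        = nrm (θ - θc) ^ 2 / (η * b) - hq (θ - θc) + hq (θ₀ - θc) / 40 := by
      have := hη.ne'
      have := h.b_pos.ne'
      field_simp
    push_cast
    linarith

/-- The increment of the squared norm is at most `(-2 η b + 6 η²) ‖Ψv‖²`, which is not positive for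
small `η`. -/
theorem nrm_stepMap_le {η : ℝ} (hη : 0 < η) (hηb : η ≤ b / 10000) (v : Fin d → ℝ) :
    nrm (stepMap M Ψ π π' η v) ≤ nrm v := by
  refine le_of_sq_le_sq ?_ (nrm_nonneg v)
  rw [stepMap_apply]
  have e : nrm (v - η • 𝒜 v) ^ 2 = nrm v ^ 2 - 2 * η * (v ⬝ᵥ 𝒜 v) + η ^ 2 * nrm (𝒜 v) ^ 2 := by
    simp only [nrm_sq, sub_dotProduct, dotProduct_sub, smul_dotProduct, dotProduct_smul,
      smul_eq_mul]
    rw [dotProduct_comm (𝒜 v) v]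
    ring
  rw [e]
  have h1 := mul_le_mul_of_nonneg_left (h.nrm_projOp_sq_le v) (sq_nonneg η)
  have h2 := mul_le_mul_of_nonneg_left (h.modulus_le v) hη.le
  have h3 := mul_le_mul_of_nonneg_right hηb (mul_nonneg hη.le (h.normSq_nonneg v))
  have h4 : 0 ≤ b * (η * hq v) := mul_nonneg h.b_pos.le (mul_nonneg hη.le (h.normSq_nonneg v))
  nlinarith

theorem nrm_stepMap_pow_le {η : ℝ} (hη : 0 < η) (hηb : η ≤ b / 10000) (k : ℕ) (v : Fin d → ℝ) :
    nrm ((stepMap M Ψ π π' η ^ k) v) ≤ nrm v := by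
  induction k generalizing v with
  | zero => simp
  | succ k ih =>
    rw [pow_succ, Module.End.mul_apply]
    exact (ih _).trans (h.nrm_stepMap_le hη hηb v)

theorem nrm_sumMap_le {η : ℝ} (hη : 0 < η) (hηb : η ≤ b / 10000) (k : ℕ) (v : Fin d → ℝ) :
    nrm (sumMap M Ψ π π' η k v) ≤ k * nrm v := by
  rw [sumMap, LinearMap.sum_apply]
  refine (nrm_sum_le _ _).trans ?_
  refine (sum_le_card_nsmul _ _ _ fun i _ => h.nrm_stepMap_pow_le hη hηb i v).trans ?_
  simp

/-- The geometric sum `y` of the powers of `I - ηA`, applied to `v`, satisfies `ηA y = v - (I -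
ηA)^T v`, of norm at most `2 ‖v‖`. So `μ b η ‖y‖ ≤ 2 ‖v‖`, and division by `T ≥ 64 / (μ b η)` gives
the contraction, with room to spare. -/
theorem nrm_averageMap_le {η : ℝ} (hη : 0 < η) (hηb : η ≤ b / 10000) {T : ℕ}
    (hT : 64 / (μ * b * η) ≤ T) (v : Fin d → ℝ) :
    nrm (averageMap M Ψ π π' η T v) ≤ nrm v / 2 := by
  have hc : 0 < μ * b * η := mul_pos (mul_pos h.mu_pos h.b_pos) hη
  have hT0 : (0 : ℝ) < T := (div_pos (by norm_num) hc).trans_le hT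
  rw [div_le_iff₀ hc] at hT
  rw [averageMap, LinearMap.smul_apply, nrm_smul, abs_of_nonneg (by positivity),
    inv_mul_le_iff₀ hT0]
  set y := sumMap M Ψ π π' η T v
  have h1 := h.mu_b_mul_nrm_le y
  have h2 : η * nrm (𝒜 y) ≤ 2 * nrm v := by
    have e : η * nrm (𝒜 y) = nrm (η • 𝒜 y) := by rw [nrm_smul, abs_of_pos hη]
    rw [e, smul_projOp_sumMap]
    have := nrm_sub_le v ((stepMap M Ψ π π' η ^ T) v)
    have := h.nrm_stepMap_pow_le hη hηb T v
    linarith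
  have h3 : μ * b * η * nrm y ≤ 2 * nrm v := by
    have := mul_le_mul_of_nonneg_left h1 hη.le
    linarith
  have h4 : μ * b * η * nrm y ≤ μ * b * η * (T * (nrm v / 2)) := by
    have := mul_le_mul_of_nonneg_right hT (nrm_nonneg v)
    have := nrm_nonneg v
    linarith
  exact le_of_mul_le_mul_left h4 hc

/-- The mean of the sum of the iterates of the inner loop. -/
theorem innerLoop_mean {η : ℝ} (hη : 0 < η) (hηb : η ≤ b / 10000) (θ₀ θc : Fin d → ℝ) (ρ : ℝ)
    {s : ℝ} (hs : 0 < s) (k : ℕ) (θ acc : Fin d → ℝ) (z : Traj S A) :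
    nrm (vmean (innerLoop M Ψ π π' η (n + 1) θ₀ ρ (𝒜 (θ₀ - θc)) k θ acc z) (fun r => r.1)
        - (acc + (k : ℝ) • θc + sumMap M Ψ π π' η k (θ - θc)))
      ≤ k ^ 2 * (η * δ) * ((nrm (θ - θc) ^ 2 + (k + 1) * nrm (θ₀ - θc) ^ 2 + s ^ 2) / s) := by
  have hδ := h.delta_nonneg
  induction k generalizing θ acc z with
  | zero =>
    have e : vmean (innerLoop M Ψ π π' η (n + 1) θ₀ ρ (𝒜 (θ₀ - θc)) 0 θ acc z) (fun r => r.1)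
        = acc := by
      funext i; simp [innerLoop, vmean]
    rw [e]
    simp [sumMap]
  | succ k ih =>
    set θ' : Obs S A × Traj S A → Fin d → ℝ := fun r =>
      θ - η • (tdOperator M Ψ θ ρ r.1 - tdOperator M Ψ θ₀ ρ r.1 + 𝒜 (θ₀ - θc)) with hθ'
    set D := nrm (θ₀ - θc) ^ 2 with hD
    set X := nrm (θ - θc) ^ 2 with hX
    have hD0 : 0 ≤ D := sq_nonneg _
    have hX0 : 0 ≤ X := sq_nonneg _
    set B := sumMap M Ψ π π' η k with hB
    set p := explore M π π' (n + 1) z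
    -- The conditional bias of one step that is caused by incomplete mixing; without it the mean
    -- iteration would be exactly `stepMap`.
    set e := vmean p (fun r => tdLin Ψ r.1 (θ - θ₀)) - 𝒜 (θ - θ₀) with he
    have hee : nrm e ≤ δ * (2 * nrm (θ - θ₀)) := by
      have h1 := h.nrm_vmean_explore_sub_le (fun ξ => tdLin Ψ ξ (θ - θ₀)) z
      rw [vmean_tdLin] at h1
      refine h1.trans (mul_le_mul_of_nonneg_left ?_ hδ)
      exact expect_le_const _ fun ξ => h.nrm_tdLin_le ξ _
    have hmean : vmean p θ' - θc = stepMap M Ψ π π' η (θ - θc) - η • e := by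
      have e1 : ∀ r, θ' r = (θ - η • 𝒜 (θ₀ - θc)) - η • tdLin Ψ r.1 (θ - θ₀) := by
        intro r
        simp only [hθ', tdOperator_sub, smul_add]
        abel
      have e2 : vmean p θ' = (θ - η • 𝒜 (θ₀ - θc)) - η • (e + 𝒜 (θ - θ₀)) := by
        rw [show θ' = _ from funext e1, vmean_sub, vmean_const, vmean_smul, he, sub_add_cancel]
      have e3 : 𝒜 (θ - θc) = 𝒜 (θ₀ - θc) + 𝒜 (θ - θ₀) := by rw [← map_add]; congr 1; abel
      rw [e2, stepMap_apply, e3, smul_add, smul_add]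
      abel
    set F : Obs S A × Traj S A → Fin d → ℝ := fun r =>
      vmean (innerLoop M Ψ π π' η (n + 1) θ₀ ρ (𝒜 (θ₀ - θc)) k (θ' r) (acc + θ) r.2)
        (fun r => r.1) with hF
    set G : Obs S A × Traj S A → Fin d → ℝ := fun r =>
      (acc + θ) + (k : ℝ) • θc + B (θ' r - θc) with hG
    have hG' : vmean p G = (acc + θ) + (k : ℝ) • θc
        + (B (stepMap M Ψ π π' η (θ - θc)) - B (η • e)) := by
      rw [hG, vmean_add, vmean_const, ← map_vmean, vmean_sub, vmean_const, hmean, map_sub]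
    have hdec : vmean (innerLoop M Ψ π π' η (n + 1) θ₀ ρ (𝒜 (θ₀ - θc)) (k + 1) θ acc z)
          (fun r => r.1)
        - (acc + ((k + 1 : ℕ) : ℝ) • θc + sumMap M Ψ π π' η (k + 1) (θ - θc))
        = vmean p (fun r => F r - G r) - B (η • e) := by
      rw [innerLoop, vmean_bind, vmean_sub, hG', sumMap_succ]
      push_cast
      rw [add_smul, one_smul]
      abel
    have hsec : nrm (B (η • e)) ≤ k * (η * (δ * (2 * nrm (θ - θ₀)))) := by
      refine (h.nrm_sumMap_le hη hηb k _).trans ?_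
      rw [nrm_smul, abs_of_pos hη]
      gcongr
    -- The distance enters linearly, whereas only second moments are controlled. The free scale `s`
    -- links the two through the inequality of arithmetic and geometric means.
    have hdist : 2 * nrm (θ - θ₀) ≤ 2 * ((X + (k + 1 + 1) * D + s ^ 2) / s) := by
      have e1 : θ - θ₀ = (θ - θc) - (θ₀ - θc) := by abel
      have e2 := nrm_sub_le (θ - θc) (θ₀ - θc)
      rw [← e1] at e2
      have e3 : nrm (θ - θ₀) ≤ (X + (k + 1 + 1) * D + s ^ 2) / s := by
        rw [le_div_iff₀ hs]
        have := nrm_nonneg (θ - θc)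
        have := nrm_nonneg (θ₀ - θc)
        have f1 := sq_nonneg (nrm (θ - θc) - s / 2)
        have f2 := sq_nonneg (nrm (θ₀ - θc) - s / 2)
        have f3 : 0 ≤ (k : ℝ) * D := by positivity
        have f4 := mul_le_mul_of_nonneg_right e2 hs.le
        nlinarith
      linarith
    have hfirst : nrm (vmean p (fun r => F r - G r)) ≤
        k ^ 2 * (η * δ) * ((X + (k + 1 + 1) * D + s ^ 2) / s) := by
      refine (nrm_vmean_le _ _).trans ?_
      refine (expect_mono _ fun r => ih (θ' r) (acc + θ) r.2).trans ?_
      rw [expect_const_mul]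
      refine mul_le_mul_of_nonneg_left ?_ (by positivity)
      simp only [div_eq_mul_inv _ s, expect_mul_const]
      refine mul_le_mul_of_nonneg_right ?_ (by positivity)
      rw [expect_add, expect_add, expect_const, expect_const]
      -- In one step the mean of `‖θ - θc‖²` grows by at most `D`, which turns `(k + 1) D` into `(k
      -- + 2) D`.
      have hd := h.descent hη hηb θ θ₀ θc ρ z
      have g1 : η * b * hq (θ₀ - θc) ≤ 1 * D := by
        refine mul_le_mul ?_ (h.normSq_le _) (h.normSq_nonneg _) (by norm_num)
        have := h.b_le
        have := h.b_pos
        nlinarith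
      have g2 := mul_nonneg (mul_pos hη h.b_pos).le (h.normSq_nonneg (θ - θc))
      linarith
    rw [hdec]
    refine (nrm_sub_le _ _).trans ((add_le_add hfirst hsec).trans ?_)
    have hkey : (k : ℝ) * (η * (δ * (2 * nrm (θ - θ₀))))
        ≤ k * (η * (δ * (2 * ((X + (k + 1 + 1) * D + s ^ 2) / s)))) := by gcongr
    refine (add_le_add le_rfl hkey).trans ?_
    push_cast
    set Q := (X + (k + 1 + 1) * D + s ^ 2) / s
    have hQ : 0 ≤ Q := by positivity
    have : 0 ≤ η * δ * Q := by positivity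
    -- The errors of one step and of the remaining steps add up because `k² + 2k ≤ (k + 1)²`.
    nlinarith

end CriticSetting

namespace GoodParams

variable {b μ δ : ℝ} {n : ℕ} {prm : Params} (hp : GoodParams b μ δ n prm) (hb : 0 < b) (hμ : 0 < μ)
include hp hb hμ

theorem N_pos : 0 < prm.N := by
  have h1 : (0 : ℝ) < prm.N := lt_of_lt_of_le (by positivity) hp.N_ge
  exact_mod_cast h1

theorem N'_pos : 0 < prm.N' := by
  have h1 : (0 : ℝ) < prm.N' := lt_of_lt_of_le (by positivity) hp.N'_ge
  exact_mod_cast h1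

theorem T_pos : 0 < prm.T := by
  have := hp.eta_pos
  have h1 : (0 : ℝ) < prm.T := lt_of_lt_of_le (by positivity) hp.T_ge
  exact_mod_cast h1

end GoodParams

/-- The factor in the bound of the bias of one epoch. -/
def biasFactor (b μ : ℝ) (prm : Params) : ℝ :=
  100 / (b * μ) + 4 * prm.η * prm.T * (prm.T + 2) / μ

theorem biasFactor_nonneg {b μ : ℝ} {prm : Params} (hb : 0 < b) (hμ : 0 < μ) (hη : 0 < prm.η) :
    0 ≤ biasFactor b μ prm := by
  rw [biasFactor]; positivity

/-! ### One epoch and the whole run of the critic -/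

namespace CriticSetting

variable [Nonempty S] {M : Model S A} {Ψ : Matrix (S × A) (Fin d) ℝ}
  {π π' : Policy S A} {b μ cbar δ : ℝ} {n : ℕ} (h : CriticSetting M Ψ π π' b μ cbar δ n)
  {prm : Params} (hp : GoodParams b μ δ n prm) {θs : Fin d → ℝ}
  (hθs : ProjectedBellman M Ψ π π' θs)

local notation "hq" => normSq M Ψ π π'
local notation "𝒜" => projOp M Ψ π π'

include h in
theorem nrm_vmean_cur_le : nrm (vmean (obsLaw M π π') fun ξ => Ψ ξ.cur) ≤ 1 :=
  (nrm_vmean_le _ _).trans (expect_le_const _ fun _ => h.nrm_feature_le _)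

include h in
/-- The error of the fixed point of the inner loop. -/
theorem normSq_fixedPoint_le {w ζ : Fin d → ℝ} {r : ℝ}
    (hw : 𝒜 w = -(ζ + r • vmean (obsLaw M π π') fun ξ => Ψ ξ.cur)) :
    hq w ≤ 2 * (nrm ζ ^ 2 / μ + r ^ 2) / b ^ 2 := by
  have hb := h.b_pos
  have hμ := h.mu_pos
  have h1 := h.modulus_le w
  rw [hw, dotProduct_neg, dotProduct_add, dotProduct_smul, smul_eq_mul, dotProduct_vmean] at h1
  set t := expect (obsLaw M π π') fun ξ => w ⬝ᵥ Ψ ξ.cur with ht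
  have h2 : t ^ 2 ≤ hq w := by
    refine (sq_expect_le _ _).trans (le_of_eq ?_)
    rw [← h.expect_cur_sq w]
    simp only [dotProduct_comm w]
  have h3 := neg_le_of_abs_le (abs_dotProduct_le w ζ)
  have h4 := h.mu_mul_le w
  rw [le_div_iff₀ (by positivity)]
  have e1 : nrm ζ ^ 2 / μ * μ = nrm ζ ^ 2 := div_mul_cancel₀ _ hμ.ne'
  set q := nrm ζ ^ 2 / μ with hqd
  -- AM-GM in the forms `b |w| |ζ| ≤ b² μ |w|² / 4 + q` and `b |r| |t| ≤ b² t² / 4 + r²`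
  have g1 : b * (nrm w * nrm ζ) ≤ b ^ 2 * hq w / 4 + q := by
    have f1 : μ * (b * (nrm w * nrm ζ)) ≤ μ * (b ^ 2 * (μ * nrm w ^ 2) / 4 + q) := by
      have := sq_nonneg (b * μ * nrm w / 2 - nrm ζ)
      nlinarith
    have f2 := le_of_mul_le_mul_left f1 hμ
    have f3 := mul_le_mul_of_nonneg_left h4 (sq_nonneg b)
    linarith
  have g2 : b * (-(r * t)) ≤ b ^ 2 * hq w / 4 + r ^ 2 := by
    have f1 := sq_nonneg (b * t / 2 + r)
    have f2 := mul_le_mul_of_nonneg_left h2 (sq_nonneg b)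
    nlinarith
  have g3 := mul_le_mul_of_nonneg_left h1 hb.le
  have g4 : b * -(w ⬝ᵥ ζ) ≤ b * (nrm w * nrm ζ) := mul_le_mul_of_nonneg_left (by linarith) hb.le
  nlinarith

include h hp in
/-- The second moment of the output of the inner loop. -/
theorem innerLoop_output_sq_le (θ₀ θc : Fin d → ℝ) (ρ : ℝ) (z : Traj S A) :
    expect (innerLoop M Ψ π π' prm.η prm.τ θ₀ ρ (𝒜 (θ₀ - θc)) prm.T θ₀ 0 z)
        (fun r => hq ((prm.T : ℝ)⁻¹ • r.1 - θc)) ≤ hq (θ₀ - θc) / 16 := by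
  have hη := hp.eta_pos
  have hT : (0 : ℝ) < prm.T := by exact_mod_cast hp.T_pos h.b_pos h.mu_pos
  have hb := h.b_pos
  have hμ := h.mu_pos
  have key := h.innerLoop_sq_le hη hp.eta_le θ₀ θc ρ prm.T 0 (Y := 0) le_rfl θ₀ 0
    (by rw [Nat.cast_zero, zero_smul, sub_zero, zero_mul, h.normSq_zero]) z
  have e : ∀ r : (Fin d → ℝ) × Traj S A, hq ((prm.T : ℝ)⁻¹ • r.1 - θc)
      = ((prm.T : ℝ)⁻¹) ^ 2 * hq (r.1 - (((0 : ℕ) : ℝ) + prm.T) • θc) := by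
    intro r
    rw [← h.normSq_smul, smul_sub, smul_smul, Nat.cast_zero, zero_add, inv_mul_cancel₀ hT.ne',
      one_smul]
  simp only [e, expect_const_mul]
  rw [hp.tau]
  have h1 := mul_le_mul_of_nonneg_left key (sq_nonneg ((prm.T : ℝ)⁻¹))
  refine h1.trans ?_
  have e2 : ((prm.T : ℝ)⁻¹) ^ 2 * ((((0 : ℕ) : ℝ) + prm.T) * (0 + nrm (θ₀ - θc) ^ 2 / (prm.η * b)
      + prm.T * (hq (θ₀ - θc) / 40)))
      = nrm (θ₀ - θc) ^ 2 / (prm.η * b * prm.T) + hq (θ₀ - θc) / 40 := by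
    rw [Nat.cast_zero]
    field_simp
    ring
  rw [e2]
  -- The length `T ≥ 64 / (μ b η)` together with `μ ‖v‖² ≤ ‖Ψv‖²` yields `1/64`; with the `1/40`
  -- from the inner loop the total stays below `1/16`.
  have h2 : nrm (θ₀ - θc) ^ 2 / (prm.η * b * prm.T) ≤ hq (θ₀ - θc) / 64 := by
    rw [div_le_div_iff₀ (by positivity) (by norm_num)]
    have hTge := hp.T_ge
    rw [div_le_iff₀ (by positivity)] at hTge
    have f1 := h.mu_mul_le (θ₀ - θc)
    have f2 := mul_le_mul_of_nonneg_left hTge (sq_nonneg (nrm (θ₀ - θc)))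
    have f3 := mul_le_mul_of_nonneg_right f1 (show 0 ≤ prm.η * b * prm.T by positivity)
    linarith
  have := h.normSq_nonneg (θ₀ - θc)
  linarith

variable (M Ψ π π') in
/-- `Θ g` is the fixed point of the inner loop that is centered at `θ₀` with the batch average
`g`. -/
def IsFixedPointMap (θs θ₀ : Fin d → ℝ) (Θ : (Fin d → ℝ) → Fin d → ℝ) : Prop :=
  ∀ g, projOp M Ψ π π' (θ₀ - Θ g) = g ∧ ∀ ρ : ℝ, projOp M Ψ π π' (Θ g - θs) =
    -((g - vmean (obsLaw M π π') (fun ξ => tdOperator M Ψ θ₀ ρ ξ)) +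
      (ρ - avgCost M π) • vmean (obsLaw M π π') fun ξ => Ψ ξ.cur)

include h hθs in
-- As `A` is invertible, `Θ g = θ₀ - A⁻¹ g`. The stationary mean of the stochastic operator at `θ₀`
-- is `A (θ₀ - θs)` plus the cost error in the direction of the mean feature, so `A (Θ g - θs)` is
-- minus the sum of the batch noise and the cost error.
theorem exists_fixedPoint (θ₀ : Fin d → ℝ) :
    ∃ Θ : (Fin d → ℝ) → Fin d → ℝ, IsFixedPointMap M Ψ π π' θs θ₀ Θ := by
  choose X hX using h.exists_projOp_eq
  refine ⟨fun g => θ₀ - X g, fun g => ⟨by rw [sub_sub_cancel, hX], fun ρ => ?_⟩⟩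
  rw [h.vmean_tdOperator θ₀ ρ hθs, sub_right_comm, map_sub, hX]
  abel

variable {θ₀ : Fin d → ℝ} {Θ : (Fin d → ℝ) → Fin d → ℝ}
  (hΘ : IsFixedPointMap M Ψ π π' θs θ₀ Θ)

include h hp hΘ in
/-- The second moment of the error of the random fixed point, given the estimate of the cost. -/
theorem fixedPoint_sq_le_of_cost (P : PMF ((Fin d → ℝ) × Traj S A)) [FinSupp P] (ρ : ℝ)
    (hP : expect P (fun q => nrm ((prm.N : ℝ)⁻¹ • q.1
        - vmean (obsLaw M π π') (fun ξ => tdOperator M Ψ θ₀ ρ ξ)) ^ 2)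
      ≤ 6 * noise M Ψ π π' cbar θ₀ θs (ρ - avgCost M π) / prm.N) :
    expect P (fun q => hq (Θ ((prm.N : ℝ)⁻¹ • q.1) - θs))
      ≤ (288 * hq (θ₀ - θs) + 288 * nrm θs ^ 2 + 192 * cbar ^ 2) / 20000
        + (48 / 20000 + 2 / b ^ 2) * (ρ - avgCost M π) ^ 2 := by
  have hb := h.b_pos
  have hμ := h.mu_pos
  have hN : (0 : ℝ) < prm.N := by exact_mod_cast hp.N_pos hb hμ
  have hNb : 1 / (μ * b ^ 2 * prm.N) ≤ 1 / 20000 := by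
    have := hp.N_ge
    rw [div_le_iff₀ (by positivity)] at this
    rw [div_le_div_iff₀ (by positivity) (by norm_num)]
    linarith
  have hn0 : 0 ≤ noise M Ψ π π' cbar θ₀ θs (ρ - avgCost M π) :=
    le_trans (expect_nonneg _ fun ξ => sq_nonneg _) (h.expect_nrm_tdOperator_sq_le θ₀ θs ρ)
  set ζ : (Fin d → ℝ) × Traj S A → Fin d → ℝ := fun q => (prm.N : ℝ)⁻¹ • q.1
        - vmean (obsLaw M π π') (fun ξ => tdOperator M Ψ θ₀ ρ ξ) with hζ
  have e1 : expect P (fun q => nrm (ζ q) ^ 2)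
      ≤ 6 * noise M Ψ π π' cbar θ₀ θs (ρ - avgCost M π) / prm.N := hP
  have e2 : expect P (fun q => hq (Θ ((prm.N : ℝ)⁻¹ • q.1) - θs)) ≤
      expect P (fun q => 2 / (μ * b ^ 2) * nrm (ζ q) ^ 2
        + 2 / b ^ 2 * (ρ - avgCost M π) ^ 2) := by
    refine expect_mono P fun q => ?_
    have := h.normSq_fixedPoint_le ((hΘ ((prm.N : ℝ)⁻¹ • q.1)).2 ρ)
    refine this.trans (le_of_eq ?_)
    simp only [hζ]
    field_simp
  rw [expect_add, expect_const, expect_const_mul] at e2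
  have e4 := mul_le_mul_of_nonneg_left e1 (show 0 ≤ 2 / (μ * b ^ 2) by positivity)
  have e5 : 2 / (μ * b ^ 2) * (6 * noise M Ψ π π' cbar θ₀ θs (ρ - avgCost M π) / prm.N)
      = 12 * noise M Ψ π π' cbar θ₀ θs (ρ - avgCost M π) * (1 / (μ * b ^ 2 * prm.N)) := by
    field_simp; ring
  have e6 := mul_le_mul_of_nonneg_left hNb
    (show 0 ≤ 12 * noise M Ψ π π' cbar θ₀ θs (ρ - avgCost M π) by linarith)
  rw [noise] at e4 e5 e6
  linarith

include h hp hΘ in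
/-- The second moment of the error of the random fixed point. -/
theorem fixedPoint_sq_le (z : Traj S A) :
    expect (costSum M π prm.τ' prm.N' z) (fun r =>
      expect (operatorSum M Ψ π π' prm.τ' θ₀ (r.1 / prm.N') prm.N r.2) fun q =>
        hq (Θ ((prm.N : ℝ)⁻¹ • q.1) - θs))
      ≤ (hq (θ₀ - θs) + (nrm θs ^ 2 + cbar ^ 2)) / 16 := by
  have hb := h.b_pos
  have hμ := h.mu_pos
  have hN' : (0 : ℝ) < prm.N' := by exact_mod_cast hp.N'_pos hb hμ
  have hNb' : 1 / (b ^ 2 * prm.N') ≤ 1 / 20000 := by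
    have := hp.N'_ge
    rw [div_le_iff₀ (by positivity)] at this
    rw [div_le_div_iff₀ (by positivity) (by norm_num)]
    have : prm.N' * (μ * b ^ 2) ≤ prm.N' * (1 * b ^ 2) := by gcongr; exact h.mu_le
    linarith
  rw [hp.tau']
  have h1 : ∀ r : ℝ × Traj S A,
      expect (operatorSum M Ψ π π' (n + 1) θ₀ (r.1 / prm.N') prm.N r.2) (fun q =>
        hq (Θ ((prm.N : ℝ)⁻¹ • q.1) - θs))
      ≤ (288 * hq (θ₀ - θs) + 288 * nrm θs ^ 2 + 192 * cbar ^ 2) / 20000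
        + (48 / 20000 + 2 / b ^ 2) * (r.1 / prm.N' - avgCost M π) ^ 2 := fun r =>
    h.fixedPoint_sq_le_of_cost hp hΘ _ _
      (h.operatorSum_error (hp.N_pos hb hμ) hp.delta_N θ₀ θs (r.1 / prm.N') r.2).1
  have h2 := (h.costSum_error (hp.N'_pos hb hμ) hp.delta_N' z).1
  have h10 := expect_mono (costSum M π (n + 1) prm.N' z) h1
  rw [expect_add, expect_const, expect_const_mul] at h10
  refine h10.trans ?_
  have h3 := mul_le_mul_of_nonneg_left h2 (show 0 ≤ 48 / 20000 + 2 / b ^ 2 by positivity)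
  have h4 : 2 / b ^ 2 * (6 * cbar ^ 2 / prm.N') = 12 * cbar ^ 2 * (1 / (b ^ 2 * prm.N')) := by
    field_simp; ring
  have h5 := mul_le_mul_of_nonneg_left hNb' (show 0 ≤ 12 * cbar ^ 2 by positivity)
  have h6 : 6 * cbar ^ 2 / prm.N' ≤ 6 * cbar ^ 2 := by
    refine div_le_self (by positivity) ?_
    exact_mod_cast hp.N'_pos hb hμ
  have h7 := h.normSq_nonneg (θ₀ - θs)
  have h8 := sq_nonneg cbar
  have h9 := sq_nonneg (nrm θs)
  linarith

include h hp hθs in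
/-- The contraction of the second moment of the error in one epoch. -/
theorem epoch_sq_le (θ₀ : Fin d → ℝ) (z : Traj S A) :
    expect (epoch M Ψ π π' prm θ₀ z) (fun r => hq (r.1 - θs))
      ≤ hq (θ₀ - θs) / 2 + (nrm θs ^ 2 + cbar ^ 2) / 2 := by
  obtain ⟨Θ, hΘ⟩ := h.exists_fixedPoint hθs θ₀
  have h1 : expect (epoch M Ψ π π' prm θ₀ z) (fun r => hq (r.1 - θs)) ≤
      expect (costSum M π prm.τ' prm.N' z) (fun r =>
        expect (operatorSum M Ψ π π' prm.τ' θ₀ (r.1 / prm.N') prm.N r.2) fun q =>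
          hq (θ₀ - θs) / 4 + 9 / 4 * hq (Θ ((prm.N : ℝ)⁻¹ • q.1) - θs)) := by
    rw [epoch, expect_bind]
    refine expect_mono _ fun r => ?_
    rw [expect_bind]
    refine expect_mono _ fun q => ?_
    rw [expect_map]
    set θc := Θ ((prm.N : ℝ)⁻¹ • q.1) with hθc
    have e0 := (hΘ ((prm.N : ℝ)⁻¹ • q.1)).1
    rw [← hθc] at e0
    conv_lhs => rw [← e0]
    have e1 := h.innerLoop_output_sq_le hp θ₀ θc (r.1 / prm.N') q.2
    have e2 := expect_mono (innerLoop M Ψ π π' prm.η prm.τ θ₀ (r.1 / prm.N') (𝒜 (θ₀ - θc)) prm.T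
        θ₀ 0 q.2) (f := fun w => hq ((prm.T : ℝ)⁻¹ • w.1 - θs))
        (g := fun w => 2 * hq ((prm.T : ℝ)⁻¹ • w.1 - θc) + 2 * hq (θc - θs)) fun w => by
      have := h.normSq_add_le ((prm.T : ℝ)⁻¹ • w.1 - θc) (θc - θs)
      rwa [sub_add_sub_cancel] at this
    rw [expect_add, expect_const, expect_const_mul] at e2
    have e3 := h.normSq_sub_le (θ₀ - θs) (θc - θs)
    rw [sub_sub_sub_cancel_right] at e3
    linarith
  refine h1.trans ?_
  simp only [expect_add, expect_const, expect_const_mul]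
  have h2 := h.fixedPoint_sq_le hp (Θ := Θ) hΘ z
  have h3 := h.normSq_nonneg (θ₀ - θs)
  have h4 := sq_nonneg (nrm θs)
  have h5 := sq_nonneg cbar
  linarith

include h hp hθs in
/-- The second moment of the error of the critic. -/
theorem runEpochs_sq_le (k : ℕ) (θ : Fin d → ℝ) (z : Traj S A) :
    expect (runEpochs M Ψ π π' prm k θ z) (fun r => hq (r.1 - θs))
      ≤ (1 / 2) ^ k * hq (θ - θs) + (1 - (1 / 2) ^ k) * (nrm θs ^ 2 + cbar ^ 2) := by
  induction k generalizing θ z with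
  | zero => simp [runEpochs]
  | succ k ih =>
    rw [runEpochs, expect_bind]
    have h0 := expect_mono (epoch M Ψ π π' prm θ z) fun r : (Fin d → ℝ) × Traj S A => ih r.1 r.2
    rw [expect_add, expect_const, expect_const_mul] at h0
    refine h0.trans ?_
    have h1 := mul_le_mul_of_nonneg_left (h.epoch_sq_le hp hθs θ z)
      (show (0 : ℝ) ≤ (1 / 2) ^ k by positivity)
    have h2 := pow_succ (1 / 2 : ℝ) k
    rw [h2]
    linarith

include h hp hθs in
/-- The mean of the output of one epoch. -/
theorem epoch_mean (hcbar : 0 ≤ cbar) {s : ℝ} (hs : 0 < s) (θ₀ : Fin d → ℝ) (z : Traj S A) :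
    nrm (vmean (epoch M Ψ π π' prm θ₀ z) (fun r => r.1)
      - (θs + averageMap M Ψ π π' prm.η prm.T (θ₀ - θs)))
      ≤ δ * biasFactor b μ prm * ((hq (θ₀ - θs) + (nrm θs ^ 2 + cbar ^ 2 + s ^ 2)) / s) := by
  obtain ⟨Θ, hΘ⟩ := h.exists_fixedPoint hθs θ₀
  have hb := h.b_pos
  have hμ := h.mu_pos
  have hδ := h.delta_nonneg
  have hη := hp.eta_pos
  have hT : (0 : ℝ) < prm.T := by exact_mod_cast hp.T_pos hb hμ
  set R := averageMap M Ψ π π' prm.η prm.T with hR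
  set h₀ := hq (θ₀ - θs) with hh₀
  have hh₀' : 0 ≤ h₀ := h.normSq_nonneg _
  set P := costSum M π prm.τ' prm.N' z with hP
  set Q : ℝ × Traj S A → PMF ((Fin d → ℝ) × Traj S A) := fun r =>
    operatorSum M Ψ π π' prm.τ' θ₀ (r.1 / prm.N') prm.N r.2 with hQ
  have hQfin : ∀ r, FinSupp (Q r) := fun r => finSupp_operatorSum _ _ _ _ _ _ _ _ _
  set W : (Fin d → ℝ) × Traj S A → Fin d → ℝ := fun q => Θ ((prm.N : ℝ)⁻¹ • q.1) - θs with hW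
  set I : ℝ × Traj S A → (Fin d → ℝ) × Traj S A → Fin d → ℝ := fun r q =>
    (prm.T : ℝ)⁻¹ • vmean (innerLoop M Ψ π π' prm.η prm.τ θ₀ (r.1 / prm.N')
      ((prm.N : ℝ)⁻¹ • q.1) prm.T θ₀ 0 q.2) (fun w => w.1) with hI
  have hep : vmean (epoch M Ψ π π' prm θ₀ z) (fun r => r.1) =
      vmean P fun r => vmean (Q r) fun q => I r q := by
    rw [epoch, vmean_bind]
    congr 1
    funext r
    rw [vmean_bind]
    congr 1
    funext q
    rw [vmean_map, hI, vmean_smul]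
  -- the mean of the inner loop
  have hinner : ∀ r q, nrm (I r q - (θs + R (θ₀ - θs) + (W q - R (W q)))) ≤
      prm.T * prm.η * δ * ((prm.T + 2) / s) *
        ((2 * h₀ + 2 * hq (W q)) / μ + s ^ 2) := by
    intro r q
    set θc := Θ ((prm.N : ℝ)⁻¹ • q.1) with hθc
    have e0 := (hΘ ((prm.N : ℝ)⁻¹ • q.1)).1
    rw [← hθc] at e0
    have key := h.innerLoop_mean hη hp.eta_le θ₀ θc (r.1 / prm.N') hs prm.T θ₀ 0 q.2
    rw [e0, ← hp.tau, zero_add] at key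
    have e1 : θ₀ - θc = (θ₀ - θs) - W q := by simp only [hW, ← hθc]; abel
    have e2 : I r q - (θs + R (θ₀ - θs) + (W q - R (W q))) = (prm.T : ℝ)⁻¹ •
        (vmean (innerLoop M Ψ π π' prm.η prm.τ θ₀ (r.1 / prm.N')
      ((prm.N : ℝ)⁻¹ • q.1) prm.T θ₀ 0 q.2) (fun w => w.1)
          - ((prm.T : ℝ) • θc + sumMap M Ψ π π' prm.η prm.T (θ₀ - θc))) := by
      have e3 : (prm.T : ℝ)⁻¹ • sumMap M Ψ π π' prm.η prm.T (θ₀ - θc)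
          = R (θ₀ - θs) - R (W q) := by
        rw [← map_sub, ← e1]; rfl
      rw [smul_sub, smul_add, smul_smul, inv_mul_cancel₀ hT.ne', one_smul, e3]
      simp only [hW, ← hθc, hI]
      abel
    have e4 : nrm (θ₀ - θc) ^ 2 ≤ (2 * h₀ + 2 * hq (W q)) / μ := by
      refine (h.nrm_sq_le _).trans ?_
      rw [e1]
      gcongr
      exact h.normSq_sub_le _ _
    rw [e2, nrm_smul, abs_of_nonneg (by positivity), inv_mul_le_iff₀ hT]
    refine key.trans ?_
    set D := nrm (θ₀ - θc) ^ 2 with hD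
    have hD0 : 0 ≤ D := sq_nonneg _
    have e5 : D + (prm.T + 1) * D + s ^ 2 ≤
        (prm.T + 2) * ((2 * h₀ + 2 * hq (W q)) / μ + s ^ 2) := by
      have f1 := mul_le_mul_of_nonneg_left e4 (show (0 : ℝ) ≤ prm.T + 2 by positivity)
      have f2 : 0 ≤ (prm.T : ℝ) * s ^ 2 := by positivity
      nlinarith [sq_nonneg s]
    calc _ ≤ (prm.T : ℝ) ^ 2 * (prm.η * δ) *
          ((prm.T + 2) * ((2 * h₀ + 2 * hq (W q)) / μ + s ^ 2) / s) := by gcongr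
      _ = _ := by ring
  -- the mean of the fixed point
  set r' : ℝ × Traj S A → ℝ := fun r => r.1 / prm.N' - avgCost M π with hr'
  set V : ℝ × Traj S A → ℝ := fun r => noise M Ψ π π' cbar θ₀ θs (r' r) with hV
  have hV0 : ∀ r, 0 ≤ V r := fun r =>
    le_trans (expect_nonneg _ fun ξ => sq_nonneg _)
      (h.expect_nrm_tdOperator_sq_le θ₀ θs (r.1 / prm.N'))
  have hcost := h.costSum_error (hp.N'_pos hb hμ) hp.delta_N' z
  rw [← hp.tau'] at hcost
  have hEr2 : expect P (fun r => r' r ^ 2) ≤ 6 * cbar ^ 2 := by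
    refine hcost.1.trans (div_le_self (by positivity) ?_)
    exact_mod_cast hp.N'_pos hb hμ
  have hEr : |expect P r'| ≤ δ * cbar := by
    refine abs_le_of_sq_le_sq ?_ (mul_nonneg hδ hcbar)
    rw [mul_pow]; exact hcost.2
  have hEV : expect P V ≤ 24 * h₀ + 24 * nrm θs ^ 2 + 40 * cbar ^ 2 := by
    have e : V = fun r => (24 * h₀ + 24 * nrm θs ^ 2 + 16 * cbar ^ 2) + 4 * r' r ^ 2 := by
      funext r; simp only [hV, noise, hh₀]
    rw [e, expect_add, expect_const, expect_const_mul]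
    linarith
  -- The bias of the batch is at most `δ √V`. The root is replaced by `V / s + s`, since it is `V`
  -- whose mean over the cost estimates is known.
  have hζ : ∀ r, nrm (vmean (Q r) fun q => (prm.N : ℝ)⁻¹ • q.1
      - vmean (obsLaw M π π') (fun ξ => tdOperator M Ψ θ₀ (r.1 / prm.N') ξ))
      ≤ δ * (V r / s + s) := by
    intro r
    have e1 := (h.operatorSum_error (hp.N_pos hb hμ) hp.delta_N θ₀ θs (r.1 / prm.N') r.2).2
    rw [← hp.tau'] at e1
    refine le_of_sq_le_sq (e1.trans ?_) (mul_nonneg hδ (by have := hV0 r; positivity))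
    rw [mul_pow]
    refine mul_le_mul_of_nonneg_left ?_ (sq_nonneg δ)
    change V r ≤ _
    have e2 : V r / s * s = V r := div_mul_cancel₀ _ hs.ne'
    have := sq_nonneg (V r / s - s)
    have := hV0 r
    nlinarith
  set m := vmean P fun r => vmean (Q r) W with hm
  have hAm : nrm (𝒜 m) ≤ 50 * δ * ((h₀ + (nrm θs ^ 2 + cbar ^ 2 + s ^ 2)) / s) := by
    -- The fixed point depends affinely on the batch average and on the cost estimate, so its mean
    -- error `m` involves only their biases, of order `δ`, and not their fluctuations.
    have e1 : 𝒜 m = -((vmean P fun r => vmean (Q r) fun q => (prm.N : ℝ)⁻¹ • q.1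
        - vmean (obsLaw M π π') (fun ξ => tdOperator M Ψ θ₀ (r.1 / prm.N') ξ))
        + expect P r' • vmean (obsLaw M π π') fun ξ => Ψ ξ.cur) := by
      rw [hm, map_vmean]
      have f1 : ∀ r, 𝒜 (vmean (Q r) W) = (-1 : ℝ) • ((vmean (Q r) fun q => (prm.N : ℝ)⁻¹ • q.1
          - vmean (obsLaw M π π') (fun ξ => tdOperator M Ψ θ₀ (r.1 / prm.N') ξ))
          + r' r • vmean (obsLaw M π π') fun ξ => Ψ ξ.cur) := by
        intro r
        rw [map_vmean]
        simp only [hW, fun q : (Fin d → ℝ) × Traj S A =>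
          (hΘ ((prm.N : ℝ)⁻¹ • q.1)).2 (r.1 / prm.N')]
        simp only [← neg_one_smul ℝ (_ + _), vmean_smul, vmean_add, vmean_const, hr']
      simp only [f1, vmean_smul, vmean_add]
      rw [neg_one_smul]
      congr 2
      funext i
      simp only [vmean, Pi.smul_apply, smul_eq_mul, expect_mul_const]
    rw [e1, nrm_neg]
    refine (nrm_add_le _ _).trans ?_
    have e2 : nrm (vmean P fun r => vmean (Q r) fun q => (prm.N : ℝ)⁻¹ • q.1
        - vmean (obsLaw M π π') (fun ξ => tdOperator M Ψ θ₀ (r.1 / prm.N') ξ))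
        ≤ δ * ((24 * h₀ + 24 * nrm θs ^ 2 + 40 * cbar ^ 2) / s + s) := by
      refine (nrm_vmean_le _ _).trans ((expect_mono _ hζ).trans ?_)
      rw [expect_const_mul, expect_add, expect_const]
      simp only [div_eq_mul_inv _ s, expect_mul_const]
      gcongr
    have e3 : nrm (expect P r' • vmean (obsLaw M π π') fun ξ => Ψ ξ.cur) ≤ δ * cbar := by
      rw [nrm_smul]
      exact (mul_le_of_le_one_right (abs_nonneg _) h.nrm_vmean_cur_le).trans hEr
    have e4 : (24 * h₀ + 24 * nrm θs ^ 2 + 40 * cbar ^ 2) / s + s + cbar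
        ≤ 50 * ((h₀ + (nrm θs ^ 2 + cbar ^ 2 + s ^ 2)) / s) := by
      rw [← mul_div_assoc, le_div_iff₀ hs, add_mul, add_mul, div_mul_cancel₀ _ hs.ne']
      nlinarith [sq_nonneg (cbar - s), sq_nonneg (nrm θs)]
    have e5 := mul_le_mul_of_nonneg_left e4 hδ
    linarith
  have hmle : nrm m ≤ 50 * δ * ((h₀ + (nrm θs ^ 2 + cbar ^ 2 + s ^ 2)) / s) / (b * μ) := by
    rw [le_div_iff₀ (by positivity)]
    have := h.mu_b_mul_nrm_le m
    linarith
  -- the second moment of the fixed point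
  have hW2 : expect P (fun r => expect (Q r) fun q => hq (W q)) ≤
      h₀ + (nrm θs ^ 2 + cbar ^ 2) := by
    refine (h.fixedPoint_sq_le hp hΘ z).trans ?_
    have := sq_nonneg (nrm θs)
    have := sq_nonneg cbar
    linarith
  have hfirst : nrm (vmean P fun r => vmean (Q r) fun q =>
      I r q - (θs + R (θ₀ - θs) + (W q - R (W q)))) ≤
      prm.T * prm.η * δ * ((prm.T + 2) / s) *
        (4 * (h₀ + (nrm θs ^ 2 + cbar ^ 2 + s ^ 2)) / μ) := by
    refine (nrm_vmean_le _ _).trans ?_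
    refine (expect_mono _ fun r => (nrm_vmean_le _ _).trans
      (expect_mono _ fun q => hinner r q)).trans ?_
    simp only [expect_const_mul, expect_add, expect_const, div_eq_mul_inv _ μ, expect_mul_const]
    refine mul_le_mul_of_nonneg_left ?_ (by positivity)
    have e1 : s ^ 2 ≤ s ^ 2 * μ⁻¹ := by
      refine le_mul_of_one_le_right (sq_nonneg s) ?_
      exact (one_le_inv₀ hμ).2 h.mu_le
    have e2 : (2 * h₀ + 2 * expect P (fun r => expect (Q r) fun q => hq (W q))) * μ⁻¹
        ≤ (2 * h₀ + 2 * (h₀ + (nrm θs ^ 2 + cbar ^ 2))) * μ⁻¹ := by gcongr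
    have e3 : 0 ≤ μ⁻¹ * (2 * (nrm θs ^ 2 + cbar ^ 2) + 3 * s ^ 2) := by positivity
    linarith
  -- The mean error of the epoch consists of the mixing error of the inner loop and of `(I - R) m`.
  have hsplit : vmean (epoch M Ψ π π' prm θ₀ z) (fun r => r.1) - (θs + R (θ₀ - θs))
      = (vmean P fun r => vmean (Q r) fun q =>
      I r q - (θs + R (θ₀ - θs) + (W q - R (W q)))) + (m - R m) := by
    rw [hep]
    simp only [vmean_sub, vmean_add, vmean_const, ← map_vmean]
    rw [← hm]
    abel
  rw [hsplit]
  refine (nrm_add_le _ _).trans ?_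
  have hRm : nrm (m - R m) ≤ 2 * nrm m := by
    have e1 := nrm_sub_le m (R m)
    have e2 := h.nrm_averageMap_le hη hp.eta_le hp.T_ge m
    have := nrm_nonneg m
    linarith
  refine (add_le_add hfirst (hRm.trans (mul_le_mul_of_nonneg_left hmle (by norm_num)))).trans
    (le_of_eq ?_)
  rw [biasFactor]
  field_simp
  ring

include h hp hθs in
/-- The bias of the critic. -/
theorem runEpochs_mean (hcbar : 0 ≤ cbar) {s : ℝ} (hs : 0 < s) (k : ℕ) (θ : Fin d → ℝ)
    (z : Traj S A) :
    nrm (vmean (runEpochs M Ψ π π' prm k θ z) (fun r => r.1)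
      - (θs + (averageMap M Ψ π π' prm.η prm.T ^ k) (θ - θs)))
      ≤ δ * biasFactor b μ prm *
        ((2 * hq (θ - θs) + 2 * k * (nrm θs ^ 2 + cbar ^ 2 + s ^ 2)) / s) := by
  have hb := h.b_pos
  have hμ := h.mu_pos
  have hδ := h.delta_nonneg
  have hbf := biasFactor_nonneg (prm := prm) hb hμ hp.eta_pos
  set m := nrm θs ^ 2 + cbar ^ 2 + s ^ 2 with hm
  set R := averageMap M Ψ π π' prm.η prm.T with hR
  have hpow : ∀ (k : ℕ) v, nrm ((R ^ k) v) ≤ nrm v := by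
    intro k
    induction k with
    | zero => intro v; simp
    | succ k ih =>
      intro v
      rw [pow_succ, Module.End.mul_apply]
      have := h.nrm_averageMap_le hp.eta_pos hp.eta_le hp.T_ge v
      have := nrm_nonneg v
      exact (ih _).trans (by linarith)
  induction k generalizing θ z with
  | zero =>
    have e : vmean (runEpochs M Ψ π π' prm 0 θ z) (fun r => r.1) = θ := by
      funext i; simp [runEpochs, vmean]
    rw [e, pow_zero, Module.End.one_apply, add_sub_cancel, sub_self, nrm_zero]
    have := h.normSq_nonneg (θ - θs)
    positivity
  | succ k ih =>
    set p := epoch M Ψ π π' prm θ z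
    set F : (Fin d → ℝ) × Traj S A → Fin d → ℝ := fun r =>
      vmean (runEpochs M Ψ π π' prm k r.1 r.2) (fun r => r.1) with hF
    set G : (Fin d → ℝ) × Traj S A → Fin d → ℝ := fun r => θs + (R ^ k) (r.1 - θs) with hG
    have hG' : vmean p G = θs + (R ^ k) (vmean p (fun r => r.1) - θs) := by
      rw [hG, vmean_add, vmean_const, ← map_vmean, vmean_sub, vmean_const]
    have hdec : vmean (runEpochs M Ψ π π' prm (k + 1) θ z) (fun r => r.1)
        - (θs + (R ^ (k + 1)) (θ - θs))
        = vmean p (fun r => F r - G r) +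
          (R ^ k) (vmean p (fun r => r.1) - (θs + R (θ - θs))) := by
      have e : (R ^ k) (vmean p (fun r => r.1) - (θs + R (θ - θs)))
          = (R ^ k) (vmean p (fun r => r.1) - θs) - (R ^ k) (R (θ - θs)) := by
        rw [← map_sub, sub_sub]
      rw [runEpochs, vmean_bind, vmean_sub, hG', pow_succ, Module.End.mul_apply, e]
      abel
    have h1 : nrm (vmean p (fun r => F r - G r)) ≤ δ * biasFactor b μ prm *
        ((2 * (hq (θ - θs) / 2 + m / 2) + 2 * k * m) / s) := by
      have h0 := expect_mono p fun r : (Fin d → ℝ) × Traj S A => ih r.1 r.2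
      rw [expect_const_mul] at h0
      refine (nrm_vmean_le _ _).trans (h0.trans ?_)
      refine mul_le_mul_of_nonneg_left ?_ (mul_nonneg hδ hbf)
      simp only [div_eq_mul_inv _ s, expect_mul_const, expect_add, expect_const,
        expect_const_mul]
      refine mul_le_mul_of_nonneg_right ?_ (by positivity)
      have := h.epoch_sq_le hp hθs θ z
      have := sq_nonneg s
      linarith
    have h2 := (hpow k _).trans (h.epoch_mean hp hθs hcbar hs θ z)
    rw [hdec]
    -- With `q` the initial form, the later epochs contribute `q + m + 2 k m`, because the first one
    -- halves the second moment up to `m / 2`. The first epoch itself contributes `q + m`; the sum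
    -- is `2 q + 2 (k + 1) m`.
    refine (nrm_add_le _ _).trans ((add_le_add h1 h2).trans (le_of_eq ?_))
    push_cast
    ring

end CriticSetting

/-! ### The differential Q-function -/

section DiffQ

variable (M : Model S A) (π : Policy S A)

/-- The centered cost at time `t`, given the state-action pair at time `0`. -/
def costAt (t : ℕ) : S × A → ℝ := (pairMatrix M π ^ t).mulVec fun y => costVec M y - avgCost M π

theorem costAt_succ (t : ℕ) (x : S × A) :
    costAt M π (t + 1) x = nextMean M π (costAt M π t) x := by
  rw [costAt, pow_succ', ← mulVec_mulVec]
  rfl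

theorem sum_policy_mul_nextMean (π' : Policy S A) (f : S × A → ℝ) (s : S) :
    ∑ a, π' s a * nextMean M π f (s, a) =
      ∑ s', stateMatrix M π' s s' * ∑ a, π s' a * f (s', a) := by
  simp only [nextMean_eq, stateMatrix, of_apply, sum_mul]
  rw [sum_comm]
  simp only [mul_sum, mul_assoc]

theorem sum_policy_mul_costAt (t : ℕ) (s : S) :
    ∑ a, π s a * costAt M π t (s, a) =
      ∑ s', (stateMatrix M π ^ t) s s' * ∑ a, π s' a * (M.cost s' a - avgCost M π) := by
  induction t generalizing s with
  | zero => simp [costAt, costVec, one_apply]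
  | succ t ih =>
    simp only [costAt_succ, sum_policy_mul_nextMean, ih, pow_succ', mul_apply, sum_mul]
    rw [sum_comm]
    simp only [mul_sum, mul_assoc]

variable {M π} [Nonempty S] {cbar CP ϱ : ℝ}

theorem abs_avgCost_le (hc : ∀ s a, |M.cost s a| ≤ cbar) : |avgCost M π| ≤ cbar := by
  have h1 : ∀ s, |∑ a, π s a * M.cost s a| ≤ cbar := fun s => by
    rw [← expect_draw]
    exact (abs_expect_le _ _).trans (expect_le_const _ fun a => hc s a)
  rw [avgCost]
  calc |∑ s, stationary M π s * ∑ a, π s a * M.cost s a|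
      ≤ ∑ s, stationary M π s * cbar := by
        refine (abs_sum_le_sum_abs _ _).trans (sum_le_sum fun s _ => ?_)
        rw [abs_mul, abs_of_nonneg (stationary_nonneg M π s)]
        exact mul_le_mul_of_nonneg_left (h1 s) (stationary_nonneg M π s)
    _ = cbar := by rw [← sum_mul, sum_stationary, one_mul]

/-- The centered cost per state has stationary mean zero, so the rows of the `t`-th power may be
replaced by their differences from the stationary distribution. The first step, from the pair to a
state, accounts for `t + 1`. -/
theorem abs_costAt_le (hc : ∀ s a, |M.cost s a| ≤ cbar) (hm : IsMixingRate M CP ϱ) (t : ℕ)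
    (x : S × A) : |costAt M π (t + 1) x| ≤ 2 * cbar * (CP * ϱ ^ t) := by
  set g : S → ℝ := fun s => ∑ a, π s a * (M.cost s a - avgCost M π) with hg
  have hρ := abs_avgCost_le (π := π) hc
  have hgb : ∀ s, |g s| ≤ 2 * cbar := fun s => by
    simp only [hg]
    rw [← expect_draw]
    refine (abs_expect_le _ _).trans (expect_le_const _ fun a => ?_)
    have := abs_sub (M.cost s a) (avgCost M π)
    have := hc s a
    linarith
  have hg0 : ∑ s, stationary M π s * g s = 0 := by
    simp only [hg, mul_sub, sum_sub_distrib, ← sum_mul, stdSimplex.sum_eq_one, one_mul,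
      sum_stationary]
    rw [avgCost, sub_self]
  have hc0 : 0 ≤ cbar := (abs_nonneg _).trans hρ
  rw [costAt_succ, nextMean_eq, ← expect_draw]
  refine (abs_expect_le _ _).trans (expect_le_const _ fun s => ?_)
  rw [sum_policy_mul_costAt]
  have e : ∑ s', (stateMatrix M π ^ t) s s' * g s' =
      ∑ s', ((stateMatrix M π ^ t) s s' - stationary M π s') * g s' := by
    simp only [sub_mul, sum_sub_distrib, hg0, sub_zero]
  change |∑ s', (stateMatrix M π ^ t) s s' * g s'| ≤ _
  rw [e]
  refine (abs_sum_le_sum_abs _ _).trans ?_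
  calc _ ≤ ∑ s', |(stateMatrix M π ^ t) s s' - stationary M π s'| * (2 * cbar) := by
        refine sum_le_sum fun s' _ => ?_
        rw [abs_mul]
        exact mul_le_mul_of_nonneg_left (hgb s') (abs_nonneg _)
    _ ≤ _ := by
        rw [← sum_mul, mul_comm]
        exact mul_le_mul_of_nonneg_left (hm.2.2.2 π t s) (by linarith)

theorem summable_costAt (hc : ∀ s a, |M.cost s a| ≤ cbar) (hm : IsMixingRate M CP ϱ)
    (x : S × A) : Summable fun t => costAt M π t x := by
  rw [← summable_nat_add_iff 1]
  refine Summable.of_norm_bounded (g := fun t => 2 * cbar * (CP * ϱ ^ t)) ?_ fun t => by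
    rw [Real.norm_eq_abs]; exact abs_costAt_le hc hm t x
  exact ((summable_geometric_of_lt_one hm.2.1.le hm.2.2.1).mul_left CP).mul_left _

/-- The Poisson equation: split off the term at time zero and take the transition matrix out of the
convergent rest. -/
theorem diffQ_eq (hc : ∀ s a, |M.cost s a| ≤ cbar) (hm : IsMixingRate M CP ϱ) (x : S × A) :
    diffQ M π x = M.cost x.1 x.2 - avgCost M π + nextMean M π (diffQ M π) x := by
  change ∑' t, costAt M π t x = _
  rw [(summable_costAt hc hm x).tsum_eq_zero_add]
  congr 1
  · simp [costAt, costVec]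
  · simp only [costAt_succ, nextMean]
    rw [Summable.tsum_finsetSum fun y _ => (summable_costAt hc hm y).mul_left _]
    exact sum_congr rfl fun y _ => tsum_mul_left

theorem abs_diffQ_le (hc : ∀ s a, |M.cost s a| ≤ cbar) (hm : IsMixingRate M CP ϱ) (x : S × A) :
    |diffQ M π x| ≤ 2 * cbar + 2 * cbar * (CP * (1 - ϱ)⁻¹) := by
  change |∑' t, costAt M π t x| ≤ _
  rw [(summable_costAt hc hm x).tsum_eq_zero_add]
  refine (abs_add_le _ _).trans (add_le_add ?_ ?_)
  · have h1 := abs_avgCost_le (π := π) hc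
    have h2 := hc x.1 x.2
    have h3 := abs_sub (M.cost x.1 x.2) (avgCost M π)
    simp only [costAt, costVec, pow_zero, one_mulVec]
    linarith
  · have hs := ((hasSum_geometric_of_lt_one hm.2.1.le hm.2.2.1).mul_left CP).mul_left (2 * cbar)
    have h1 := tsum_of_norm_bounded (f := fun t => costAt M π (t + 1) x) hs fun t => by
      rw [Real.norm_eq_abs]; exact abs_costAt_le hc hm t x
    rwa [Real.norm_eq_abs] at h1

/-- The performance difference lemma. -/
theorem avgCost_sub_avgCost (hc : ∀ s a, |M.cost s a| ≤ cbar) (hm : IsMixingRate M CP ϱ)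
    (π' : Policy S A) :
    avgCost M π' - avgCost M π =
      ∑ s, stationary M π' s * ∑ a, diffQ M π (s, a) * (π' s a - π s a) := by
  set V : S → ℝ := fun s => ∑ a, π s a * diffQ M π (s, a) with hV
  have h1 : ∀ s, ∑ a, π' s a * diffQ M π (s, a) =
      ∑ a, π' s a * M.cost s a - avgCost M π + ∑ s', stateMatrix M π' s s' * V s' := by
    intro s
    have e : ∀ a, π' s a * diffQ M π (s, a) = π' s a * M.cost s a - π' s a * avgCost M π +
        π' s a * nextMean M π (diffQ M π) (s, a) := by
      intro a
      conv_lhs => rw [diffQ_eq hc hm]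
      ring
    simp only [e, sum_add_distrib, sum_sub_distrib, ← sum_mul, stdSimplex.sum_eq_one, one_mul,
      sum_policy_mul_nextMean, hV]
  -- Stationarity of `π'` cancels the value terms, so only the cost difference survives.
  have h2 : ∑ s, stationary M π' s * ∑ s', stateMatrix M π' s s' * V s' =
      ∑ s, stationary M π' s * V s := by
    simp only [mul_sum, ← mul_assoc]
    rw [sum_comm]
    simp only [← sum_mul, sum_stationary_mul]
  have h3 : ∀ s, ∑ a, diffQ M π (s, a) * (π' s a - π s a) =
      ∑ a, π' s a * M.cost s a - avgCost M π + ∑ s', stateMatrix M π' s s' * V s' - V s := by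
    intro s
    rw [← h1, hV, ← sum_sub_distrib]
    exact sum_congr rfl fun a _ => by ring
  rw [sum_congr rfl fun s _ => congrArg (stationary M π' s * ·) (h3 s)]
  simp only [mul_add, mul_sub, sum_add_distrib, sum_sub_distrib, h2, ← sum_mul, sum_stationary]
  conv_lhs => rw [avgCost]
  ring

end DiffQ

/-! ### The span seminorm -/

section Span

variable (Q : S × A → ℝ)

theorem spanNorm_nonneg : 0 ≤ spanNorm Q := Real.iInf_nonneg fun _ => norm_nonneg _

theorem spanNorm_le (b : ℝ) : spanNorm Q ≤ ‖fun x => Q x + b‖ :=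
  ciInf_le ⟨0, by rintro _ ⟨b, rfl⟩; exact norm_nonneg _⟩ b

theorem spanNorm_le_norm : spanNorm Q ≤ ‖Q‖ := by simpa using spanNorm_le Q 0

theorem le_spanNorm {c : ℝ} (h : ∀ b : ℝ, c ≤ ‖fun x => Q x + b‖) : c ≤ spanNorm Q := le_ciInf h

theorem spanNorm_add_le (Q' : S × A → ℝ) :
    spanNorm (fun x => Q x + Q' x) ≤ ‖Q‖ + spanNorm Q' := by
  rw [← sub_le_iff_le_add']
  refine le_spanNorm _ fun b => ?_
  rw [sub_le_iff_le_add']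
  refine (spanNorm_le _ b).trans ?_
  have := norm_add_le Q fun x => Q' x + b
  simp only [add_assoc]
  exact this

/-- The difference of two distributions has mass zero and is orthogonal to constants. This is why
the actor needs the estimate only modulo constants. -/
theorem abs_sum_mul_sub_le (s : S) (p q : stdSimplex ℝ A) :
    |∑ a, Q (s, a) * (p a - q a)| ≤ 2 * spanNorm Q := by
  have h : |∑ a, Q (s, a) * (p a - q a)| / 2 ≤ spanNorm Q := by
    refine le_spanNorm _ fun b => ?_
    have e : ∑ a, Q (s, a) * (p a - q a) = ∑ a, (Q (s, a) + b) * (p a - q a) := by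
      simp only [add_mul, sum_add_distrib, ← mul_sum, sum_sub_distrib, stdSimplex.sum_eq_one]
      ring
    rw [e, div_le_iff₀ two_pos]
    calc _ ≤ ∑ a, ‖fun x => Q x + b‖ * (p a + q a) := by
          refine (abs_sum_le_sum_abs _ _).trans (sum_le_sum fun a _ => ?_)
          rw [abs_mul]
          refine mul_le_mul (norm_le_pi_norm (fun x => Q x + b) (s, a)) ?_ (abs_nonneg _)
            (norm_nonneg _)
          have h1 := stdSimplex.zero_le p a
          have h2 := stdSimplex.zero_le q a
          rw [abs_le]
          constructor <;> linarith
      _ = _ := by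
          rw [← mul_sum, sum_add_distrib, stdSimplex.sum_eq_one, stdSimplex.sum_eq_one]
          ring
  linarith

theorem abs_sub_mean_le (s : S) (a : A) (p : stdSimplex ℝ A) :
    |Q (s, a) - ∑ a', Q (s, a') * p a'| ≤ 2 * spanNorm Q := by
  have := abs_sum_mul_sub_le Q s (stdSimplex.vertex a) p
  simpa [mul_sub, sum_sub_distrib, Pi.single_apply] using this

end Span

/-! ### Relative entropy and the mirror descent update -/

/-- Serves in place of Hoeffding's lemma: averaged over a centered bounded variable, the linear term
vanishes and a subgaussian bound remains. -/
theorem exp_le_add_exp_sq (x : ℝ) : Real.exp x ≤ x + Real.exp (x ^ 2) := by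
  rcases le_or_gt |x| 1 with h | h
  · have h1 := (abs_le.1 (Real.abs_exp_sub_one_sub_id_le h)).2
    have h2 := Real.add_one_le_exp (x ^ 2)
    linarith
  · rcases lt_abs.1 h with h | h
    · have : Real.exp x ≤ Real.exp (x ^ 2) := Real.exp_le_exp.2 (by nlinarith)
      linarith
    · have h1 : Real.exp x ≤ 1 := Real.exp_le_one_iff.2 (by linarith)
      have h2 := Real.add_one_le_exp (x ^ 2)
      nlinarith

section Prox

variable {lam : ℝ} {p q : stdSimplex ℝ A}

/-- Adding `q a - p a`, of total mass zero, makes each summand nonnegative, with equality only for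
`p a = q a`. -/
theorem kl_eq_sum_klFun (hq : ∀ a, 0 < q a) :
    kl p q = ∑ a, q a * InformationTheory.klFun (p a / q a) := by
  have e : ∀ a, q a * InformationTheory.klFun (p a / q a)
      = p a * Real.log (p a / q a) + (q a - p a) := by
    intro a
    have := (hq a).ne'
    rw [InformationTheory.klFun]
    field_simp
    ring
  simp only [e, sum_add_distrib, sum_sub_distrib, stdSimplex.sum_eq_one, sub_self, add_zero, kl]

theorem kl_nonneg (hq : ∀ a, 0 < q a) : 0 ≤ kl p q := by
  rw [kl_eq_sum_klFun hq]
  exact sum_nonneg fun a _ => mul_nonneg (hq a).le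
    (InformationTheory.klFun_nonneg (div_nonneg (stdSimplex.zero_le p a) (hq a).le))

theorem eq_of_kl_le_zero (hq : ∀ a, 0 < q a) (h : kl p q ≤ 0) : p = q := by
  have h0 : ∀ a ∈ univ, 0 ≤ q a * InformationTheory.klFun (p a / q a) := fun a _ =>
    mul_nonneg (hq a).le
      (InformationTheory.klFun_nonneg (div_nonneg (stdSimplex.zero_le p a) (hq a).le))
  have h1 := le_antisymm h (kl_nonneg hq)
  rw [kl_eq_sum_klFun hq, sum_eq_zero_iff_of_nonneg h0] at h1
  ext a
  have h2 := (mul_eq_zero.1 (h1 a (mem_univ a))).resolve_left (hq a).ne'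
  rw [InformationTheory.klFun_eq_zero_iff (div_nonneg (stdSimplex.zero_le p a) (hq a).le)] at h2
  exact (div_eq_one_iff_eq (hq a).ne').1 h2

theorem kl_self (hq : ∀ a, 0 < q a) : kl q q = 0 := by
  simp [kl, div_self (hq _).ne']

theorem kl_sub_kl {p' : stdSimplex ℝ A} (hp : ∀ a, 0 < p a) (hp' : ∀ a, 0 < p' a) :
    kl q p - kl q p' = ∑ a, q a * (Real.log (p' a) - Real.log (p a)) := by
  rw [kl, kl, ← sum_sub_distrib]
  refine sum_congr rfl fun a _ => ?_
  rcases eq_or_ne (q a) 0 with h | h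
  · simp [h]
  · rw [Real.log_div h (hp a).ne', Real.log_div h (hp' a).ne']
    ring

theorem nonempty_of_simplex (p : stdSimplex ℝ A) : Nonempty A := by
  by_contra h
  rw [not_nonempty_iff] at h
  have := stdSimplex.sum_eq_one p
  simp at this

/-- The Gibbs variational principle: the objective equals the divergence from the exponentially
reweighted distribution `σ` minus the constant `log Z`, so `σ` is the only minimizer and the chosen
one must be `σ`. -/
theorem proxPolicy_spec {π : Policy S A} (hπ : ∀ s a, 0 < π s a) (Q : S × A → ℝ) (s : S) :
    0 < ∑ a, π s a * Real.exp (-(lam * Q (s, a))) ∧ ∀ a, proxPolicy lam Q π s a =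
      π s a * Real.exp (-(lam * Q (s, a))) / ∑ a', π s a' * Real.exp (-(lam * Q (s, a'))) := by
  have hA := nonempty_of_simplex (π s)
  set w : A → ℝ := fun a => π s a * Real.exp (-(lam * Q (s, a))) with hw
  have hw0 : ∀ a, 0 < w a := fun a => mul_pos (hπ s a) (Real.exp_pos _)
  have hZ : 0 < ∑ a, w a := sum_pos (fun a _ => hw0 a) univ_nonempty
  refine ⟨hZ, ?_⟩
  let σ : stdSimplex ℝ A := ⟨fun a => w a / ∑ a', w a', fun a => (div_pos (hw0 a) hZ).le, by
    rw [← sum_div, div_self hZ.ne']⟩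
  have hσ : ∀ a, σ a = w a / ∑ a', w a' := fun a => rfl
  have hσ0 : ∀ a, 0 < σ a := fun a => div_pos (hw0 a) hZ
  have hobj : ∀ q : stdSimplex ℝ A, lam * ∑ a, Q (s, a) * q a + kl q (π s) =
      kl q σ - Real.log (∑ a, w a) := by
    intro q
    have h1 := kl_sub_kl (q := q) (hπ s) hσ0
    have h2 : ∑ a, q a * (Real.log (σ a) - Real.log (π s a)) =
        -(lam * ∑ a, Q (s, a) * q a) - Real.log (∑ a, w a) := by
      have e : ∀ a, q a * (Real.log (σ a) - Real.log (π s a)) =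
          -(lam * (Q (s, a) * q a)) - q a * Real.log (∑ a, w a) := by
        intro a
        rw [hσ, Real.log_div (hw0 a).ne' hZ.ne', hw,
          Real.log_mul (hπ s a).ne' (Real.exp_pos _).ne', Real.log_exp]
        ring
      simp only [e, sum_sub_distrib, sum_neg_distrib, ← mul_sum, ← sum_mul,
        stdSimplex.sum_eq_one, one_mul]
    linarith
  have hex : ∃ p : stdSimplex ℝ A, ∀ q : stdSimplex ℝ A,
      lam * ∑ a, Q (s, a) * p a + kl p (π s) ≤ lam * ∑ a, Q (s, a) * q a + kl q (π s) := by
    refine ⟨σ, fun q => ?_⟩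
    rw [hobj, hobj, kl_self hσ0]
    have := kl_nonneg (p := q) hσ0
    linarith
  have hσe : proxPolicy lam Q π s = σ := by
    rw [proxPolicy, dif_pos hex]
    have h1 := hex.choose_spec σ
    rw [hobj, hobj, kl_self hσ0] at h1
    exact eq_of_kl_le_zero hσ0 (by linarith)
  intro a
  rw [hσe, hσ]

theorem proxPolicy_pos {π : Policy S A} (hπ : ∀ s a, 0 < π s a) (Q : S × A → ℝ) (s : S) (a : A) :
    0 < proxPolicy lam Q π s a := by
  obtain ⟨hZ, h⟩ := proxPolicy_spec (lam := lam) hπ Q s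
  rw [h]
  exact div_pos (mul_pos (hπ s a) (Real.exp_pos _)) hZ

/-- The one-step inequality of mirror descent. -/
theorem proxPolicy_le {π : Policy S A} (hπ : ∀ s a, 0 < π s a) (Q : S × A → ℝ) (s : S)
    (q : stdSimplex ℝ A) :
    lam * ∑ a, Q (s, a) * (π s a - q a) ≤
      kl q (π s) - kl q (proxPolicy lam Q π s) + 4 * lam ^ 2 * spanNorm Q ^ 2 := by
  obtain ⟨hZ, h⟩ := proxPolicy_spec (lam := lam) hπ Q s
  set Z := ∑ a, π s a * Real.exp (-(lam * Q (s, a))) with hZd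
  rw [kl_sub_kl (hπ s) fun a => proxPolicy_pos hπ Q s a]
  have e1 : ∑ a, q a * (Real.log (proxPolicy lam Q π s a) - Real.log (π s a)) =
      -(lam * ∑ a, Q (s, a) * q a) - Real.log Z := by
    have e : ∀ a, q a * (Real.log (proxPolicy lam Q π s a) - Real.log (π s a)) =
        -(lam * (Q (s, a) * q a)) - q a * Real.log Z := by
      intro a
      rw [h, Real.log_div (mul_pos (hπ s a) (Real.exp_pos _)).ne' hZ.ne',
        Real.log_mul (hπ s a).ne' (Real.exp_pos _).ne', Real.log_exp]
      ring
    simp only [e, sum_sub_distrib, sum_neg_distrib, ← mul_sum, ← sum_mul,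
      stdSimplex.sum_eq_one, one_mul]
  rw [e1]
  set m := ∑ a, Q (s, a) * π s a with hm
  have e2 : ∑ a, Q (s, a) * (π s a - q a) = m - ∑ a, Q (s, a) * q a := by
    rw [hm, ← sum_sub_distrib]; exact sum_congr rfl fun a _ => by ring
  rw [e2]
  -- Hoeffding's lemma
  have h1 : Z ≤ Real.exp (-(lam * m) + 4 * lam ^ 2 * spanNorm Q ^ 2) := by
    have f1 : ∀ a, π s a * Real.exp (-(lam * Q (s, a))) ≤ Real.exp (-(lam * m)) *
        (π s a * (-(lam * (Q (s, a) - m))) +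
          π s a * Real.exp (4 * lam ^ 2 * spanNorm Q ^ 2)) := by
      intro a
      have g1 : -(lam * Q (s, a)) = -(lam * m) + -(lam * (Q (s, a) - m)) := by ring
      rw [g1, Real.exp_add]
      have g2 := exp_le_add_exp_sq (-(lam * (Q (s, a) - m)))
      have g3 : Real.exp ((-(lam * (Q (s, a) - m))) ^ 2) ≤
          Real.exp (4 * lam ^ 2 * spanNorm Q ^ 2) := by
        rw [Real.exp_le_exp]
        have := sq_le_sq' (neg_le_of_abs_le (abs_sub_mean_le Q s a (π s)))
          (le_of_abs_le (abs_sub_mean_le Q s a (π s)))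
        rw [← hm] at this
        have := mul_le_mul_of_nonneg_left this (sq_nonneg lam)
        linarith
      have g4 := mul_le_mul_of_nonneg_left (g2.trans (add_le_add_right g3 _))
        (mul_pos (hπ s a) (Real.exp_pos (-(lam * m)))).le
      linarith
    refine (sum_le_sum fun a _ => f1 a).trans (le_of_eq ?_)
    rw [← mul_sum, sum_add_distrib, ← sum_mul, stdSimplex.sum_eq_one, Real.exp_add]
    have f2 : ∑ a, π s a * (-(lam * (Q (s, a) - m))) = 0 := by
      have : ∀ a, π s a * (-(lam * (Q (s, a) - m))) =
        lam * m * π s a - lam * (Q (s, a) * π s a) := fun a => by ring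
      simp only [this, sum_sub_distrib, ← mul_sum, stdSimplex.sum_eq_one, ← hm]
      ring
    rw [f2]; ring
  have h2 := (Real.log_le_iff_le_exp hZ).2 h1
  linarith

theorem kl_uniform_le [Nonempty A] (q : stdSimplex ℝ A) (s : S) :
    kl q ((uniformPolicy : Policy S A) s) ≤ Real.log (Fintype.card A) := by
  have hc : (0 : ℝ) < Fintype.card A := by exact_mod_cast Fintype.card_pos
  have e : ∀ a, q a * Real.log (q a / ((uniformPolicy : Policy S A) s) a) ≤
      q a * Real.log (Fintype.card A) := by
    intro a
    have h0 := stdSimplex.zero_le q a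
    rcases h0.eq_or_lt with h | h
    · simp [← h]
    · refine mul_le_mul_of_nonneg_left (Real.log_le_log ?_ ?_) h0
      · exact div_pos h (inv_pos.2 hc)
      · change q a / (Fintype.card A : ℝ)⁻¹ ≤ _
        rw [div_inv_eq_mul]
        exact mul_le_of_le_one_left hc.le (stdSimplex.le_one q a)
  refine (sum_le_sum fun a _ => e a).trans ?_
  rw [← sum_mul, stdSimplex.sum_eq_one, one_mul]

end Prox

/-! ### Stochastic policy mirror descent -/

section Output

variable {B : Type}

theorem expect_uniformOfFinset {s : Finset B} (hs : s.Nonempty) (f : B → ℝ) :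
    expect (PMF.uniformOfFinset s hs) f = (s.card : ℝ)⁻¹ * ∑ b ∈ s, f b := by
  rw [expect_eq_sum_of_subset _ _ s fun b hb => PMF.uniformOfFinset_apply_of_notMem hs hb, mul_sum]
  refine sum_congr rfl fun b hb => ?_
  rw [PMF.uniformOfFinset_apply_of_mem hs hb, ENNReal.toReal_inv, ENNReal.toReal_natCast]

instance finSupp_uniformOfFinset {s : Finset B} (hs : s.Nonempty) :
    FinSupp (PMF.uniformOfFinset s hs) :=
  ⟨by rw [PMF.support_uniformOfFinset]; exact s.finite_toSet⟩

end Output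

section Actor

variable [Nonempty S] [Nonempty A] {M : Model S A} {Ψ : Matrix (S × A) (Fin d) ℝ}
  {u : Policy S A → ℝ} {prm : Params} {lam : ℝ} {s₀ : S} {cbar CP ϱ κ e : ℝ}

theorem expect_spmdOutput {K : ℕ} (hK : 0 < K) (f : Policy S A → ℝ) :
    expect (spmdOutput M Ψ u prm lam s₀ K hK) f =
      (K : ℝ)⁻¹ * ∑ k ∈ range K, expect (spmd M Ψ u prm lam s₀ k) fun z => f z.policy := by
  rw [spmdOutput, expect_bind, expect_uniformOfFinset, card_range]
  simp only [expect_map]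

theorem spmd_pos {k : ℕ} {z : Iterate S A} (hz : z ∈ (spmd M Ψ u prm lam s₀ k).support) (s : S)
    (a : A) : 0 < z.policy s a := by
  induction k generalizing z s a with
  | zero =>
    simp only [spmd, PMF.support_pure, Set.mem_singleton_iff] at hz
    rw [hz]
    exact inv_pos.2 (by exact_mod_cast Fintype.card_pos)
  | succ k ih =>
    simp only [spmd, PMF.mem_support_bind_iff, PMF.mem_support_map_iff] at hz
    obtain ⟨y, hy, r, -, rfl⟩ := hz
    exact proxPolicy_pos (fun s a => ih hy s a) _ s a

/-- The potential of mirror descent. -/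
def klAvg (M : Model S A) (π π' : Policy S A) : ℝ := ∑ s, stationary M π s * kl (π s) (π' s)

theorem klAvg_nonneg (π : Policy S A) {π' : Policy S A} (hπ' : ∀ s a, 0 < π' s a) :
    0 ≤ klAvg M π π' :=
  sum_nonneg fun s _ => mul_nonneg (stationary_nonneg M π s) (kl_nonneg (hπ' s))

theorem klAvg_uniform_le (π : Policy S A) :
    klAvg M π uniformPolicy ≤ Real.log (Fintype.card A) := by
  refine (sum_le_sum fun s _ => mul_le_mul_of_nonneg_left (kl_uniform_le (π s) s)
    (stationary_nonneg M π s)).trans ?_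
  rw [← sum_mul, sum_stationary, one_mul]

/-- The weights are the stationary distribution of the comparator `π`, the same in all iterations,
so that the potential telescopes. They are also the weights in the performance difference of `π` and
the current policy. The critic enters the linear term by its conditional mean alone; its fluctuation
meets `lam ^ 2`. -/
theorem spmd_step_le (hc : ∀ s a, |M.cost s a| ≤ cbar) (hm : IsMixingRate M CP ϱ)
    (hlam : 0 ≤ lam)
    (hbias : ∀ (π : Policy S A) (s : S), spanNorm (fun x =>
      expect (critic M Ψ (u π) prm π s 0) (fun r => r.1 x) - diffQ M π x) ≤ e)
    (π : Policy S A) {z : Iterate S A} (hz : ∀ s a, 0 < z.policy s a)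
    (hκ : criticSecondMoment M Ψ (u z.policy) prm z.policy z.state ≤ κ ^ 2) :
    lam * (avgCost M z.policy - avgCost M π) ≤ klAvg M π z.policy -
      expect (critic M Ψ (u z.policy) prm z.policy z.state z.samples)
        (fun r => klAvg M π (proxPolicy lam r.1 z.policy)) +
      (4 * lam ^ 2 * κ ^ 2 + 2 * lam * e) := by
  set p := z.policy
  set P := critic M Ψ (u p) prm p z.state z.samples with hP
  set E : S × A → ℝ := fun x => expect P fun r => r.1 x with hE
  have hE' : ∀ x, E x = expect (critic M Ψ (u p) prm p z.state 0) fun r => r.1 x := fun x =>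
    expect_critic_samples M Ψ p (u p) prm z.state z.samples fun Q => Q x
  have hκ' : expect P (fun r => spanNorm r.1 ^ 2) ≤ κ ^ 2 :=
    (expect_critic_samples M Ψ p (u p) prm z.state z.samples fun Q => spanNorm Q ^ 2).trans_le hκ
  have h1 : ∀ r : (S × A → ℝ) × Traj S A,
      ∑ s, stationary M π s * (lam * ∑ a, r.1 (s, a) * (p s a - π s a)) ≤
      klAvg M π p - klAvg M π (proxPolicy lam r.1 p) + 4 * lam ^ 2 * spanNorm r.1 ^ 2 := by
    intro r
    refine (sum_le_sum fun s _ => mul_le_mul_of_nonneg_left (proxPolicy_le hz r.1 s (π s))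
      (stationary_nonneg M π s)).trans (le_of_eq ?_)
    simp only [mul_add, mul_sub, sum_add_distrib, sum_sub_distrib, ← sum_mul, sum_stationary,
      klAvg, one_mul]
  have h2 := expect_mono P h1
  rw [expect_add, expect_sub, expect_const, expect_const_mul] at h2
  have h3 : expect P (fun r =>
      ∑ s, stationary M π s * (lam * ∑ a, r.1 (s, a) * (p s a - π s a))) =
      lam * ∑ s, stationary M π s * ∑ a, E (s, a) * (p s a - π s a) := by
    simp only [expect_sum, expect_const_mul, expect_mul_const, hE, mul_sum]
    refine sum_congr rfl fun s _ => sum_congr rfl fun a _ => by ring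
  rw [h3] at h2
  have h4 : ∀ s, -(2 * e) + ∑ a, diffQ M p (s, a) * (p s a - π s a) ≤
      ∑ a, E (s, a) * (p s a - π s a) := by
    intro s
    have f1 := neg_le_of_abs_le (abs_sum_mul_sub_le (fun x => E x - diffQ M p x) s (p s) (π s))
    have f2 := hbias p z.state
    simp only [← hE'] at f2
    simp only [sub_mul, sum_sub_distrib] at f1
    linarith
  have h5 : -(2 * e) + (avgCost M p - avgCost M π) ≤
      ∑ s, stationary M π s * ∑ a, E (s, a) * (p s a - π s a) := by
    refine le_trans (le_of_eq ?_) (sum_le_sum fun s _ =>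
      mul_le_mul_of_nonneg_left (h4 s) (stationary_nonneg M π s))
    have f1 := avgCost_sub_avgCost (π := p) hc hm π
    have f2 : ∀ s, ∑ a, diffQ M p (s, a) * (p s a - π s a) =
        -∑ a, diffQ M p (s, a) * (π s a - p s a) := by
      intro s
      rw [← sum_neg_distrib]
      exact sum_congr rfl fun a _ => by ring
    simp only [f2, mul_add, mul_neg, sum_add_distrib, sum_neg_distrib, ← f1]
    rw [← sum_mul, sum_stationary]
    ring
  have h6 := mul_le_mul_of_nonneg_left h5 hlam
  have h7 := mul_le_mul_of_nonneg_left hκ' (show 0 ≤ 4 * lam ^ 2 by positivity)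
  linarith

theorem spmd_sum_le (hc : ∀ s a, |M.cost s a| ≤ cbar) (hm : IsMixingRate M CP ϱ)
    (hlam : 0 ≤ lam)
    (hbias : ∀ (π : Policy S A) (s : S), spanNorm (fun x =>
      expect (critic M Ψ (u π) prm π s 0) (fun r => r.1 x) - diffQ M π x) ≤ e)
    (π : Policy S A) (n : ℕ)
    (hκ : ∀ k < n, ∀ z ∈ (spmd M Ψ u prm lam s₀ k).support,
      criticSecondMoment M Ψ (u z.policy) prm z.policy z.state ≤ κ ^ 2) :
    lam * ∑ k ∈ range n,
      (expect (spmd M Ψ u prm lam s₀ k) (fun z => avgCost M z.policy) - avgCost M π) ≤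
      Real.log (Fintype.card A) - expect (spmd M Ψ u prm lam s₀ n) (fun z => klAvg M π z.policy) +
      n * (4 * lam ^ 2 * κ ^ 2 + 2 * lam * e) := by
  induction n with
  | zero =>
    have := klAvg_uniform_le (M := M) π
    simp only [range_zero, sum_empty, spmd, expect_pure, Nat.cast_zero]
    linarith
  | succ n ih =>
    have h1 := ih fun k hk => hκ k (by omega)
    have h2 := expect_mono_support (spmd M Ψ u prm lam s₀ n) fun z hz =>
      spmd_step_le hc hm hlam hbias π (fun s a => spmd_pos hz s a) (hκ n (by omega) z hz)
    rw [expect_const_mul, expect_sub, expect_const, expect_add, expect_sub, expect_const] at h2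
    have h3 : expect (spmd M Ψ u prm lam s₀ (n + 1)) (fun z => klAvg M π z.policy) =
        expect (spmd M Ψ u prm lam s₀ n) fun z =>
          expect (critic M Ψ (u z.policy) prm z.policy z.state z.samples)
            fun r => klAvg M π (proxPolicy lam r.1 z.policy) := by
      rw [spmd, expect_bind]
      simp only [expect_map]
    rw [h3, sum_range_succ, mul_add]
    push_cast
    linarith

theorem policy_eq_of_card_eq_one (hA : Fintype.card A = 1) (π π' : Policy S A) : π = π' := by
  obtain ⟨a₀, ha⟩ := Fintype.card_eq_one_iff.1 hA
  have : ∀ p : stdSimplex ℝ A, ∀ a, p a = 1 := fun p a => by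
    have h1 := stdSimplex.sum_eq_one p
    rw [sum_eq_single a (fun b _ hb => absurd ((ha b).trans (ha a).symm) hb) (by simp)] at h1
    exact h1
  funext s
  ext a
  rw [this, this]

/-- The optimality gap of stochastic policy mirror descent. -/
theorem spmdOutput_le (hc : ∀ s a, |M.cost s a| ≤ cbar) (hm : IsMixingRate M CP ϱ)
    (he : 0 ≤ e)
    (hbias : ∀ (π : Policy S A) (s : S), spanNorm (fun x =>
      expect (critic M Ψ (u π) prm π s 0) (fun r => r.1 x) - diffQ M π x) ≤ e)
    (hκ0 : 0 < κ) {ε : ℝ} (hε : 0 < ε) {K : ℕ} (hK : 0 < K)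
    (hKge : 196 * (κ ^ 2 * Real.log (Fintype.card A) / ε ^ 2) ≤ K)
    (hκ : ∀ k < K, ∀ z ∈ (spmd M Ψ u prm (stepSize A κ K) s₀ k).support,
      criticSecondMoment M Ψ (u z.policy) prm z.policy z.state ≤ κ ^ 2) (π : Policy S A) :
    expect (spmdOutput M Ψ u prm (stepSize A κ K) s₀ K hK) (avgCost M) - avgCost M π ≤
      2 * e + ε / 2 := by
  have hK' : (0 : ℝ) < K := by exact_mod_cast hK
  rw [expect_spmdOutput]
  rcases Nat.lt_or_ge 1 (Fintype.card A) with hA | hA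
  · set L := Real.log (Fintype.card A) with hL
    have hL0 : 0 < L := Real.log_pos (by exact_mod_cast hA)
    set lam := stepSize A κ K with hlam
    have hlam0 : 0 < lam := by
      rw [hlam, stepSize, ← hL]
      have := Real.sqrt_pos.2 hK'
      have := Real.sqrt_pos.2 (show 0 < 2 * L by linarith)
      positivity
    have hlamsq : lam ^ 2 = 2 * L / (κ ^ 2 * K) := by
      rw [hlam, stepSize, div_pow, mul_pow, Real.sq_sqrt (by positivity), Real.sq_sqrt hK'.le]
    have key := spmd_sum_le (s₀ := s₀) hc hm hlam0.le hbias π K hκ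
    have hΦ : 0 ≤ expect (spmd M Ψ u prm lam s₀ K) (fun z => klAvg M π z.policy) := by
      have := expect_mono_support (spmd M Ψ u prm lam s₀ K) (f := fun _ => 0)
        (g := fun z => klAvg M π z.policy) fun z hz => klAvg_nonneg π fun s a => spmd_pos hz s a
      rwa [expect_const] at this
    rw [sum_sub_distrib, sum_const, card_range, nsmul_eq_mul, ← hL] at key
    set X := ∑ k ∈ range K, expect (spmd M Ψ u prm lam s₀ k) (fun z => avgCost M z.policy)
    -- The step size gives `lam ^ 2 * κ ^ 2 * K = 2 * L`. With the initial entropy `L` the total is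
    -- `9 * L`; its square `81 * L ^ 2` is covered by `98 * L ^ 2`, which is where 196 comes from.
    have h1 : K * (4 * lam ^ 2 * κ ^ 2) = 8 * L := by
      rw [hlamsq]; field_simp; ring
    have h2 : 9 * L ≤ lam * K * (ε / 2) := by
      refine le_of_abs_le (abs_le_of_sq_le_sq ?_ (by positivity))
      have e1 : (lam * K * (ε / 2)) ^ 2 = L * (K * ε ^ 2 / κ ^ 2) / 2 := by
        rw [mul_pow, mul_pow, hlamsq]; field_simp
      have e2 : 196 * L ≤ K * ε ^ 2 / κ ^ 2 := by
        rw [← mul_div_assoc, div_le_iff₀ (by positivity)] at hKge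
        rw [le_div_iff₀ (by positivity)]
        linarith
      have := mul_le_mul_of_nonneg_left e2 hL0.le
      rw [e1]
      nlinarith
    have h3 : lam * (X - K * avgCost M π) ≤ lam * (K * (2 * e + ε / 2)) := by
      linarith
    have h4 := le_of_mul_le_mul_left h3 hlam0
    rw [inv_mul_eq_div, sub_le_iff_le_add, div_le_iff₀ hK']
    linarith
  -- With a single action the step size is zero and cannot be divided by, but then there is only one
  -- policy.
  · have hA1 : Fintype.card A = 1 := le_antisymm hA Fintype.card_pos
    have h1 : ∀ z : Iterate S A, avgCost M z.policy = avgCost M π := fun z => by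
      rw [policy_eq_of_card_eq_one hA1 z.policy π]
    simp only [h1, expect_const, sum_const, card_range, nsmul_eq_mul]
    rw [inv_mul_cancel_left₀ hK'.ne', sub_self]
    positivity

end Actor

/-! ### Spectral norms -/

section Norms

open scoped Matrix.Norms.L2Operator

variable {ι κ : Type} [Fintype ι] [Fintype κ] [DecidableEq κ]

theorem l2_opNorm_le {B : Matrix ι κ ℝ} {c : ℝ} (hc : 0 ≤ c)
    (h : ∀ (x : EuclideanSpace ℝ κ) i, |(B *ᵥ x.ofLp) i| ≤ c * ‖x‖) :
    ‖B‖ ≤ √(Fintype.card ι) * c := by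
  rw [l2_opNorm_def]
  refine ContinuousLinearMap.opNorm_le_bound _ (by positivity) fun x => ?_
  change ‖(WithLp.toLp 2 (B *ᵥ x.ofLp) : EuclideanSpace ℝ ι)‖ ≤ _
  rw [EuclideanSpace.norm_eq, mul_assoc]
  refine (Real.sqrt_le_sqrt (sum_le_sum (g := fun _ => (c * ‖x‖) ^ 2) fun i _ =>
    pow_le_pow_left₀ (norm_nonneg _) (h x i) 2)).trans ?_
  rw [sum_const, card_univ, nsmul_eq_mul, Real.sqrt_mul (by positivity),
    Real.sqrt_sq (by positivity)]

theorem l2_opNorm_le_of_feature_le {Ψ : Matrix ι (Fin d) ℝ} (h : ∀ x, Ψ x ⬝ᵥ Ψ x ≤ 1) :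
    ‖Ψ‖ ≤ √(Fintype.card ι) := by
  have := l2_opNorm_le (B := Ψ) zero_le_one fun v i => by
    refine (abs_dotProduct_le (Ψ i) v.ofLp).trans ?_
    have h1 := h i
    rw [← nrm_sq] at h1
    have h2 : nrm (Ψ i) ≤ 1 := by nlinarith [nrm_nonneg (Ψ i)]
    exact mul_le_mul_of_nonneg_right h2 (nrm_nonneg _)
  rwa [mul_one] at this

theorem l2_opNorm_one_sub_le [DecidableEq ι] {P : Matrix ι ι ℝ} (h : P ∈ rowStochastic ℝ ι) :
    ‖1 - P‖ ≤ √(Fintype.card ι) * 2 := by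
  refine l2_opNorm_le zero_le_two fun v i => ?_
  rw [sub_mulVec, one_mulVec, Pi.sub_apply]
  have h1 : ∀ j, |v.ofLp j| ≤ ‖v‖ := fun j => PiLp.norm_apply_le v j
  have h2 : |(P *ᵥ v.ofLp) i| ≤ ‖v‖ := by
    refine (abs_sum_le_sum_abs _ _).trans ?_
    calc ∑ j, |P i j * v.ofLp j| ≤ ∑ j, P i j * ‖v‖ := by
          refine sum_le_sum fun j _ => ?_
          rw [abs_mul, abs_of_nonneg (h.1 i j)]
          exact mul_le_mul_of_nonneg_left (h1 j) (h.1 i j)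
      _ = ‖v‖ := by rw [← sum_mul, sum_row_of_mem_rowStochastic h, one_mul]
  have h3 := abs_sub (v.ofLp i) ((P *ᵥ v.ofLp) i)
  have := h1 i
  linarith

end Norms

/-! ### The critic -/

theorem IsModulus.mono {M : Model S A} [Nonempty S] {Ψ : Matrix (S × A) (Fin d) ℝ}
    {π π' : Policy S A} {b b' : ℝ}
    (h : IsModulus M Ψ π π' b) (hb : 0 < b') (hle : b' ≤ b) : IsModulus M Ψ π π' b' := by
  refine ⟨hb, fun θ => le_trans (mul_le_mul_of_nonneg_right hle ?_) (h.2 θ)⟩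
  rw [normSq_eq]
  exact sum_nonneg fun x _ => mul_nonneg (weight_nonneg M π π' x) (sq_nonneg _)

namespace CriticSetting

variable [Nonempty S] {M : Model S A} {Ψ : Matrix (S × A) (Fin d) ℝ} {u : ℝ} {π : Policy S A}
  {b μ cbar δ : ℝ} {n : ℕ} (h : CriticSetting M Ψ π (perturb u π) b μ cbar δ n)
  {prm : Params} (hp : GoodParams b μ δ n prm)

include h in
theorem projectedBellman_thetaStar :
    ProjectedBellman M Ψ π (perturb u π) (thetaStar M Ψ u π) := by
  have hex : ∃ θ, ProjectedBellman M Ψ π (perturb u π) θ := by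
    simp only [projectedBellman_iff]
    exact h.exists_projOp_eq _
  rw [thetaStar, dif_pos hex]
  exact hex.choose_spec

include h in
theorem nrm_thetaStar_le : nrm (thetaStar M Ψ u π) ≤ 2 * cbar / (μ * b) := by
  have hμ := h.mu_pos
  have hb := h.b_pos
  rw [le_div_iff₀ (by positivity), mul_comm]
  refine (h.mu_b_mul_nrm_le _).trans ?_
  rw [(projectedBellman_iff M Ψ π (perturb u π) _).1 h.projectedBellman_thetaStar, ← vmean_cost]
  refine (nrm_vmean_le _ _).trans (expect_le_const _ fun ξ => ?_)
  rw [nrm_smul]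
  have h1 := h.cost_le ξ.cur
  have h2 : |avgCost M π| ≤ cbar := abs_avgCost_le fun s a => h.cost_le (s, a)
  have h3 := abs_sub (costVec M ξ.cur) (avgCost M π)
  exact (mul_le_of_le_one_right (abs_nonneg _) (h.nrm_feature_le _)).trans (by linarith)

include h in
theorem abs_mulVec_le (v : Fin d → ℝ) (x : S × A) : |(Ψ *ᵥ v) x| ≤ nrm v :=
  abs_le_of_sq_le_sq (h.mulVec_sq_le v x) (nrm_nonneg v)

include h in
theorem norm_mulVec_le (v : Fin d → ℝ) : ‖Ψ *ᵥ v‖ ≤ nrm v :=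
  (pi_norm_le_iff_of_nonneg (nrm_nonneg v)).2 fun x => h.abs_mulVec_le v x

theorem norm_mulVec_sq_le {ω : ℝ} (hω : 0 < ω) (hle : ∀ x, ω ≤ weight M π (perturb u π) x)
    (v : Fin d → ℝ) : ‖Ψ *ᵥ v‖ ^ 2 ≤ normSq M Ψ π (perturb u π) v / ω := by
  have h0 : 0 ≤ normSq M Ψ π (perturb u π) v / ω := by
    rw [normSq_eq]
    exact div_nonneg (sum_nonneg fun x _ => mul_nonneg (weight_nonneg M π _ x) (sq_nonneg _)) hω.le
  have h1 : ‖Ψ *ᵥ v‖ ≤ √(normSq M Ψ π (perturb u π) v / ω) := by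
    refine (pi_norm_le_iff_of_nonneg (Real.sqrt_nonneg _)).2 fun x => Real.abs_le_sqrt ?_
    rw [le_div_iff₀ hω, normSq_eq, mul_comm]
    refine (mul_le_mul_of_nonneg_right (hle x) (sq_nonneg _)).trans ?_
    exact single_le_sum (f := fun x => weight M π (perturb u π) x * (Ψ *ᵥ v) x ^ 2)
      (fun x _ => mul_nonneg (weight_nonneg M π _ x) (sq_nonneg _)) (mem_univ x)
  exact (pow_le_pow_left₀ (norm_nonneg _) h1 2).trans (Real.sq_sqrt h0).le

include h hp in
/-- The second moment of the estimate of the critic. -/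
theorem criticSecondMoment_le {ω : ℝ} (hω : 0 < ω)
    (hle : ∀ x, ω ≤ weight M π (perturb u π) x) (s : S) :
    criticSecondMoment M Ψ u prm π s ≤ 2 * ‖Ψ *ᵥ thetaStar M Ψ u π‖ ^ 2 +
      2 * ((cbar ^ 2 + thetaStar M Ψ u π ⬝ᵥ thetaStar M Ψ u π) / ω) := by
  set θs := thetaStar M Ψ u π
  have h1 : ∀ θ : Fin d → ℝ, spanNorm (Ψ *ᵥ θ) ^ 2 ≤
      2 * ‖Ψ *ᵥ θs‖ ^ 2 + 2 / ω * normSq M Ψ π (perturb u π) (θ - θs) := by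
    intro θ
    have e1 := pow_le_pow_left₀ (spanNorm_nonneg _) (spanNorm_le_norm (Ψ *ᵥ θ)) 2
    have e2 : ‖Ψ *ᵥ θ‖ ≤ ‖Ψ *ᵥ θs‖ + ‖Ψ *ᵥ (θ - θs)‖ := by
      rw [mulVec_sub]
      simpa using norm_add_le (Ψ *ᵥ θs) (Ψ *ᵥ θ - Ψ *ᵥ θs)
    have e3 := norm_mulVec_sq_le (Ψ := Ψ) hω hle (θ - θs)
    have e4 := pow_le_pow_left₀ (norm_nonneg _) e2 2
    have e5 := sq_nonneg (‖Ψ *ᵥ θs‖ - ‖Ψ *ᵥ (θ - θs)‖)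
    have e6 : 2 / ω * normSq M Ψ π (perturb u π) (θ - θs) =
      2 * (normSq M Ψ π (perturb u π) (θ - θs) / ω) := by ring
    rw [e6]
    nlinarith
  have h2 : ∀ z : Traj S A, expect (runEpochs M Ψ π (perturb u π) prm prm.epochs 0 z)
      (fun r => spanNorm (Ψ *ᵥ r.1) ^ 2) ≤
      2 * ‖Ψ *ᵥ θs‖ ^ 2 + 2 / ω * (nrm θs ^ 2 + cbar ^ 2) := by
    intro z
    have e1 := expect_mono (runEpochs M Ψ π (perturb u π) prm prm.epochs 0 z)
      fun r : (Fin d → ℝ) × Traj S A => h1 r.1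
    rw [expect_add, expect_const, expect_const_mul] at e1
    have e2 := h.runEpochs_sq_le hp h.projectedBellman_thetaStar prm.epochs 0 z
    have e3 : normSq M Ψ π (perturb u π) (0 - θs) ≤ nrm θs ^ 2 := by
      rw [zero_sub, ← nrm_neg θs]; exact h.normSq_le _
    have e4 : (0 : ℝ) ≤ (1 / 2) ^ prm.epochs := by positivity
    have e5 := mul_le_mul_of_nonneg_left e3 e4
    have e6 : expect (runEpochs M Ψ π (perturb u π) prm prm.epochs 0 z)
        (fun r => normSq M Ψ π (perturb u π) (r.1 - θs)) ≤ nrm θs ^ 2 + cbar ^ 2 := by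
      refine e2.trans ?_
      nlinarith [sq_nonneg cbar]
    have e7 := mul_le_mul_of_nonneg_left e6 (show 0 ≤ 2 / ω by positivity)
    linarith
  rw [criticSecondMoment, critic, expect_bind]
  simp only [expect_map]
  refine (expect_le_const _ fun a => h2 _).trans (le_of_eq ?_)
  rw [nrm_sq]
  ring

include h hp in
theorem nrm_runEpochs_bias_le (hcbar : 0 ≤ cbar) {s : ℝ} (hs : 0 < s) (z : Traj S A) :
    nrm (vmean (runEpochs M Ψ π (perturb u π) prm prm.epochs 0 z) (fun r => r.1)
      - thetaStar M Ψ u π) ≤ (1 / 2) ^ prm.epochs * nrm (thetaStar M Ψ u π) +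
      δ * biasFactor b μ prm * ((2 * nrm (thetaStar M Ψ u π) ^ 2 +
        2 * prm.epochs * (nrm (thetaStar M Ψ u π) ^ 2 + cbar ^ 2 + s ^ 2)) / s) := by
  set θs := thetaStar M Ψ u π
  set R := averageMap M Ψ π (perturb u π) prm.η prm.T
  have hδ := h.delta_nonneg
  have hbf := biasFactor_nonneg (prm := prm) h.b_pos h.mu_pos hp.eta_pos
  have hpow : ∀ (k : ℕ) v, nrm ((R ^ k) v) ≤ (1 / 2) ^ k * nrm v := by
    intro k
    induction k with
    | zero => intro v; simp
    | succ k ih =>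
      intro v
      rw [pow_succ, Module.End.mul_apply]
      have h1 := h.nrm_averageMap_le hp.eta_pos hp.eta_le hp.T_ge v
      refine (ih _).trans ?_
      rw [pow_succ (1 / 2 : ℝ), mul_assoc]
      exact mul_le_mul_of_nonneg_left (by linarith) (by positivity)
  have h1 := h.runEpochs_mean hp h.projectedBellman_thetaStar hcbar hs prm.epochs 0 z
  have h2 := hpow prm.epochs (0 - θs)
  rw [zero_sub, nrm_neg] at h2
  have h3 : normSq M Ψ π (perturb u π) (0 - θs) ≤ nrm θs ^ 2 := by
    rw [zero_sub, ← nrm_neg θs]; exact h.normSq_le _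
  have h4 := nrm_add_le (vmean (runEpochs M Ψ π (perturb u π) prm prm.epochs 0 z) (fun r => r.1)
      - (θs + (R ^ prm.epochs) (0 - θs))) ((R ^ prm.epochs) (-θs))
  rw [zero_sub] at h4 h1 h3
  rw [← sub_sub, sub_add_cancel] at h4
  rw [← sub_sub] at h1
  refine h4.trans ?_
  rw [add_comm]
  refine add_le_add h2 (h1.trans (mul_le_mul_of_nonneg_left ?_ (mul_nonneg hδ hbf)))
  gcongr

include h in
/-- The bias of the estimate of the critic in the span seminorm. -/
theorem spanNorm_critic_sub_le {c : ℝ} (hc : ∀ z : Traj S A,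
    nrm (vmean (runEpochs M Ψ π (perturb u π) prm prm.epochs 0 z) (fun r => r.1)
      - thetaStar M Ψ u π) ≤ c) (s : S) :
    spanNorm (fun x => expect (critic M Ψ u prm π s 0) (fun r => r.1 x) - diffQ M π x) ≤
      c + spanNorm fun x => (Ψ *ᵥ thetaStar M Ψ u π) x - diffQ M π x := by
  set θs := thetaStar M Ψ u π
  set F : A → Fin d → ℝ := fun a =>
    vmean (runEpochs M Ψ π (perturb u π) prm prm.epochs 0 ⟨s, a, 0⟩) fun r => r.1 with hF
  set v := vmean (draw (π s)) F with hv
  have h1 : ∀ x, expect (critic M Ψ u prm π s 0) (fun r => r.1 x) = (Ψ *ᵥ v) x := by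
    intro x
    rw [critic, expect_bind]
    simp only [expect_map]
    change _ = Ψ x ⬝ᵥ v
    rw [hv, dotProduct_vmean]
    refine congrArg _ (funext fun a => ?_)
    rw [hF, dotProduct_vmean]
    rfl
  have h2 : nrm (v - θs) ≤ c := by
    have e : v - θs = vmean (draw (π s)) fun a => F a - θs := by rw [vmean_sub, vmean_const]
    rw [e]
    exact (nrm_vmean_le _ _).trans (expect_le_const _ fun a => hc _)
  have h3 := spanNorm_add_le (Ψ *ᵥ (v - θs)) fun x => (Ψ *ᵥ θs) x - diffQ M π x
  have h4 := (h.norm_mulVec_le (v - θs)).trans h2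
  have e : (fun x => expect (critic M Ψ u prm π s 0) (fun r => r.1 x) - diffQ M π x) =
      fun x => (Ψ *ᵥ (v - θs)) x + ((Ψ *ᵥ θs) x - diffQ M π x) := by
    funext x
    rw [h1, mulVec_sub, Pi.sub_apply]
    ring
  rw [e]
  linarith

end CriticSetting

/-! ### The parameter selection -/

/-- The factor 2 in the exponent is enough because `log 2 > 1/2`. -/
theorem half_pow_le {X : ℝ} (hX : 1 ≤ X) {m k : ℕ} (hk : 2 * m * Real.log X ≤ k) :
    (1 / 2 : ℝ) ^ k ≤ (X ^ m)⁻¹ := by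
  have hX0 : 0 < X := by linarith
  rw [one_div, inv_pow]
  refine inv_anti₀ (by positivity) ?_
  rw [← Real.log_le_log_iff (by positivity) (by positivity), Real.log_pow, Real.log_pow]
  have h1 := Real.log_two_gt_d9
  have h2 : (0 : ℝ) ≤ k := Nat.cast_nonneg k
  nlinarith

/-- Numerical constants are absorbed into powers of the scale, which is at least 2. -/
theorem mul_pow_le_pow {X a : ℝ} (hX : 2 ≤ X) {i : ℕ} (ha : a ≤ 2 ^ i) (j : ℕ) :
    a * X ^ j ≤ X ^ (i + j) := by
  rw [pow_add]
  have : (2 : ℝ) ^ i ≤ X ^ i := pow_le_pow_left₀ two_pos.le hX i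
  exact mul_le_mul_of_nonneg_right (ha.trans this) (by positivity)

/-- The parameters of the critic for the modulus `b`, with `k` epochs and `n` skipped steps. -/
def criticParams (b μ : ℝ) (k n : ℕ) : Params where
  epochs := k
  η := b / 10000
  T := ⌈64 / (μ * b * (b / 10000))⌉₊
  N := ⌈20000 / (μ * b ^ 2)⌉₊
  N' := ⌈20000 / (μ * b ^ 2)⌉₊
  τ := n + 1
  τ' := n + 1

/-- The scales of the problem: `X` bounds all relevant quantities up to the power `D`. -/
structure Scale (X b μ ℓ : ℝ) (D : ℕ) : Prop where
  two_le : 2 ≤ X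
  b_pos : 0 < b
  b_le : b ≤ 1
  mu_pos : 0 < μ
  mu_le : μ ≤ 1
  l_pos : 0 < ℓ
  inv_l_le : 1 / ℓ ≤ X
  inv_le : 1 / (μ * b) ≤ X ^ (D + 1)
  inv_sq_le : 1 / (μ * b ^ 2) ≤ X ^ (2 * (D + 1))

namespace Scale

variable {X b μ ℓ : ℝ} {D : ℕ} (h : Scale X b μ ℓ D) {k n : ℕ}
include h

theorem one_le : 1 ≤ X := by linarith [h.two_le]

theorem pos : 0 < X := by linarith [h.two_le]

theorem inv_b_le : 1 / b ≤ X ^ (D + 1) := by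
  refine le_trans ?_ h.inv_le
  have := h.b_pos
  have := h.mu_pos
  refine one_div_le_one_div_of_le (by positivity) ?_
  exact mul_le_of_le_one_left h.b_pos.le h.mu_le

theorem one_le_inv_sq : 1 ≤ 1 / (μ * b ^ 2) := by
  have := h.b_pos
  have := h.mu_pos
  rw [le_div_iff₀ (by positivity), one_mul]
  have : b ^ 2 ≤ 1 := pow_le_one₀ h.b_pos.le h.b_le
  nlinarith [h.mu_le]

theorem N_le : ((criticParams b μ k n).N : ℝ) ≤ 20001 * (1 / (μ * b ^ 2)) := by
  have h1 := h.one_le_inv_sq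
  have e : 20000 / (μ * b ^ 2) = 20000 * (1 / (μ * b ^ 2)) := by ring
  have h2 := Nat.ceil_lt_add_one (show 0 ≤ 20000 / (μ * b ^ 2) by rw [e]; linarith)
  change (⌈20000 / (μ * b ^ 2)⌉₊ : ℝ) ≤ _
  linarith

theorem T_le : ((criticParams b μ k n).T : ℝ) ≤ 640001 * (1 / (μ * b ^ 2)) := by
  have h1 := h.one_le_inv_sq
  have := h.b_pos
  have := h.mu_pos
  have e : 64 / (μ * b * (b / 10000)) = 640000 * (1 / (μ * b ^ 2)) := by
    field_simp
    norm_num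
  have h2 := Nat.ceil_lt_add_one (show 0 ≤ 64 / (μ * b * (b / 10000)) by rw [e]; linarith)
  change (⌈64 / (μ * b * (b / 10000))⌉₊ : ℝ) ≤ _
  linarith

theorem pow_inv_le_div {q i j : ℕ} {a y : ℝ} (ha : a ≤ 2 ^ i) (ha0 : 0 < a) (hy : 0 < y)
    (hyX : 1 / y ≤ X ^ j) (hq : i + j ≤ q) : (X ^ q)⁻¹ ≤ y / a := by
  have hX := h.pos
  rw [inv_le_comm₀ (by positivity) (by positivity), inv_div]
  calc a / y = a * (1 / y) := by ring
    _ ≤ a * X ^ j := mul_le_mul_of_nonneg_left hyX ha0.le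
    _ ≤ X ^ (i + j) := mul_pow_le_pow h.two_le ha j
    _ ≤ X ^ q := pow_le_pow_right₀ h.one_le hq

theorem goodParams {q : ℕ} (hq : 2 * D + 17 ≤ q) :
    GoodParams b μ (X ^ q)⁻¹ n (criticParams b μ k n) := by
  have hb := h.b_pos
  have hμ := h.mu_pos
  have hX := h.pos
  have hN0 : 20000 / (μ * b ^ 2) ≤ (criticParams b μ k n).N := Nat.le_ceil _
  have hN : (X ^ q)⁻¹ ≤ 1 / ((criticParams b μ k n).N : ℝ) := by
    have hpos : (0 : ℝ) < (criticParams b μ k n).N := lt_of_lt_of_le (by positivity) hN0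
    rw [one_div]
    refine inv_anti₀ hpos (h.N_le.trans ?_)
    calc 20001 * (1 / (μ * b ^ 2)) ≤ 20001 * X ^ (2 * (D + 1)) := by
          gcongr; exact h.inv_sq_le
      _ ≤ X ^ (15 + 2 * (D + 1)) := mul_pow_le_pow h.two_le (by norm_num) _
      _ ≤ X ^ q := pow_le_pow_right₀ h.one_le (by omega)
  exact ⟨by change 0 < b / 10000; positivity, le_rfl, Nat.le_ceil _, hN0, hN0, rfl, rfl, hN, hN⟩

theorem biasFactor_le : biasFactor b μ (criticParams b μ k n) ≤ 2 ^ 28 * X ^ (3 * (D + 1)) := by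
  have hb := h.b_pos
  have hμ := h.mu_pos
  have hT := h.T_le (k := k) (n := n)
  have h1 := h.one_le_inv_sq
  set Y := X ^ (D + 1) with hY
  have hY1 : 1 ≤ Y := one_le_pow₀ h.one_le
  have hinv := h.inv_le
  set T := ((criticParams b μ k n).T : ℝ) with hTd
  have hT0 : 0 ≤ T := Nat.cast_nonneg _
  have e1 : b / 10000 * T ≤ 65 * Y := by
    calc b / 10000 * T ≤ b / 10000 * (640001 * (1 / (μ * b ^ 2))) := by gcongr
      _ = 640001 / 10000 * (1 / (μ * b)) := by field_simp
      _ ≤ 65 * Y := by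
        have : 0 < 1 / (μ * b) := by positivity
        linarith
  have e2 : (T + 2) / μ ≤ 640003 * Y ^ 2 := by
    calc (T + 2) / μ ≤ (640003 * (1 / (μ * b ^ 2))) / μ := by gcongr; linarith
      _ = 640003 * (1 / (μ * b)) ^ 2 := by field_simp
      _ ≤ 640003 * Y ^ 2 := by gcongr
  have e3 : biasFactor b μ (criticParams b μ k n) =
      100 * (1 / (μ * b)) + 4 * ((b / 10000 * T) * ((T + 2) / μ)) := by
    rw [biasFactor]
    change 100 / (b * μ) + 4 * (b / 10000) * T * (T + 2) / μ = _
    field_simp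
  have e4 : (b / 10000 * T) * ((T + 2) / μ) ≤ 65 * Y * (640003 * Y ^ 2) := by gcongr
  have e5 : Y ≤ Y ^ 3 := le_self_pow₀ hY1 (by norm_num)
  have e6 : X ^ (3 * (D + 1)) = Y ^ 3 := by rw [hY, ← pow_mul]; ring_nf
  rw [e3, e6]
  have e7 : 65 * Y * (640003 * Y ^ 2) = 41600195 * Y ^ 3 := by ring
  have e8 : 0 ≤ Y ^ 3 := by positivity
  have e9 : (2 : ℝ) ^ 28 = 268435456 := by norm_num
  rw [e9]
  linarith

/-- The bias of the critic is small compared to `ε`. -/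
theorem bias_le {s ε cbar v : ℝ} (hε : 0 < ε) (hs : 0 < s) (hsX : s ≤ X * ε) (hc0 : 0 ≤ cbar)
    (hcs : cbar ≤ s) (hv0 : 0 ≤ v) (hv : v ≤ 2 * cbar / (μ * b))
    (hk : 2 * (D + 7) * Real.log X ≤ k) (hk' : (k : ℝ) ≤ 2 * (D + 7) * Real.log X + 1) :
    (1 / 2) ^ k * v + (X ^ (6 * D + 50))⁻¹ * biasFactor b μ (criticParams b μ k n) *
      ((2 * v ^ 2 + 2 * k * (v ^ 2 + cbar ^ 2 + s ^ 2)) / s) ≤ ε / 4 := by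
  have hX := h.pos
  have hb := h.b_pos
  have hμ := h.mu_pos
  set Y := X ^ (D + 1) with hY
  have hY1 : 1 ≤ Y := one_le_pow₀ h.one_le
  have hvY : v ≤ 2 * s * Y := by
    calc v ≤ 2 * cbar * (1 / (μ * b)) := hv.trans (le_of_eq (by ring))
      _ ≤ 2 * s * Y := by gcongr; exact h.inv_le
  have h1 : (1 / 2) ^ k * v ≤ ε / 8 := by
    -- Of these powers, `D + 1` cancel `Y` and one cancels `s ≤ X ε`; the remaining five make `2
    -- X⁻⁵` smaller than `1/8`.
    have e1 : (1 / 2 : ℝ) ^ k ≤ (X ^ (D + 7))⁻¹ := half_pow_le h.one_le (by push_cast; exact hk)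
    calc (1 / 2) ^ k * v ≤ (X ^ (D + 7))⁻¹ * (2 * (X * ε) * Y) := by
          gcongr
          exact hvY.trans (by gcongr)
      _ = 2 * (X ^ 5)⁻¹ * ε := by
          rw [hY, show D + 7 = 5 + (D + 1 + 1) by ring, pow_add X 5, pow_succ X (D + 1)]
          field_simp
      _ ≤ 2 * (1 / 16) * ε := by
          gcongr
          rw [inv_le_comm₀ (by positivity) (by norm_num)]
          have := pow_le_pow_left₀ two_pos.le h.two_le 5
          norm_num at this ⊢
          linarith
      _ = ε / 8 := by ring
  have hlog : Real.log X ≤ X := Real.log_le_self hX.le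
  have h2 : (2 * v ^ 2 + 2 * k * (v ^ 2 + cbar ^ 2 + s ^ 2)) / s ≤
      X ^ (D + 9) * (X * ε) * Y ^ 2 := by
    have e1 : v ^ 2 ≤ 4 * s ^ 2 * Y ^ 2 :=
      (pow_le_pow_left₀ hv0 hvY 2).trans (le_of_eq (by ring))
    have e2 : cbar ^ 2 ≤ s ^ 2 := pow_le_pow_left₀ hc0 hcs 2
    have e3 : s ^ 2 ≤ s ^ 2 * Y ^ 2 := le_mul_of_one_le_right (sq_nonneg s) (one_le_pow₀ hY1)
    have e4 : v ^ 2 + cbar ^ 2 + s ^ 2 ≤ 6 * s ^ 2 * Y ^ 2 := by linarith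
    have e5 : 12 * (k : ℝ) + 12 ≤ X ^ (D + 9) := by
      have f1 : (D : ℝ) < 2 ^ D := by exact_mod_cast Nat.lt_two_pow_self
      have f2 : 12 * (k : ℝ) + 12 ≤ (24 * D + 180) * X := by
        have : (D : ℝ) * Real.log X ≤ D * X := by gcongr
        have := h.two_le
        linarith
      have f3 : (24 * (D : ℝ) + 180) ≤ 2 ^ (D + 8) := by
        have : (1 : ℝ) ≤ 2 ^ D := one_le_pow₀ (by norm_num)
        rw [pow_add]
        linarith
      refine f2.trans ?_
      have := mul_pow_le_pow h.two_le f3 1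
      rwa [pow_one] at this
    rw [div_le_iff₀ hs]
    have hk0 : (0 : ℝ) ≤ k := Nat.cast_nonneg k
    calc 2 * v ^ 2 + 2 * k * (v ^ 2 + cbar ^ 2 + s ^ 2)
        ≤ 2 * (6 * s ^ 2 * Y ^ 2) + 2 * k * (6 * s ^ 2 * Y ^ 2) := by
          gcongr
          have := sq_nonneg cbar
          have := sq_nonneg s
          linarith
      _ = (12 * (k : ℝ) + 12) * s * Y ^ 2 * s := by ring
      _ ≤ X ^ (D + 9) * (X * ε) * Y ^ 2 * s := by gcongr
  have hbf := h.biasFactor_le (k := k) (n := n)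
  have h3 : 0 ≤ (2 * v ^ 2 + 2 * k * (v ^ 2 + cbar ^ 2 + s ^ 2)) / s := by positivity
  have h4 : (X ^ (6 * D + 50))⁻¹ * biasFactor b μ (criticParams b μ k n) *
      ((2 * v ^ 2 + 2 * k * (v ^ 2 + cbar ^ 2 + s ^ 2)) / s) ≤ ε / 8 := by
    calc _ ≤ (X ^ (6 * D + 50))⁻¹ * (X ^ 28 * X ^ (3 * (D + 1))) *
          (X ^ (D + 9) * (X * ε) * Y ^ 2) := by
          gcongr
          refine hbf.trans ?_
          gcongr
          exact h.two_le
      -- The factors `X ^ 28 * X ^ (3 (D + 1))`, `X ^ (D + 9)`, `X` and `Y ^ 2` use up `6 D + 43`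
      -- powers; seven are left for the constant `1/8`.
      _ = (X ^ 7)⁻¹ * ε := by
          rw [show 6 * D + 50 = 7 + (28 + 3 * (D + 1) + (D + 9) + 1 + (D + 1) * 2) by ring, hY,
            ← pow_mul, pow_add X 7, pow_add X (28 + 3 * (D + 1) + (D + 9) + 1),
            pow_add X (28 + 3 * (D + 1) + (D + 9)), pow_add X (28 + 3 * (D + 1)), pow_add X 28]
          field_simp
      _ ≤ 1 / 8 * ε := by
          gcongr
          rw [inv_le_comm₀ (by positivity) (by norm_num)]
          have := pow_le_pow_left₀ two_pos.le h.two_le 7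
          norm_num at this ⊢
          linarith
      _ = ε / 8 := by ring
  linarith

end Scale

/-- The modulus that is used in the parameter selection. -/
def selectedModulus (M : Model S A) (χ : ℝ) : ℝ := 1 / ((4 + 2 * χ) * mixingTime M)

/-! ### The assumptions on the model, the features and the exploration levels -/

/-- The assumptions on the process, the features and the exploration levels. -/
structure Setting (M : Model S A) (Ψ : Matrix (S × A) (Fin d) ℝ) (u : Policy S A → ℝ)
    (cbar μ ℓ χ : ℝ) : Prop where
  ergodic : IsErgodic M
  cost_le : ∀ s a, |M.cost s a| ≤ cbar
  dim_pos : 0 < d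
  feature_le : ∀ x, Ψ x ⬝ᵥ Ψ x ≤ 1
  chi_pos : 0 < χ
  modulus : ∀ π : Policy S A, IsModulus M Ψ π π (1 / (χ * mixingTime M))
  exploration : ∀ π : Policy S A, IsExploration M Ψ π (u π)
  mu_pos : 0 < μ
  gram : ∀ (π : Policy S A) (θ : Fin d → ℝ), μ * (θ ⬝ᵥ θ) ≤ normSq M Ψ π (perturb (u π) π) θ
  l_pos : 0 < ℓ
  l_le : ∀ (π : Policy S A) (x : S × A), ℓ ≤ weight M π (perturb (u π) π) x

namespace Setting

variable [Nonempty S] [Nonempty A] {M : Model S A} {Ψ : Matrix (S × A) (Fin d) ℝ}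
  {u : Policy S A → ℝ} {cbar μ ℓ χ : ℝ} (h : Setting M Ψ u cbar μ ℓ χ)
include h

/-- With mixing time zero the assumed modulus would be `1 / 0 = 0`, but a modulus is positive. -/
theorem mixingTime_ne_zero : mixingTime M ≠ 0 := by
  intro h0
  have := (h.modulus uniformPolicy).1
  simp [h0] at this

theorem one_le_mixingTime : (1 : ℝ) ≤ mixingTime M := by
  exact_mod_cast Nat.one_le_iff_ne_zero.2 h.mixingTime_ne_zero

theorem cbar_nonneg : 0 ≤ cbar := by
  obtain ⟨s⟩ := ‹Nonempty S›
  obtain ⟨a⟩ := ‹Nonempty A›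
  exact (abs_nonneg _).trans (h.cost_le s a)

/-- Test the Gram form on a coordinate vector, which exists since `0 < d`; unit features and unit
total weight bound it by 1. -/
theorem mu_le_one : μ ≤ 1 := by
  let θ : Fin d → ℝ := Pi.single ⟨0, h.dim_pos⟩ 1
  have h1 : θ ⬝ᵥ θ = 1 := by simp [θ]
  have h2 := h.gram uniformPolicy θ
  rw [h1, mul_one, normSq_eq] at h2
  have h3 : nrm θ = 1 := by
    have := nrm_sq θ
    rw [h1] at this
    rw [← Real.sqrt_sq (nrm_nonneg θ), this, Real.sqrt_one]
  refine h2.trans ?_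
  calc _ ≤ ∑ x, weight M uniformPolicy (perturb (u uniformPolicy) uniformPolicy) x * 1 := by
        refine sum_le_sum fun x _ => mul_le_mul_of_nonneg_left ?_ (weight_nonneg M _ _ x)
        rw [sq_le_one_iff_abs_le_one]
        refine (abs_dotProduct_le (Ψ x) θ).trans ?_
        have h4 := h.feature_le x
        rw [← nrm_sq] at h4
        rw [h3, mul_one]
        nlinarith [nrm_nonneg (Ψ x)]
    _ = 1 := by simp only [mul_one, sum_weight]

theorem card_mul_le : (Fintype.card (S × A) : ℝ) * ℓ ≤ 1 := by
  rw [← sum_weight M uniformPolicy (perturb (u uniformPolicy) uniformPolicy), ← nsmul_eq_mul,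
    ← card_univ, ← sum_const]
  exact sum_le_sum fun x _ => h.l_le uniformPolicy x

theorem l_le_one : ℓ ≤ 1 := by
  have h1 := h.card_mul_le
  have h2 : (1 : ℝ) ≤ Fintype.card (S × A) := by exact_mod_cast Fintype.card_pos
  nlinarith [h.l_pos]

theorem l_le_stationary (π : Policy S A) (s : S) : ℓ ≤ stationary M π s := by
  obtain ⟨a⟩ := ‹Nonempty A›
  refine (h.l_le π (s, a)).trans ?_
  exact mul_le_of_le_one_right (stationary_nonneg M π s) (stdSimplex.le_one _ _)

theorem l_le_iInf (π : Policy S A) : ℓ ≤ ⨅ x, weight M π (perturb (u π) π) x :=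
  le_ciInf (h.l_le π)

theorem log_card_le : Real.log (Fintype.card A) ≤ Real.log (1 / ℓ) := by
  refine Real.log_le_log (by exact_mod_cast Fintype.card_pos) ?_
  rw [le_div_iff₀ h.l_pos]
  refine le_trans (mul_le_mul_of_nonneg_right ?_ h.l_pos.le) h.card_mul_le
  rw [Fintype.card_prod]
  exact_mod_cast Nat.le_mul_of_pos_left _ Fintype.card_pos

theorem selectedModulus_pos : 0 < selectedModulus M χ := by
  have := h.one_le_mixingTime
  have := h.chi_pos
  rw [selectedModulus]; positivity

/-- The perturbed form has the modulus `min (b / 2) (1 / 4)` with `b ≥ 1 / (χ t_mix)`; the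
denominator `(4 + 2 χ) t_mix` is chosen to stay below both. As all stationary masses are at least
`ℓ`, an absolute mixing error `δ ℓ` is a relative error `δ`. -/
theorem criticSetting {δ : ℝ} {n : ℕ} (hδ : 0 ≤ δ) (hδb : δ ≤ selectedModulus M χ / 1000)
    (hn : 4 * mixingRate M ^ n ≤ δ * ℓ) (π : Policy S A) :
    CriticSetting M Ψ π (perturb (u π) π) (selectedModulus M χ) μ cbar δ n := by
  have ht := h.one_le_mixingTime
  have hχ := h.chi_pos
  obtain ⟨b, δ', hb, hmod, hpert⟩ := (h.exploration π).exists_perturbed (h.modulus π)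
    fun s => h.l_pos.trans_le (h.l_le_stationary π s)
  have hb4 : selectedModulus M χ ≤ 1 / 4 := by
    refine one_div_le_one_div_of_le (by norm_num) ?_
    nlinarith
  have hb2 : selectedModulus M χ ≤ b / 2 := by
    have e : selectedModulus M χ ≤ 1 / (2 * (χ * mixingTime M)) := by
      refine one_div_le_one_div_of_le (by positivity) ?_
      nlinarith
    have e2 : 1 / (2 * (χ * mixingTime M)) = 1 / (χ * mixingTime M) / 2 := by
      field_simp
    rw [e2] at e
    linarith
  refine ⟨h.feature_le, fun x => h.cost_le x.1 x.2,
    (hpert.isModulus hmod).mono h.selectedModulus_pos (le_min hb2 hb4), by linarith, h.mu_pos,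
    h.mu_le_one, h.gram π, hpert.sum_nextMean_sq_le hmod, hδ, hδb, fun m hm s s' => ?_⟩
  have h1 := (isMixingRate_mixingRate h.ergodic h.mixingTime_ne_zero).2.2.2 π m s
  have h2 : mixingRate M ^ m ≤ mixingRate M ^ n :=
    pow_le_pow_of_le_one mixingRate_pos.le (mixingRate_lt_one h.mixingTime_ne_zero).le hm
  have h3 := single_le_sum (f := fun s' => |(stateMatrix M π ^ m) s s' - stationary M π s'|)
    (fun s' _ => abs_nonneg _) (mem_univ s')
  have h4 := mul_le_mul_of_nonneg_left (h.l_le_stationary π s') hδ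
  linarith

/-! #### Scales -/

variable {ε : ℝ} (hε : 0 < ε)
include hε

theorem two_mul_le_logArg : 2 * mixingTime M / (μ * ℓ) ≤ logArg M cbar μ ℓ ε := by
  have := h.mu_pos
  have := h.l_pos
  have := div_nonneg h.cbar_nonneg hε.le
  have := h.one_le_mixingTime
  rw [logArg, mul_comm 2]
  gcongr
  linarith

theorem one_div_l_le : 1 / ℓ ≤ logArg M cbar μ ℓ ε := by
  have h1 := h.mu_pos
  have h2 := h.l_pos
  refine le_trans ?_ (h.two_mul_le_logArg hε)
  rw [div_le_div_iff₀ h2 (by positivity), one_mul]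
  have h3 := h.mu_le_one
  have h4 := h.one_le_mixingTime
  exact mul_le_mul_of_nonneg_right (by linarith) h2.le

theorem mixingTime_div_mu_le : mixingTime M / μ ≤ logArg M cbar μ ℓ ε := by
  have h1 := h.mu_pos
  have h2 := h.l_pos
  refine le_trans ?_ (h.two_mul_le_logArg hε)
  have h3 := h.l_le_one
  have h4 := h.one_le_mixingTime
  rw [div_le_div_iff₀ h1 (by positivity)]
  have : (mixingTime M : ℝ) * (μ * ℓ) ≤ mixingTime M * (μ * 2) := by gcongr; linarith
  linarith

theorem two_le_logArg : 2 ≤ logArg M cbar μ ℓ ε := by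
  have h1 := h.mu_pos
  have h2 := h.l_pos
  refine le_trans ?_ (h.two_mul_le_logArg hε)
  rw [le_div_iff₀ (by positivity)]
  have h3 : μ * ℓ ≤ 1 := mul_le_one₀ h.mu_le_one h2.le h.l_le_one
  have h4 := h.one_le_mixingTime
  linarith

theorem add_le_logArg_mul : cbar + ε ≤ logArg M cbar μ ℓ ε * ε := by
  have h1 := h.mu_pos
  have h2 := h.l_pos
  have h3 : μ * ℓ ≤ 1 := mul_le_one₀ h.mu_le_one h2.le h.l_le_one
  have h4 := h.one_le_mixingTime
  have h5 := div_nonneg h.cbar_nonneg hε.le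
  have h6 : 2 + cbar / ε ≤ logArg M cbar μ ℓ ε := by
    rw [logArg, le_div_iff₀ (by positivity)]
    have e1 : (2 + cbar / ε) * (μ * ℓ) ≤ (2 + cbar / ε) * 1 := by gcongr
    have e2 : 1 * (2 + cbar / ε) ≤ mixingTime M * (2 + cbar / ε) := by gcongr
    linarith
  have h7 := mul_le_mul_of_nonneg_right h6 hε.le
  have h8 : (2 + cbar / ε) * ε = 2 * ε + cbar := by field_simp
  linarith

theorem scale {D : ℕ} (hD : 4 + 2 * χ ≤ 2 ^ D) :
    Scale (logArg M cbar μ ℓ ε) (selectedModulus M χ) μ ℓ D := by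
  have hμ := h.mu_pos
  have ht := h.one_le_mixingTime
  have hχ := h.chi_pos
  set X := logArg M cbar μ ℓ ε
  have hX : 2 ≤ X := h.two_le_logArg hε
  have htμ : mixingTime M / μ ≤ X := h.mixingTime_div_mu_le hε
  have htX : (mixingTime M : ℝ) ≤ X := by
    refine le_trans ?_ htμ
    rw [le_div_iff₀ hμ]
    nlinarith [h.mu_le_one]
  refine ⟨hX, h.selectedModulus_pos, ?_, hμ, h.mu_le_one, h.l_pos, h.one_div_l_le hε, ?_, ?_⟩
  · rw [selectedModulus]
    refine div_le_one_of_le₀ ?_ (by positivity)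
    nlinarith
  · have e : 1 / (μ * selectedModulus M χ) = (4 + 2 * χ) * (mixingTime M / μ) := by
      rw [selectedModulus]; field_simp
    rw [e]
    have e1 : (4 + 2 * χ) * (mixingTime M / μ) ≤ (4 + 2 * χ) * X ^ 1 := by
      rw [pow_one]; gcongr
    exact e1.trans (mul_pow_le_pow hX hD 1)
  · have e : 1 / (μ * selectedModulus M χ ^ 2) =
        (4 + 2 * χ) ^ 2 * (mixingTime M * (mixingTime M / μ)) := by
      rw [selectedModulus]; field_simp
    rw [e, mul_add, mul_one]
    have e1 : (4 + 2 * χ) ^ 2 ≤ 2 ^ (2 * D) := by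
      rw [mul_comm 2 D, pow_mul]; gcongr
    have e2 : (mixingTime M : ℝ) * (mixingTime M / μ) ≤ X ^ 2 := by
      rw [sq]; gcongr
    exact (mul_le_mul_of_nonneg_left e2 (sq_nonneg _)).trans (mul_pow_le_pow hX e1 2)

end Setting

/-- The number of skipped steps in the parameter selection. -/
def skippedSteps (M : Model S A) (D : ℕ) (X : ℝ) : ℕ :=
  mixingTime M * ⌈2 * (6 * D + 53) * Real.log X⌉₊

/-- The parameter selection for the scale `X`. -/
def selectedParams (M : Model S A) (χ μ : ℝ) (D : ℕ) (X : ℝ) : Params :=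
  criticParams (selectedModulus M χ) μ ⌈2 * (D + 7) * Real.log X⌉₊ (skippedSteps M D X)

/-! ### The selected parameters: admissibility, bias, second moment and cost -/

namespace Setting

variable [Nonempty S] [Nonempty A] {M : Model S A} {Ψ : Matrix (S × A) (Fin d) ℝ}
  {u : Policy S A → ℝ} {cbar μ ℓ χ : ℝ} (h : Setting M Ψ u cbar μ ℓ χ)
  {ε : ℝ} (hε : 0 < ε) {D : ℕ} (hD : 4 + 2 * χ ≤ 2 ^ D)
include h hε

local notation "X" => logArg M cbar μ ℓ ε
local notation "𝔭" => selectedParams M χ μ D X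

theorem log_pos : 1 / 2 < Real.log X := by
  have h1 := Real.log_le_log two_pos (h.two_le_logArg hε)
  have := Real.log_two_gt_d9
  linarith

theorem mixingRate_pow_le : mixingRate M ^ skippedSteps M D X ≤ (X ^ (6 * D + 53))⁻¹ := by
  have h1 : 1 ≤ X := by linarith [h.two_le_logArg hε]
  rw [skippedSteps, pow_mul, mixingRate_pow h.mixingTime_ne_zero]
  exact half_pow_le h1 (by push_cast; exact Nat.le_ceil _)

include hD

theorem criticSetting_selected (π : Policy S A) :
    CriticSetting M Ψ π (perturb (u π) π) (selectedModulus M χ) μ cbar (X ^ (6 * D + 50))⁻¹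
      (skippedSteps M D X) := by
  have sc := h.scale hε hD
  have hX := sc.pos
  refine h.criticSetting (by positivity) ?_ ?_ π
  · exact sc.pow_inv_le_div (i := 10) (by norm_num) (by norm_num) sc.b_pos sc.inv_b_le (by omega)
  · have h1 := h.mixingRate_pow_le hε (D := D)
    -- The three powers by which the mixing error `6 D + 53` exceeds `6 D + 50` pay for the mixing
    -- constant 4 and for the passage from absolute to relative error.
    have h2 : 4 * (X ^ 3)⁻¹ ≤ ℓ := by
      have := sc.pow_inv_le_div (q := 3) (i := 2) (j := 1) (a := 4) (y := ℓ) (by norm_num)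
        (by norm_num) sc.l_pos (by rw [pow_one]; exact sc.inv_l_le) (by omega)
      linarith
    rw [show 6 * D + 53 = 6 * D + 50 + 3 by ring, pow_add, mul_inv] at h1
    have h3 := mul_le_mul_of_nonneg_left h2 (show 0 ≤ (X ^ (6 * D + 50))⁻¹ by positivity)
    linarith

theorem goodParams_selected :
    GoodParams (selectedModulus M χ) μ (X ^ (6 * D + 50))⁻¹ (skippedSteps M D X) 𝔭 :=
  (h.scale hε hD).goodParams (by omega)

open scoped Matrix.Norms.L2Operator in
omit hD in
theorem biasConst_le (π : Policy S A) : biasConst M Ψ π (perturb (u π) π) 4 ≤ X ^ 5 := by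
  have hX := h.two_le_logArg hε
  have hℓ := h.l_pos
  set m := (Fintype.card (S × A) : ℝ) with hm
  have hm0 : 0 ≤ m := Nat.cast_nonneg _
  have h1 : ‖Ψ‖ ≤ √m := l2_opNorm_le_of_feature_le h.feature_le
  have h2 : ‖1 - pairMatrix M π‖ ≤ √m * 2 := l2_opNorm_one_sub_le (pairMatrix_mem M π)
  have h3 : ℓ ≤ √(⨅ x, weight M π (perturb (u π) π) x) := by
    refine Real.le_sqrt_of_sq_le (le_trans ?_ (h.l_le_iInf π))
    rw [sq]
    exact mul_le_of_le_one_left hℓ.le h.l_le_one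
  have h4 : m ≤ 1 / ℓ := by
    rw [le_div_iff₀ hℓ]; exact h.card_mul_le
  have h5 := h.one_div_l_le hε
  calc biasConst M Ψ π (perturb (u π) π) 4 ≤ 4 / ℓ * √m * (√m * 2) := by
        rw [biasConst]; gcongr
    _ = 8 * (1 / ℓ) * (√m * √m) := by ring
    _ = 8 * (1 / ℓ) * m := by rw [Real.mul_self_sqrt hm0]
    _ ≤ 8 * X * X := by gcongr; exact h4.trans h5
    _ = 8 * X ^ 2 := by ring
    _ ≤ X ^ (3 + 2) := mul_pow_le_pow hX (by norm_num) 2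

open scoped Matrix.Norms.L2Operator in
-- The analysis works with a smaller step size and larger batches than admissibility demands. The
-- conditions on the skipped steps hold because `ϱ ^ τ` is below a power of `X` that dominates `1 /
-- ℓ`, `1 / (μ b)` and the norms of the features.
theorem isSelection_selected (π : Policy S A) :
    IsSelection M Ψ (u π) μ 4 (mixingRate M) π 𝔭 := by
  have sc := h.scale hε hD
  have hX := sc.pos
  have hb := sc.b_pos
  have hμ := sc.mu_pos
  have cs := h.criticSetting_selected hε hD π
  have hp := h.goodParams_selected hε hD
  have hbc := h.biasConst_le hε π
  have hrate := h.mixingRate_pow_le hε (D := D)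
  have hϱ0 := mixingRate_pos (M := M)
  have hϱ : mixingRate M ^ (skippedSteps M D X + 1) ≤ (X ^ (6 * D + 53))⁻¹ := by
    refine le_trans ?_ hrate
    exact pow_le_pow_of_le_one hϱ0.le (mixingRate_lt_one h.mixingTime_ne_zero).le (Nat.le_succ _)
  have hbc0 : 0 ≤ biasConst M Ψ π (perturb (u π) π) 4 := by rw [biasConst]; positivity
  refine ⟨selectedModulus M χ, cs.modulus, hp.eta_pos, hp.eta_le.trans ?_, hp.T_ge, ?_, ?_, ?_,
    ?_, ?_⟩
  · linarith
  · refine le_trans ?_ hp.N_ge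
    gcongr; norm_num
  · refine le_trans ?_ hp.N'_ge
    gcongr; norm_num
  · rw [hp.tau]
    have e1 : (X ^ (D + 48))⁻¹ ≤ μ * selectedModulus M χ / 10000 :=
      sc.pow_inv_le_div (i := 14) (by norm_num) (by norm_num) (by positivity) sc.inv_le (by omega)
    have e2 : μ ≤ √μ := Real.le_sqrt_of_sq_le (by
      rw [sq]; exact mul_le_of_le_one_left hμ.le sc.mu_le)
    calc _ ≤ X ^ 5 * (X ^ (6 * D + 53))⁻¹ := by gcongr
      _ = (X ^ (6 * D + 48))⁻¹ := by
        rw [show 6 * D + 53 = 5 + (6 * D + 48) by ring, pow_add]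
        field_simp
      _ ≤ (X ^ (D + 48))⁻¹ := by
        gcongr
        · exact sc.one_le
        · omega
      _ ≤ μ * selectedModulus M χ / 10000 := e1
      _ = μ * (selectedModulus M χ / 10000) := by ring
      _ ≤ √μ * (selectedModulus M χ / 10000) := by gcongr
  · rw [hp.tau']
    refine le_trans ?_ (h.l_le_iInf π)
    have e1 : (X ^ (6 * D + 53))⁻¹ ≤ ℓ / 4 :=
      sc.pow_inv_le_div (i := 2) (j := 1) (by norm_num) (by norm_num) sc.l_pos
        (by rw [pow_one]; exact sc.inv_l_le) (by omega)
    linarith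
  · rw [hp.tau']
    refine hϱ.trans ?_
    have hΨ : ‖Ψ‖ ≤ X := by
      have hm0 : (1 : ℝ) ≤ Fintype.card (S × A) := by exact_mod_cast Fintype.card_pos
      have f1 := l2_opNorm_le_of_feature_le h.feature_le
      have f2 : √(Fintype.card (S × A) : ℝ) ≤ Fintype.card (S × A) :=
        Real.sqrt_le_iff.2 ⟨by positivity, le_self_pow₀ hm0 two_ne_zero⟩
      have f3 : (Fintype.card (S × A) : ℝ) ≤ 1 / ℓ := by
        rw [le_div_iff₀ sc.l_pos]; exact h.card_mul_le
      exact f1.trans (f2.trans (f3.trans sc.inv_l_le))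
    have g1 : 4 ≤ X ^ 5 := by
      have := pow_le_pow_left₀ two_pos.le sc.two_le 5
      norm_num at this
      linarith
    have g2 : 4 * ‖Ψ‖ ≤ X ^ 5 := by
      calc 4 * ‖Ψ‖ ≤ 4 * X ^ 1 := by rw [pow_one]; gcongr
        _ ≤ X ^ (2 + 1) := mul_pow_le_pow sc.two_le (by norm_num) 1
        _ ≤ X ^ 5 := pow_le_pow_right₀ sc.one_le (by norm_num)
    have g3 : 4 * max 4 (max (biasConst M Ψ π (perturb (u π) π) 4) (4 * ‖Ψ‖)) + 1 ≤
        X ^ (6 * D + 53) := by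
      have f1 := max_le g1 (max_le hbc g2)
      calc _ ≤ 8 * X ^ 5 := by linarith
        _ ≤ X ^ (3 + 5) := mul_pow_le_pow sc.two_le (by norm_num) 5
        _ ≤ _ := pow_le_pow_right₀ sc.one_le (by omega)
    rw [one_div]
    refine inv_anti₀ ?_ g3
    have := le_max_left 4 (max (biasConst M Ψ π (perturb (u π) π) 4) (4 * ‖Ψ‖))
    linarith

/-- The bias of the critic. -/
theorem spanNorm_critic_le (π : Policy S A) (s : S) :
    spanNorm (fun x => expect (critic M Ψ (u π) 𝔭 π s 0) (fun r => r.1 x) - diffQ M π x) ≤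
      ε / 4 + spanNorm fun x => (Ψ *ᵥ thetaStar M Ψ (u π) π) x - diffQ M π x := by
  have sc := h.scale hε hD
  have cs := h.criticSetting_selected hε hD π
  have hp := h.goodParams_selected hε hD
  have hc := h.cbar_nonneg
  have hs : 0 < cbar + ε := by linarith
  have hlog := h.log_pos hε
  refine cs.spanNorm_critic_sub_le (fun z => ?_) s
  refine (cs.nrm_runEpochs_bias_le hp hc hs z).trans ?_
  exact sc.bias_le hε hs (h.add_le_logArg_mul hε) hc (by linarith) (nrm_nonneg _)
    cs.nrm_thetaStar_le (Nat.le_ceil _) (Nat.ceil_lt_add_one (by positivity)).le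

theorem exists_nrm_thetaStar_le : ∃ B, ∀ π : Policy S A, nrm (thetaStar M Ψ (u π) π) ≤ B :=
  ⟨_, fun π => (h.criticSetting_selected hε hD π).nrm_thetaStar_le⟩

/-- The supremum dominates its terms only if it is bounded. The solutions `θ*` and the differential
Q-functions have bounds uniform in the policy. -/
theorem le_approxError (π : Policy S A) :
    spanNorm (fun x => (Ψ *ᵥ thetaStar M Ψ (u π) π) x - diffQ M π x) ≤ approxError M Ψ u := by
  obtain ⟨B, hB⟩ := h.exists_nrm_thetaStar_le hε hD
  have hm := isMixingRate_mixingRate h.ergodic h.mixingTime_ne_zero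
  refine le_ciSup (f := fun π : Policy S A =>
    spanNorm fun x => (Ψ *ᵥ thetaStar M Ψ (u π) π) x - diffQ M π x)
    ⟨B + (2 * cbar + 2 * cbar * (4 * (1 - mixingRate M)⁻¹)), ?_⟩ π
  rintro _ ⟨π, rfl⟩
  have h1 : ‖fun x => diffQ M π x‖ ≤ 2 * cbar + 2 * cbar * (4 * (1 - mixingRate M)⁻¹) := by
    have hb := abs_diffQ_le (π := π) h.cost_le hm
    refine (pi_norm_le_iff_of_nonneg ?_).2 hb
    exact (abs_nonneg _).trans (hb (Classical.arbitrary _))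
  have h2 := ((h.criticSetting_selected hε hD π).norm_mulVec_le _).trans (hB π)
  have h3 := norm_sub_le (Ψ *ᵥ thetaStar M Ψ (u π) π) (fun x => diffQ M π x)
  exact (spanNorm_le_norm _).trans (h3.trans (by linarith))

/-- The bound of the second moment of the critic. -/
theorem criticSecondMoment_selected_le {C : ℝ} (hC : 2 ≤ C) (π : Policy S A) (s : S) :
    criticSecondMoment M Ψ (u π) 𝔭 π s ≤
      2 * (⨆ π' : Policy S A, ‖Ψ.mulVec (thetaStar M Ψ (u π') π')‖ ^ 2) +
      C * ⨆ π' : Policy S A,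
        (cbar ^ 2 + thetaStar M Ψ (u π') π' ⬝ᵥ thetaStar M Ψ (u π') π') /
          (⨅ x, weight M π' (perturb (u π') π') x) := by
  obtain ⟨B, hB⟩ := h.exists_nrm_thetaStar_le hε hD
  have cs := h.criticSetting_selected hε hD
  have hω : ∀ π, 0 < ⨅ x, weight M π (perturb (u π) π) x := fun π =>
    h.l_pos.trans_le (h.l_le_iInf π)
  have h1 := (cs π).criticSecondMoment_le (h.goodParams_selected hε hD) (hω π)
    (fun x => ciInf_le (Set.finite_range _).bddBelow x) s
  have hB2 : ∀ π, nrm (thetaStar M Ψ (u π) π) ^ 2 ≤ B ^ 2 := fun π =>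
    pow_le_pow_left₀ (nrm_nonneg _) (hB π) 2
  have h2 := le_ciSup (f := fun π' : Policy S A => ‖Ψ.mulVec (thetaStar M Ψ (u π') π')‖ ^ 2)
    ⟨B ^ 2, by
      rintro _ ⟨π, rfl⟩
      exact (pow_le_pow_left₀ (norm_nonneg _) ((cs π).norm_mulVec_le _) 2).trans (hB2 π)⟩ π
  have h3 := le_ciSup (f := fun π' : Policy S A =>
      (cbar ^ 2 + thetaStar M Ψ (u π') π' ⬝ᵥ thetaStar M Ψ (u π') π') /
          (⨅ x, weight M π' (perturb (u π') π') x))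
    ⟨(cbar ^ 2 + B ^ 2) / ℓ, by
      rintro _ ⟨π, rfl⟩
      simp only [← nrm_sq]
      exact div_le_div₀ (by positivity) (by linarith [hB2 π]) h.l_pos (h.l_le_iInf π)⟩ π
  have h4 : 0 ≤ (cbar ^ 2 + thetaStar M Ψ (u π) π ⬝ᵥ thetaStar M Ψ (u π) π) /
          (⨅ x, weight M π (perturb (u π) π) x) := by
    rw [← nrm_sq]
    exact div_nonneg (by positivity) (hω π).le
  have h5 := mul_le_mul hC h3 h4 (by linarith)
  linarith

/-- The number of samples of the critic. -/
theorem samples_le : (((𝔭).epochs * (𝔭).epochSamples : ℕ) : ℝ) ≤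
    (2 * D + 16) * (12 * D + 112) * (680003 * (4 + 2 * χ) ^ 2) *
      ((mixingTime M : ℝ) ^ 3 / μ) * Real.log X ^ 2 := by
  have sc := h.scale hε hD
  have hlog := h.log_pos hε
  have ht := h.one_le_mixingTime
  have hμ := h.mu_pos
  have hχ := h.chi_pos
  set L := Real.log X with hL
  set t := (mixingTime M : ℝ) with htd
  have h1 : ((𝔭).epochs : ℝ) ≤ (2 * D + 16) * L := by
    have := Nat.ceil_lt_add_one (show 0 ≤ 2 * ((D : ℝ) + 7) * L by positivity)
    change (⌈2 * ((D : ℝ) + 7) * L⌉₊ : ℝ) ≤ _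
    linarith
  have h2 : ((skippedSteps M D X : ℕ) : ℝ) + 2 ≤ t * ((12 * D + 112) * L) := by
    have := Nat.ceil_lt_add_one (show 0 ≤ 2 * (6 * (D : ℝ) + 53) * L by positivity)
    rw [skippedSteps, Nat.cast_mul]
    calc t * ((⌈2 * (6 * (D : ℝ) + 53) * L⌉₊ : ℕ) : ℝ) + 2
        ≤ t * (2 * (6 * (D : ℝ) + 53) * L + 1) + t * 2 := by gcongr; linarith
      _ = t * (2 * (6 * (D : ℝ) + 53) * L + 3) := by ring
      _ ≤ t * ((12 * D + 112) * L) := by gcongr; linarith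
  have h3 : (1 : ℝ) / (μ * selectedModulus M χ ^ 2) = (4 + 2 * χ) ^ 2 * (t ^ 2 / μ) := by
    rw [selectedModulus, htd]; field_simp
  have hN := sc.N_le (k := ⌈2 * ((D : ℝ) + 7) * L⌉₊) (n := skippedSteps M D X)
  have hT := sc.T_le (k := ⌈2 * ((D : ℝ) + 7) * L⌉₊) (n := skippedSteps M D X)
  have h4 : ((𝔭).epochSamples : ℝ) = (((𝔭).N : ℝ) + (𝔭).N + (𝔭).T) *
      ((skippedSteps M D X : ℕ) + 2) := by
    change (((((𝔭).N + (𝔭).N) * (skippedSteps M D X + 1 + 1) +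
      (𝔭).T * (skippedSteps M D X + 1 + 1) : ℕ)) : ℝ) = _
    push_cast
    ring
  -- The constant is `2 · 20001 + 640001`: two batches of equal size and the inner loop.
  have h5 : ((𝔭).N : ℝ) + (𝔭).N + (𝔭).T ≤ 680003 * ((4 + 2 * χ) ^ 2 * (t ^ 2 / μ)) := by
    rw [← h3]
    change ((𝔭).N : ℝ) ≤ _ at hN
    change ((𝔭).T : ℝ) ≤ _ at hT
    linarith
  rw [Nat.cast_mul, h4]
  calc _ ≤ ((2 * D + 16) * L) * ((680003 * ((4 + 2 * χ) ^ 2 * (t ^ 2 / μ))) *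
        (t * ((12 * D + 112) * L))) := by gcongr
    _ = _ := by ring

end Setting

end AMDP

end

/-! ### The theorem -/

open AMDP in
theorem corollary2 :
    -- universal constants
    ∃ (C : ℝ) (p : ℕ), 0 < C ∧
    -- the constant in the bound of `1 / (1 - β)` by the mixing time, and the constants in the
    -- number of epochs and of samples, which depend only on it
    ∀ χ : ℝ, 0 < χ → ∃ C' C'' : ℝ, 0 < C' ∧ 0 < C'' ∧
    ∀ (S A : Type) [Fintype S] [DecidableEq S] [Nonempty S] [Fintype A] [DecidableEq A]
      [Nonempty A] (M : Model S A) (cbar : ℝ) (d : ℕ) (Ψ : Matrix (S × A) (Fin d) ℝ)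
      (u : Policy S A → ℝ) (μ ℓ : ℝ),
    IsErgodic M →
    (∀ s a, |M.cost s a| ≤ cbar) →
    -- there is at least one feature, and the feature vectors have Euclidean norm at most one
    0 < d → (∀ x, Ψ x ⬝ᵥ Ψ x ≤ 1) →
    -- `1 / (1 - β) ≤ χ t_mix` for all policies
    (∀ π : Policy S A, IsModulus M Ψ π π (1 / (χ * mixingTime M))) →
    -- admissible exploration levels
    (∀ π : Policy S A, IsExploration M Ψ π (u π)) →
    -- `μ` bounds the smallest eigenvalue of the Gram matrix `Ψᵀ D̃ Ψ` from below, and `ℓ` that of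
    -- `D̃`, for all policies
    0 < μ → (∀ (π : Policy S A) (θ : Fin d → ℝ),
      μ * (θ ⬝ᵥ θ) ≤ normSq M Ψ π (perturb (u π) π) θ) →
    0 < ℓ → (∀ (π : Policy S A) (x : S × A), ℓ ≤ weight M π (perturb (u π) π) x) →
    ∀ ε : ℝ, 0 < ε →
    ∃ prm : Params,
      prm.epochs = ⌈C' * Real.log (logArg M cbar μ ℓ ε)⌉₊ ∧
      (∃ CP ϱ : ℝ, IsMixingRate M CP ϱ ∧
        ∀ π : Policy S A, IsSelection M Ψ (u π) μ CP ϱ π prm) ∧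
      -- the bound on the second moment of the critic
      (∀ (π : Policy S A) (s : S),
        criticSecondMoment M Ψ (u π) prm π s ≤
          2 * (⨆ π' : Policy S A, ‖Ψ.mulVec (thetaStar M Ψ (u π') π')‖ ^ 2) +
          C * ⨆ π' : Policy S A,
            (cbar ^ 2 + thetaStar M Ψ (u π') π' ⬝ᵥ thetaStar M Ψ (u π') π') /
              (⨅ x, weight M π' (perturb (u π') π') x)) ∧
      -- the complexity
      ∀ κ : ℝ, 0 < κ →
      ∃ (K : ℕ) (hK : 0 < K),
        (K : ℝ) ≤ 1 + C * (κ ^ 2 * Real.log (Fintype.card A) / ε ^ 2) ∧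
        ∀ s₀ : S,
          (∀ z ∈ (spmd M Ψ u prm (stepSize A κ K) s₀ K).support,
            (z.samples : ℝ) ≤ C'' * ((mixingTime M : ℝ) ^ 3 * (1 + κ ^ 2 / ε ^ 2) / μ) *
              Real.log (logArg M cbar μ ℓ ε) ^ p) ∧
          ((∀ k < K, ∀ z ∈ (spmd M Ψ u prm (stepSize A κ K) s₀ k).support,
              criticSecondMoment M Ψ (u z.policy) prm z.policy z.state ≤ κ ^ 2) →
            expect (spmdOutput M Ψ u prm (stepSize A κ K) s₀ K hK) (avgCost M) -
                (⨅ π : Policy S A, avgCost M π) ≤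
              C * approxError M Ψ u + ε) := by
  -- The constant 196 belongs to the number of iterations. The three logarithms come from the
  -- epochs, the skipped steps, and `log|𝒜|` in the number of iterations.
  refine ⟨196, 3, by norm_num, fun χ hχ => ?_⟩
  -- All dependence on `χ` is turned into powers of the scale by a single exponent `D`.
  obtain ⟨D, hD'⟩ := pow_unbounded_of_one_lt (4 + 2 * χ) (one_lt_two (α := ℝ))
  have hD := hD'.le
  refine ⟨2 * (D + 7), 196 * ((2 * D + 16) * (12 * D + 112) * (680003 * (4 + 2 * χ) ^ 2)),
    by positivity, by positivity, ?_⟩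
  intro S A _ _ _ _ _ _ M cbar d Ψ u μ ℓ hM hc hd hΨ hmod hexp hμ hgram hℓ hw ε hε
  have h : Setting M Ψ u cbar μ ℓ χ :=
    ⟨hM, hc, hd, hΨ, hχ, hmod, hexp, hμ, hgram, hℓ, hw⟩
  have hlog := h.log_pos hε
  have hrate := isMixingRate_mixingRate hM h.mixingTime_ne_zero
  set X := logArg M cbar μ ℓ ε with hX
  refine ⟨selectedParams M χ μ D X, rfl,
    ⟨4, mixingRate M, hrate, h.isSelection_selected hε hD⟩,
    h.criticSecondMoment_selected_le hε hD (by norm_num), fun κ hκ => ?_⟩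
  set y := κ ^ 2 * Real.log (Fintype.card A) / ε ^ 2 with hy
  have hcard : 0 ≤ Real.log (Fintype.card A) := Real.log_natCast_nonneg _
  have hy0 : 0 ≤ y := by positivity
  have hK := Nat.lt_floor_add_one (196 * y)
  have hK' := Nat.floor_le (show 0 ≤ 196 * y by positivity)
  have hKle : ((⌊196 * y⌋₊ + 1 : ℕ) : ℝ) ≤ 1 + 196 * y := by push_cast; linarith
  refine ⟨⌊196 * y⌋₊ + 1, Nat.succ_pos _, hKle, fun s₀ => ⟨fun z hz => ?_, fun hsm => ?_⟩⟩
  · have ht := h.one_le_mixingTime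
    have hsamp := h.samples_le hε hD
    have hlogA : Real.log (Fintype.card A) ≤ Real.log X :=
      h.log_card_le.trans (Real.log_le_log (by positivity) (h.one_div_l_le hε))
    have hy1 : y ≤ κ ^ 2 / ε ^ 2 * Real.log X := by
      rw [hy, mul_div_right_comm]
      gcongr
    have hKL : ((⌊196 * y⌋₊ + 1 : ℕ) : ℝ) ≤ 196 * ((1 + κ ^ 2 / ε ^ 2) * Real.log X) := by
      linarith
    rw [samples_spmd hz, Nat.cast_mul]
    refine (mul_le_mul hKL hsamp (Nat.cast_nonneg _) (by positivity)).trans (le_of_eq ?_)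
    ring
  · have happ : 0 ≤ approxError M Ψ u := Real.iSup_nonneg fun π => spanNorm_nonneg _
    -- A span bias of `ε / 4` plus the approximation error is doubled by the actor, which adds `ε /
    -- 2` of its own: `ε` plus twice the approximation error in total.
    have key := spmdOutput_le (s₀ := s₀) hc hrate (e := ε / 4 + approxError M Ψ u) (by positivity)
      (fun π s => (h.spanNorm_critic_le hε hD π s).trans
        (add_le_add_right (h.le_approxError hε hD π) _))
      hκ hε (Nat.succ_pos _) (by push_cast; exact hK.le) hsm
    have hinf := le_ciInf fun π => sub_le_comm.1 (key π)
    linarith
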